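/- Let $k$ be a field. Cochains of a group with values in $k^\times$ (trivial action) are written multiplicatively and are normalized, i.e. equal to $1$ when some argument is $1$. For a $3$-cochain $\omega$ put $$d\omega(x,y,z,t)=\omega(y,z,t)\,\omega(xy,z,t)^{-1}\,\omega(x,yz,t)\,\omega(x,y,zt)^{-1}\,\omega(x,y,z).$$ Let $Q$ be a group, $\pi\in Z^4(Q,k^\times)$ a normalized $4$-cocycle, $\rho:G\to Q$ a surjective homomorphism of groups with kernel $K$, and $\omega$ a normalized $3$-cochain on $G$ with $d\omega=\rho^*\pi$; then $\omega|_K$ is a normalized $3$-cocycle. Let $\mathcal C$ be a $k$-linear monoidal category with an action of $G$: linear monoidal autoequivalences $g_*$ $(g\in G)$ and monoidal natural isomorphisms $\chi_{g,h}:g_*h_*\to(gh)_*$ and $\nu:1_*\to\mathrm{id}$ satisfying the usual associativity and unit conditions. The twisted crossed product $\mathcal D=\mathcal C\rtimes_\omega K=\bigoplus_{\sigma\in K}\mathcal C_\sigma$ $(\mathcal C_\sigma=\mathcal C)$ is the following $k$-linear monoidal category. Its objects are the finite formal direct sums of homogeneous objects $[V,\sigma]$, $V\in\mathcal C$, $\sigma\in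 K$; $\mathrm{Hom}([V,\sigma],[W,\tau])$ is $\mathcal C(V,W)$ if $\sigma=\tau$ and $0$ otherwise, and morphisms of direct sums are matrices. The tensor product is the biadditive extension of $[V,\sigma]\otimes[W,\tau]=[V\otimes\sigma_*W,\sigma\tau]$, the unit is $[\mathbf 1,1]$, and the associator $[V,\sigma]\otimes([W,\tau]\otimes[Z,\upsilon])\to([V,\sigma]\otimes[W,\tau])\otimes[Z,\upsilon]$ is $\omega(\sigma,\tau,\upsilon)$ times the composite $$V\otimes\sigma_*(W\otimes\tau_*Z)\to V\otimes(\sigma_*W\otimes\sigma_*\tau_*Z)\xrightarrow{\chi_{\sigma,\tau}}V\otimes(\sigma_*W\otimes(\sigma\tau)_*Z)\to(V\otimes\sigma_*W)\otimes(\sigma\tau)_*Z.$$ Let $2\text{-}\mathrm{Aut}_\otimes(\mathcal D)$ be the monoidal $2$-category whose objects are the $k$-linear monoidal autoequivalences of $\mathcal D$ (with composition as tensor product), whose $1$-morphisms $F\Rightarrow F'$ are the pseudonatural isomorphisms $(U,\chi)$, that is, a tensor-invertible object $U$ of $\mathcal D$ with isomorphisms $\chi_V:F(V)\otimes U\to U\otimes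 F'(V)$, natural in $V$ and compatible with the monoidal structures of $F$ and $F'$, and whose $2$-morphisms $(U,\chi)\Rightarrow(U',\chi')$ are the invertible modifications, that is, isomorphisms $\Gamma:U\to U'$ with $\chi'_V(F(V)\otimes\Gamma)=(\Gamma\otimes F'(V))\chi_V$ for all $V$. Scalars $k^\times$ act on $2$-morphisms by multiplication. Let $3\text{-}\mathrm{Gr}(Q,\pi)$ be the monoidal $2$-category whose objects are the elements of $Q$, with only identity $1$-morphisms, with $k^\times$ as the $2$-endomorphisms of each identity, with tensor product given by the multiplication of $Q$, and strict except that the pentagonator at $(q,r,s,t)$, from the composite of three associators $q(r(st))\to q((rs)t)\to(q(rs))t\to((qr)s)t$ to the composite of two $q(r(st))\to(qr)(st)\to((qr)s)t$, is the scalar $\pi(q,r,s,t)$. **Theorem.** There is a $\pi$-anomalous action of $Q$ on $\mathcal C\rtimes_\omega K$, that is, a $k^\times$-linear monoidal $2$-functor (trihomomorphism) $3\text{-}\mathrm{Gr}(Q,\pi)\to2\text{-}\mathrm{Aut}_\otimes(\mathcal C\rtimes_\omega K)$. Explicitly, there are linear monoidal autoequivalences $F(q)$ of $\mathcal D$ for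 $q\in Q$, pseudonatural isomorphisms $\chi_{q,r}:F(q)F(r)\Rightarrow F(qr)$ and $\iota:\mathrm{id}\Rightarrow F(1)$, and invertible modifications $$\Omega_{q,r,s}:\ \chi_{q,rs}\circ(1\otimes\chi_{r,s})\Rrightarrow\chi_{qr,s}\circ(\chi_{q,r}\otimes1),\qquad \gamma_q:\ \chi_{1,q}\circ(\iota\otimes1)\Rrightarrow1,\qquad \delta_q:\ \chi_{q,1}\circ(1\otimes\iota)\Rrightarrow1,$$ such that for all $q,r,s,t\in Q$, up to the structural isomorphisms of $2\text{-}\mathrm{Aut}_\otimes(\mathcal D)$, $$(\Omega_{q,r,s}1)\circ\Omega_{q,rs,t}\circ(1\Omega_{r,s,t})=\pi(q,r,s,t)\cdot\Omega_{qr,s,t}\circ\Omega_{q,r,st},$$ and such that $\delta_q\circ\Omega_{q,1,r}=\gamma_r$ as modifications $\chi_{q,r}\circ(1\otimes\chi_{1,r})\circ(1\otimes\iota\otimes1)\Rrightarrow\chi_{q,r}$ (whiskerings suppressed). -/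

import Mathlib

open CategoryTheory MonoidalCategory

set_option linter.unusedSectionVars false

noncomputable section

namespace Anomalous

universe v u w

/-! ### Normalized cochains with values in `kˣ` (trivial coefficients) -/

section Cochains

variable (G : Type*) [Group G] (M : Type*) [CommGroup M]

/-- Normalized `3`-cochains of `G` with values in the trivial module `M`, written
multiplicatively. -/
structure Cochain₃ where
  toFun : G → G → G → M
  normalized : ∀ x y z, x = 1 ∨ y = 1 ∨ z = 1 → toFun x y z = 1

instance : CoeFun (Cochain₃ G M) fun _ => G → G → G → M := ⟨Cochain₃.toFun⟩

/-- Normalized `4`-cochains of `G` with values in the trivial module `M`. -/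
structure Cochain₄ where
  toFun : G → G → G → G → M
  normalized : ∀ x y z t, x = 1 ∨ y = 1 ∨ z = 1 ∨ t = 1 → toFun x y z t = 1

instance : CoeFun (Cochain₄ G M) fun _ => G → G → G → G → M := ⟨Cochain₄.toFun⟩

variable {G M}

/-- The differential of a `3`-cochain. -/
def Cochain₃.d (ω : Cochain₃ G M) (x y z t : G) : M :=
  ω y z t * (ω (x * y) z t)⁻¹ * ω x (y * z) t * (ω x y (z * t))⁻¹ * ω x y z

/-- The differential of a `4`-cochain. -/
def Cochain₄.d (π : Cochain₄ G M) (x y z t s : G) : M :=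
  π y z t s * (π (x * y) z t s)⁻¹ * π x (y * z) t s * (π x y (z * t) s)⁻¹ *
    π x y z (t * s) * (π x y z t)⁻¹

variable (G M)

/-- Normalized `3`-cocycles, `Z³(G, M)`. -/
structure Cocycle₃ extends Cochain₃ G M where
  cocycle : ∀ x y z t, toCochain₃.d x y z t = 1

instance : CoeFun (Cocycle₃ G M) fun _ => G → G → G → M := ⟨fun θ => θ.toFun⟩

/-- Normalized `4`-cocycles, `Z⁴(G, M)`. -/
structure Cocycle₄ extends Cochain₄ G M where
  cocycle : ∀ x y z t s, toCochain₄.d x y z t s = 1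

instance : CoeFun (Cocycle₄ G M) fun _ => G → G → G → G → M := ⟨fun π => π.toFun⟩

variable {G M}

/-- If `dω = ρ^* π`, then `ω` restricts to a normalized `3`-cocycle on `ker ρ`. -/
def Cochain₃.restrictKer {Q : Type*} [Group Q] (ω : Cochain₃ G M) (ρ : G →* Q) (π : Cocycle₄ Q M)
    (h : ∀ x y z t, ω.d x y z t = π (ρ x) (ρ y) (ρ z) (ρ t)) : Cocycle₃ ρ.ker M where
  toFun x y z := ω x y z
  normalized x y z hx := ω.normalized _ _ _ (by simpa using hx)
  cocycle x y z t := by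
    refine (h x y z t).trans (π.normalized _ _ _ _ (Or.inl ?_))
    exact x.2

end Cochains

/-! ### Group actions on linear monoidal categories -/

variable (k : Type w) [Field k]

/-- An action of a group `G` on a `k`-linear monoidal category `C`. -/
structure GroupAction (G : Type*) [Group G] (C : Type u) [Category.{v} C] [Preadditive C]
    [Linear k C] [MonoidalCategory C] where
  /-- The autoequivalence `g_*`. -/
  act : G → C ⥤ C
  monoidal : ∀ g, (act g).Monoidal
  additive : ∀ g, (act g).Additive
  linear : ∀ g, (act g).Linear k
  isEquivalence : ∀ g, (act g).IsEquivalence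
  /-- The isomorphisms `χ_{g,h} : g_* ∘ h_* ≅ (gh)_*`. -/
  χ : ∀ g h, act h ⋙ act g ≅ act (g * h)
  χ_monoidal : ∀ g h, NatTrans.IsMonoidal (χ g h).hom
  /-- The isomorphism `ν : 1_* ≅ id`. -/
  ν : act 1 ≅ 𝟭 C
  ν_monoidal : NatTrans.IsMonoidal ν.hom
  /-- Associativity; `eqToHom` is the identity of `((gh)l)_* V = (g(hl))_* V`. -/
  assoc : ∀ g h l (V : C),
    (χ g h).hom.app ((act l).obj V) ≫ (χ (g * h) l).hom.app V ≫
        eqToHom (congrArg (fun x => (act x).obj V) (mul_assoc g h l)) =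
      (act g).map ((χ h l).hom.app V) ≫ (χ g (h * l)).hom.app V
  unit_left : ∀ g (V : C),
    (χ 1 g).hom.app V ≫ eqToHom (congrArg (fun x => (act x).obj V) (one_mul g)) = ν.hom.app ((act g).obj V)
  unit_right : ∀ g (V : C),
    (χ g 1).hom.app V ≫ eqToHom (congrArg (fun x => (act x).obj V) (mul_one g)) = (act g).map (ν.hom.app V)

attribute [instance] GroupAction.monoidal GroupAction.additive GroupAction.linear
  GroupAction.isEquivalence GroupAction.χ_monoidal GroupAction.ν_monoidal

variable {k}

namespace GroupAction

variable {G : Type*} [Group G] {C : Type u} [Category.{v} C] [Preadditive C]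
    [Linear k C] [MonoidalCategory C]

/-- Restriction of an action to a subgroup. -/
def restrict (A : GroupAction k G C) (H : Subgroup G) : GroupAction k H C where
  act h := A.act h
  monoidal h := A.monoidal h
  additive h := A.additive h
  linear h := A.linear h
  isEquivalence h := A.isEquivalence h
  χ g h := A.χ g h
  χ_monoidal g h := A.χ_monoidal g h
  ν := A.ν
  ν_monoidal := A.ν_monoidal
  assoc g h l V := A.assoc g h l V
  unit_left g V := A.unit_left g V
  unit_right g V := A.unit_right g V

/-- The identity `g_* V ⟶ g'_* V` for `g = g'`. -/
def cast (A : GroupAction k G C) {g g' : G} (h : g = g') (V : C) :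
    (A.act g).obj V ⟶ (A.act g').obj V :=
  eqToHom (by rw [h])

variable (A : GroupAction k G C)

@[simp]
lemma cast_rfl (g : G) (V : C) : A.cast (rfl : g = g) V = 𝟙 _ := rfl

@[simp]
lemma cast_trans {g h l : G} (e : g = h) (e' : h = l) (V : C) :
    A.cast e V ≫ A.cast e' V = A.cast (e.trans e') V := by
  subst e; subst e'; simp


lemma cast_naturality {g h : G} (e : g = h) {V W : C} (f : V ⟶ W) :
    A.cast e V ≫ (A.act h).map f = (A.act g).map f ≫ A.cast e W := by
  subst e; simp

lemma assoc_cast (g h l : G) (V : C) :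
    (A.χ g h).hom.app ((A.act l).obj V) ≫ (A.χ (g * h) l).hom.app V ≫
        A.cast (mul_assoc g h l) V =
      (A.act g).map ((A.χ h l).hom.app V) ≫ (A.χ g (h * l)).hom.app V :=
  A.assoc g h l V

lemma unit_left_cast (g : G) (V : C) :
    (A.χ 1 g).hom.app V ≫ A.cast (one_mul g) V = A.ν.hom.app ((A.act g).obj V) :=
  A.unit_left g V

lemma unit_right_cast (g : G) (V : C) :
    (A.χ g 1).hom.app V ≫ A.cast (mul_one g) V = (A.act g).map (A.ν.hom.app V) :=
  A.unit_right g V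

lemma χ_cast {g g' h h' : G} (e : g = g') (e' : h = h') (V : C) :
    (A.χ g h).hom.app V ≫ A.cast (congrArg₂ (· * ·) e e') V =
      A.cast e ((A.act h).obj V) ≫ (A.act g').map (A.cast e' V) ≫ (A.χ g' h').hom.app V := by
  subst e; subst e'; simp

end GroupAction

/-! ### Twisted crossed products -/

/-- The homogeneous objects `[V, g]` of the twisted crossed product `C ⋊_θ G`. -/
structure Homogeneous {G : Type*} [Group G] {C : Type u} [Category.{v} C] [Preadditive C]
    [Linear k C] [MonoidalCategory C] (A : GroupAction k G C) (θ : Cocycle₃ G kˣ) where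
  obj : C
  deg : G

namespace Homogeneous

variable {G : Type*} [Group G] {C : Type u} [Category.{v} C] [Preadditive C]
    [Linear k C] [MonoidalCategory C]
    {A : GroupAction k G C} {θ : Cocycle₃ G kˣ}

/-- The morphisms `[V, g] ⟶ [W, h]` are the morphisms `V ⟶ W` of `C` if `g = h`, and only `0`
otherwise. -/
def homs (X Y : Homogeneous A θ) : Submodule k (X.obj ⟶ Y.obj) where
  carrier := {f | X.deg ≠ Y.deg → f = 0}
  add_mem' hf hg h := by simp [hf h, hg h]
  zero_mem' _ := rfl
  smul_mem' a f hf h := by simp [hf h]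

instance : Category (Homogeneous A θ) where
  Hom X Y := homs X Y
  id X := ⟨𝟙 X.obj, fun h => absurd rfl h⟩
  comp {X Y Z} f g := ⟨f.1 ≫ g.1, fun h => by
    by_cases e : X.deg = Y.deg
    · rw [g.2 (fun e' => h (e.trans e')), Limits.comp_zero]
    · rw [f.2 e, Limits.zero_comp]⟩

@[ext]
lemma hom_ext {X Y : Homogeneous A θ} {f g : X ⟶ Y} (h : f.1 = g.1) : f = g := Subtype.ext h

@[simp] lemma id_val (X : Homogeneous A θ) : (𝟙 X : X ⟶ X).1 = 𝟙 X.obj := rfl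

@[simp] lemma comp_val {X Y Z : Homogeneous A θ} (f : X ⟶ Y) (g : Y ⟶ Z) :
    (f ≫ g).1 = f.1 ≫ g.1 := rfl

instance : Preadditive (Homogeneous A θ) where
  homGroup X Y := inferInstanceAs (AddCommGroup (homs X Y))
  add_comp _ _ _ f f' g := Subtype.ext (Preadditive.add_comp _ _ _ f.1 f'.1 g.1)
  comp_add _ _ _ f g g' := Subtype.ext (Preadditive.comp_add _ _ _ f.1 g.1 g'.1)

instance : Linear k (Homogeneous A θ) where
  homModule X Y := inferInstanceAs (Module k (homs X Y))
  smul_comp _ _ _ a f g := Subtype.ext (Linear.smul_comp _ _ _ a f.1 g.1)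
  comp_smul _ _ _ f a g := Subtype.ext (Linear.comp_smul _ _ _ f.1 a g.1)

@[simp] lemma zero_val (X Y : Homogeneous A θ) : (0 : X ⟶ Y).1 = 0 := rfl

@[simp] lemma add_val {X Y : Homogeneous A θ} (f g : X ⟶ Y) : (f + g).1 = f.1 + g.1 := rfl

@[simp] lemma smul_val {X Y : Homogeneous A θ} (a : k) (f : X ⟶ Y) : (a • f).1 = a • f.1 := rfl

/-- An isomorphism of `C` between the underlying objects, in equal degrees. -/
@[simps]
def mkIso {X Y : Homogeneous A θ} (e : X.obj ≅ Y.obj) (h : X.deg = Y.deg) : X ≅ Y where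
  hom := ⟨e.hom, fun h' => absurd h h'⟩
  inv := ⟨e.inv, fun h' => absurd h.symm h'⟩

variable (A) in
/-- The associativity isomorphism of the untwisted crossed product,
`V ⊗ g_*(W ⊗ h_* Z) ≅ (V ⊗ g_* W) ⊗ (gh)_* Z`. -/
def assoc₀ (V : C) (g : G) (W : C) (h : G) (Z : C) :
    V ⊗ (A.act g).obj (W ⊗ (A.act h).obj Z) ≅
      (V ⊗ (A.act g).obj W) ⊗ (A.act (g * h)).obj Z :=
  whiskerLeftIso V (Functor.Monoidal.μIso (A.act g) W ((A.act h).obj Z)).symm ≪≫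
    whiskerLeftIso V (whiskerLeftIso _ ((A.χ g h).app Z)) ≪≫ (α_ _ _ _).symm

/-- Multiplication by a unit of `k`, as an automorphism. -/
@[simps]
def scalarIso {D : Type*} [Category D] [Preadditive D] [Linear k D] (a : kˣ) (X : D) : X ≅ X where
  hom := (a : k) • 𝟙 X
  inv := ((a⁻¹ : kˣ) : k) • 𝟙 X


section Monoidal

variable [MonoidalPreadditive C] [MonoidalLinear k C]

open Classical in
instance : MonoidalCategoryStruct (Homogeneous A θ) where
  tensorObj X Y := ⟨X.obj ⊗ (A.act X.deg).obj Y.obj, X.deg * Y.deg⟩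
  whiskerLeft X Y Z f := ⟨X.obj ◁ (A.act X.deg).map f.1, fun h => by
    rw [f.2 (fun e => h (congrArg (X.deg * ·) e)), Functor.map_zero,
      MonoidalPreadditive.whiskerLeft_zero]⟩
  whiskerRight {X Y} f Z := ⟨if h : X.deg = Y.deg then f.1 ⊗ₘ A.cast h Z.obj else 0, fun h =>
    dif_neg (fun e => h (congrArg (· * Z.deg) e))⟩
  tensorUnit := ⟨𝟙_ C, 1⟩
  associator X Y Z := (scalarIso (θ X.deg Y.deg Z.deg) _ ≪≫
    mkIso (assoc₀ A X.obj X.deg Y.obj Y.deg Z.obj) (mul_assoc _ _ _).symm).symm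
  leftUnitor X := mkIso (whiskerLeftIso _ (A.ν.app X.obj) ≪≫ λ_ X.obj) (one_mul _)
  rightUnitor X := mkIso (whiskerLeftIso _ (Functor.Monoidal.εIso (A.act X.deg)).symm ≪≫ ρ_ X.obj)
    (mul_one _)

@[simp] lemma tensor_obj (X Y : Homogeneous A θ) :
    (X ⊗ Y).obj = X.obj ⊗ (A.act X.deg).obj Y.obj := rfl

@[simp] lemma tensor_deg (X Y : Homogeneous A θ) : (X ⊗ Y).deg = X.deg * Y.deg := rfl

@[simp] lemma unit_obj : (𝟙_ (Homogeneous A θ)).obj = 𝟙_ C := rfl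

@[simp] lemma unit_deg : (𝟙_ (Homogeneous A θ)).deg = 1 := rfl

@[simp] lemma whiskerLeft_val (X : Homogeneous A θ) {Y Z : Homogeneous A θ} (f : Y ⟶ Z) :
    (X ◁ f).1 = X.obj ◁ (A.act X.deg).map f.1 := rfl

lemma whiskerRight_val {X Y : Homogeneous A θ} (f : X ⟶ Y) (Z : Homogeneous A θ)
    (h : X.deg = Y.deg) : (f ▷ Z).1 = f.1 ⊗ₘ A.cast h Z.obj := dif_pos h

lemma whiskerRight_val₀ {V W : C} {g : G} (f : (⟨V, g⟩ : Homogeneous A θ) ⟶ ⟨W, g⟩)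
    (Z : Homogeneous A θ) : (f ▷ Z).1 = f.1 ▷ (A.act g).obj Z.obj := by
  rw [whiskerRight_val f Z rfl]
  simp

lemma hom_eq_zero {X Y : Homogeneous A θ} (f : X ⟶ Y) (h : X.deg ≠ Y.deg) : f = 0 :=
  hom_ext (f.2 h)

lemma tensorHom_val {X Y X' Y' : Homogeneous A θ} (f : X ⟶ Y) (g : X' ⟶ Y') :
    f ⊗ₘ g = f ▷ X' ≫ Y ◁ g := rfl

lemma associator_hom_val (X Y Z : Homogeneous A θ) :
    (α_ X Y Z).hom.1 = ((θ X.deg Y.deg Z.deg)⁻¹ : kˣ) •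
      ((α_ _ _ _).hom ≫ X.obj ◁ ((A.act X.deg).obj Y.obj ◁
        (A.χ X.deg Y.deg).inv.app Z.obj) ≫
        X.obj ◁ Functor.LaxMonoidal.μ (A.act X.deg) Y.obj ((A.act Y.deg).obj Z.obj)) := by
  change (assoc₀ A X.obj X.deg Y.obj Y.deg Z.obj).inv ≫
    ((((θ X.deg Y.deg Z.deg)⁻¹ : kˣ) : k) • 𝟙 _) = _
  simp [assoc₀, Units.smul_def]

lemma leftUnitor_hom_val (X : Homogeneous A θ) :
    (λ_ X).hom.1 = 𝟙_ C ◁ A.ν.hom.app X.obj ≫ (λ_ X.obj).hom := rfl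

lemma rightUnitor_hom_val (X : Homogeneous A θ) :
    (ρ_ X).hom.1 = X.obj ◁ Functor.OplaxMonoidal.η (A.act X.deg) ≫ (ρ_ X.obj).hom := rfl

lemma zero_whiskerRight' {X Y : Homogeneous A θ} (Z : Homogeneous A θ) :
    (0 : X ⟶ Y) ▷ Z = 0 := by
  ext
  by_cases h : X.deg = Y.deg
  · rw [whiskerRight_val _ _ h]; simp
  · exact dif_neg h

lemma whiskerLeft_zero' (X : Homogeneous A θ) {Y Z : Homogeneous A θ} :
    X ◁ (0 : Y ⟶ Z) = 0 := by
  ext; simp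

lemma pentagon_aux {F : C ⥤ C} [F.Monoidal] (X Y : C) {P P' R R' S T : C}
    (c : P' ⟶ F.obj P) (t : R ⟶ R') (d : R' ⟶ F.obj S) (e : S ⟶ T) {M : C} (m : P ⊗ T ⟶ M) :
    ((α_ X (F.obj Y) P').hom ≫ X ◁ F.obj Y ◁ c ≫ X ◁ Functor.LaxMonoidal.μ F Y P) ▷ R ≫
      (X ⊗ F.obj (Y ⊗ P)) ◁ t ≫ (α_ X (F.obj (Y ⊗ P)) R').hom ≫ X ◁ F.obj (Y ⊗ P) ◁ d ≫
      X ◁ Functor.LaxMonoidal.μ F (Y ⊗ P) S ≫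
      X ◁ F.map ((α_ Y P S).hom ≫ Y ◁ P ◁ e ≫ Y ◁ m) =
    (α_ (X ⊗ F.obj Y) P' R).hom ≫ (α_ X (F.obj Y) (P' ⊗ R)).hom ≫
      X ◁ F.obj Y ◁ ((c ⊗ₘ (t ≫ d ≫ F.map e)) ≫ Functor.LaxMonoidal.μ F P T ≫ F.map m) ≫
      X ◁ Functor.LaxMonoidal.μ F Y M := by
  have h : (F.obj Y ◁ c) ▷ R ≫ Functor.LaxMonoidal.μ F Y P ▷ R ≫ F.obj (Y ⊗ P) ◁ (t ≫ d) ≫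
      Functor.LaxMonoidal.μ F (Y ⊗ P) S ≫ F.map ((α_ Y P S).hom ≫ Y ◁ P ◁ e ≫ Y ◁ m) =
      (α_ _ _ _).hom ≫
      F.obj Y ◁ ((c ⊗ₘ (t ≫ d ≫ F.map e)) ≫ Functor.LaxMonoidal.μ F P T ≫ F.map m) ≫
      Functor.LaxMonoidal.μ F Y M := by
    rw [← whisker_exchange_assoc]
    simp only [Functor.map_comp, Functor.LaxMonoidal.associativity_assoc]
    rw [← whisker_exchange_assoc]
    have e1 : Functor.LaxMonoidal.μ F Y (P ⊗ S) ≫ F.map (Y ◁ P ◁ e) ≫ F.map (Y ◁ m) =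
        F.obj Y ◁ F.map (P ◁ e ≫ m) ≫ Functor.LaxMonoidal.μ F Y M := by
      rw [← Functor.map_comp, ← MonoidalCategory.whiskerLeft_comp,
        Functor.LaxMonoidal.μ_natural_right]
    rw [e1, MonoidalCategory.tensorHom_def]
    simp only [MonoidalCategory.whiskerLeft_comp, Category.assoc,
      associator_naturality_middle_assoc, associator_naturality_right_assoc,
      Functor.LaxMonoidal.μ_natural_right_assoc, Functor.map_comp]
    have e2 := congrArg (F.obj Y ◁ ·) (whisker_exchange c (t ≫ d))
    simp only [MonoidalCategory.whiskerLeft_comp, Category.assoc] at e2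
    rw [reassoc_of% e2]
  have h' := congrArg (fun z => (α_ X (F.obj Y) P').hom ▷ R ≫ (α_ _ _ _).hom ≫ X ◁ z) h
  simp only [MonoidalCategory.whiskerLeft_comp, MonoidalCategory.pentagon_assoc,
    Category.assoc] at h'
  simp only [MonoidalCategory.whiskerLeft_comp, comp_whiskerRight, Category.assoc]
  rw [← h']
  simp only [associator_naturality_middle_assoc, associator_naturality_right_assoc]

set_option maxHeartbeats 1000000 in
instance : MonoidalCategory (Homogeneous A θ) where
  tensorHom_def _ _ := rfl
  id_tensorHom_id X Y := by
    ext; rw [tensorHom_val, comp_val, whiskerRight_val _ _ rfl]; simp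
  whiskerLeft_id X Y := by ext; simp
  id_whiskerRight X Y := by ext; rw [whiskerRight_val _ _ rfl]; simp
  tensorHom_comp_tensorHom {X Y Z X' Y' Z'} f f' g g' := by
    by_cases e : X.deg = Y.deg
    · by_cases e' : Y.deg = Z.deg
      · obtain ⟨X, a⟩ := X
        obtain ⟨Y, b⟩ := Y
        obtain ⟨Z, c⟩ := Z
        obtain rfl : a = b := e
        obtain rfl : a = c := e'
        ext
        simp only [tensorHom_val, comp_val, whiskerLeft_val]
        rw [whiskerRight_val₀ f, whiskerRight_val₀ g, whiskerRight_val₀ (f ≫ g)]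
        simp [whisker_exchange_assoc]
      · simp [tensorHom_val, hom_eq_zero g e', zero_whiskerRight']
    · simp [tensorHom_val, hom_eq_zero f e, zero_whiskerRight']
  associator_naturality {X Y Z X' Y' Z'} f g h := by
    by_cases e : X.deg = X'.deg
    · by_cases e' : Y.deg = Y'.deg
      · obtain ⟨X, a⟩ := X
        obtain ⟨X', a'⟩ := X'
        obtain ⟨Y, b⟩ := Y
        obtain ⟨Y', b'⟩ := Y'
        obtain rfl : a = a' := e
        obtain rfl : b = b' := e'
        ext
        simp only [tensorHom_val, comp_val, whiskerLeft_val, associator_hom_val]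
        have key := whiskerRight_val₀ (A := A) (θ := θ) (g := a * b)
          (f ▷ (⟨Y, b⟩ : Homogeneous A θ) ≫ (⟨X', a⟩ : Homogeneous A θ) ◁ g) Z
        rw [comp_val, whiskerRight_val₀ f] at key
        rw [whiskerRight_val₀ f, whiskerRight_val₀ g, key]
        by_cases e'' : Z.deg = Z'.deg
        · obtain ⟨Z, c⟩ := Z
          obtain ⟨Z', c'⟩ := Z'
          obtain rfl : c = c' := e''
          simp
          rw [associator_naturality_left_assoc]
          simp only [whisker_exchange_assoc]
          refine congrArg (fun z => (α_ _ _ _).hom ≫ f.1 ▷ _ ≫ z) ?_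
          simp only [← MonoidalCategory.whiskerLeft_comp]
          congr 1
          have n := (A.χ a b).inv.naturality h.1
          rw [← whisker_exchange_assoc, ← whisker_exchange_assoc,
            ← MonoidalCategory.whiskerLeft_comp_assoc, n]
          simp only [Functor.comp_obj, Functor.comp_map, MonoidalCategory.whiskerLeft_comp,
            Category.assoc, Functor.LaxMonoidal.μ_natural_left,
            Functor.LaxMonoidal.μ_natural_right_assoc]
          rw [← Functor.map_comp, ← Functor.map_comp, whisker_exchange]
        · simp [hom_eq_zero h e'']
      · simp [tensorHom_val, hom_eq_zero g e', zero_whiskerRight', whiskerLeft_zero']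
    · simp [tensorHom_val, hom_eq_zero f e, zero_whiskerRight']
  leftUnitor_naturality {X Y} f := by
    ext
    have := A.ν.hom.naturality f.1
    simp only [comp_val, whiskerLeft_val, leftUnitor_hom_val, unit_obj, unit_deg, Category.assoc]
    rw [← whiskerLeft_comp_assoc, this]
    simp [-id_whiskerLeft, leftUnitor_naturality]
  rightUnitor_naturality {X Y} f := by
    by_cases e : X.deg = Y.deg
    · obtain ⟨X, g⟩ := X
      obtain ⟨Y, g'⟩ := Y
      obtain rfl : g = g' := e
      ext
      rw [comp_val, whiskerRight_val f _ rfl]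
      simp [rightUnitor_hom_val, ← whisker_exchange_assoc]
    · simp [hom_eq_zero f e, zero_whiskerRight']
  pentagon X Y Z W := by
    ext
    simp only [comp_val, whiskerLeft_val]
    rw [whiskerRight_val _ _ (mul_assoc _ _ _)]
    simp only [associator_hom_val, tensor_obj, tensor_deg]
    obtain ⟨X, g⟩ := X
    obtain ⟨Y, h⟩ := Y
    obtain ⟨Z, l⟩ := Z
    obtain ⟨W, m⟩ := W
    dsimp only
    have key := pentagon_aux (F := A.act g) (T := (A.act h).obj ((A.act l).obj W)) X Y ((A.χ g h).inv.app Z)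
      (A.cast (mul_assoc g h l) W) ((A.χ g (h * l)).inv.app W) ((A.χ h l).inv.app W)
      (Functor.LaxMonoidal.μ (A.act h) Z ((A.act l).obj W))
    have key₂ : ((A.χ g h).inv.app Z ⊗ₘ (A.cast (mul_assoc g h l) W ≫ (A.χ g (h * l)).inv.app W ≫
          (A.act g).map ((A.χ h l).inv.app W))) ≫
        Functor.LaxMonoidal.μ (A.act g) ((A.act h).obj Z) ((A.act h).obj ((A.act l).obj W)) ≫
          (A.act g).map (Functor.LaxMonoidal.μ (A.act h) Z ((A.act l).obj W)) =
        (A.act (g * h)).obj Z ◁ (A.χ (g * h) l).inv.app W ≫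
        Functor.LaxMonoidal.μ (A.act (g * h)) Z ((A.act l).obj W) ≫
          (A.χ g h).inv.app (Z ⊗ (A.act l).obj W) := by
      have a1 := A.assoc_cast g h l W
      have n1 := (NatTrans.IsMonoidal.tensor (τ := (A.χ g h).hom)) Z ((A.act l).obj W)
      have a2 : A.cast (mul_assoc g h l) W ≫ (A.χ g (h * l)).inv.app W ≫
          (A.act g).map ((A.χ h l).inv.app W) =
          (A.χ (g * h) l).inv.app W ≫ (A.χ g h).inv.app ((A.act l).obj W) := by
        rw [← cancel_epi ((A.χ g h).hom.app ((A.act l).obj W) ≫ (A.χ (g * h) l).hom.app W)]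
        simp only [Category.assoc]
        rw [reassoc_of% a1]
        simp [← Functor.map_comp]
      rw [a2, Functor.LaxMonoidal.comp_μ] at *
      have n2 := congrArg (fun z => ((A.χ g h).inv.app Z ⊗ₘ
        (A.χ g h).inv.app ((A.act l).obj W)) ≫ z ≫ (A.χ g h).inv.app (Z ⊗ (A.act l).obj W)) n1
      simp only [Category.assoc, Iso.hom_inv_id_app, tensorHom_comp_tensorHom_assoc,
        Iso.inv_hom_id_app, Functor.comp_obj, Category.comp_id, id_tensorHom_id,
        Category.id_comp] at n2
      rw [← n2, ← id_tensorHom, tensorHom_comp_tensorHom_assoc]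
      simp
    rw [key₂] at key
    rw [MonoidalCategory.tensorHom_def]
    simp only [Units.smul_def, Functor.map_smul, MonoidalLinear.whiskerLeft_smul,
      MonoidalLinear.smul_whiskerRight, Linear.smul_comp, Linear.comp_smul, smul_smul]
    simp only [MonoidalCategory.whiskerLeft_comp, Category.assoc] at key ⊢
    rw [key]
    simp only [tensor_whiskerLeft, Category.assoc, Iso.inv_hom_id_assoc]
    congr 1
    norm_cast
    have c := θ.cocycle g h l m
    have c' : θ g h l * θ g (h * l) m * θ h l m = θ (g * h) l m * θ g h (l * m) := by
      rw [Cochain₃.d] at c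
      rw [← mul_inv_eq_one, ← c]
      simp only [mul_inv]
      ac_rfl
    rw [← inv_inj]
    simp only [mul_inv, inv_inv]
    rw [mul_comm _ (θ g h l), ← mul_assoc, mul_right_comm, c', mul_comm]
  triangle X Y := by
    ext
    simp only [comp_val, whiskerLeft_val]
    rw [whiskerRight_val _ _ (mul_one _)]
    simp only [associator_hom_val, leftUnitor_hom_val, rightUnitor_hom_val, unit_obj, unit_deg]
    obtain ⟨X, g⟩ := X
    obtain ⟨Y, h⟩ := Y
    have e1 : (A.act g).map (A.ν.hom.app Y) = _ := (A.unit_right_cast g Y).symm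
    rw [θ.normalized _ _ _ (Or.inr (Or.inl rfl))]
    dsimp only
    rw [inv_one, one_smul, MonoidalCategory.tensorHom_def]
    simp only [Functor.map_comp, Functor.Monoidal.map_leftUnitor, Category.assoc,
      MonoidalCategory.whiskerLeft_comp, comp_whiskerRight]
    have e2 : Functor.LaxMonoidal.μ (A.act g) (𝟙_ C) ((A.act 1).obj Y) ≫
        (A.act g).map (𝟙_ C ◁ A.ν.hom.app Y) ≫
        Functor.OplaxMonoidal.δ (A.act g) (𝟙_ C) Y = (A.act g).obj (𝟙_ C) ◁
          (A.act g).map (A.ν.hom.app Y) := by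
      rw [← Functor.LaxMonoidal.μ_natural_right_assoc]
      simp
    simp only [← MonoidalCategory.whiskerLeft_comp]
    rw [reassoc_of% e2, ← MonoidalCategory.whiskerLeft_comp_assoc, e1]
    have e3 : (A.act g).obj (𝟙_ C) ◁ A.cast (mul_one g) Y ≫
        Functor.OplaxMonoidal.η (A.act g) ▷ (A.act g).obj Y ≫ (λ_ ((A.act g).obj Y)).hom =
        Functor.OplaxMonoidal.η (A.act g) ▷ (A.act (g * 1)).obj Y ≫ (λ_ _).hom ≫
        A.cast (mul_one g) Y := by
      rw [whisker_exchange_assoc, MonoidalCategory.leftUnitor_naturality]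
    rw [Iso.inv_hom_id_app_assoc, e3]
    change _ = (X ◁ Functor.OplaxMonoidal.η (A.act g)) ▷ (A.act (g * 1)).obj Y ≫
      (ρ_ X).hom ▷ (A.act (g * 1)).obj Y ≫ X ◁ A.cast (mul_one g) Y
    rw [← MonoidalCategory.triangle_assoc, associator_naturality_middle_assoc]
    simp only [MonoidalCategory.whiskerLeft_comp]

instance : MonoidalPreadditive (Homogeneous A θ) where
  whiskerLeft_zero := whiskerLeft_zero' _
  zero_whiskerRight := zero_whiskerRight' _
  whiskerLeft_add f g := by ext; simp
  add_whiskerRight {X Y Z} f g := by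
    by_cases e : Y.deg = Z.deg
    · ext
      rw [add_val, whiskerRight_val _ _ e, whiskerRight_val _ _ e, whiskerRight_val _ _ e]
      simp [MonoidalCategory.tensorHom_def]
    · simp [hom_eq_zero f e, hom_eq_zero g e, zero_whiskerRight']

instance : MonoidalLinear k (Homogeneous A θ) where
  whiskerLeft_smul X Y Z r f := by ext; simp
  smul_whiskerRight r {Y Z} f X := by
    by_cases e : Y.deg = Z.deg
    · ext
      rw [smul_val, whiskerRight_val _ _ e, whiskerRight_val _ _ e]
      simp [MonoidalCategory.tensorHom_def]
    · simp [hom_eq_zero f e]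

end Monoidal

end Homogeneous

/-! ### Formal finite direct sums -/

section DirectSums

variable {k : Type w} [Field k] {D : Type u} [Category.{v} D] [Preadditive D]

/-- The morphism of formal direct sums with given entries. -/
def matOf {M N : Mat_ D} (a : ∀ i j, M.X i ⟶ N.X j) : M ⟶ N := a

/-- The entries of a morphism of formal direct sums. -/
def entry {M N : Mat_ D} (f : M ⟶ N) (i : M.ι) (j : N.ι) : M.X i ⟶ N.X j := f i j

lemma mat_ext {M N : Mat_ D} {f g : M ⟶ N} (h : ∀ i j, entry f i j = entry g i j) : f = g :=
  Mat_.hom_ext _ _ h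

@[simp] lemma entry_matOf {M N : Mat_ D} (a : ∀ i j, M.X i ⟶ N.X j) (i j) :
    entry (matOf a) i j = a i j := rfl

lemma entry_comp {M N K : Mat_ D} (f : M ⟶ N) (g : N ⟶ K) (i l) :
    entry (f ≫ g) i l = ∑ j, entry f i j ≫ entry g j l := rfl

@[simp] lemma entry_id (M : Mat_ D) (i : M.ι) : entry (𝟙 M) i i = 𝟙 (M.X i) :=
  Mat_.id_apply_self M i

lemma entry_id_of_ne (M : Mat_ D) {i j : M.ι} (h : i ≠ j) : entry (𝟙 M) i j = 0 :=
  Mat_.id_apply_of_ne M i j h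

@[simp] lemma entry_zero {M N : Mat_ D} (i j) : entry (0 : M ⟶ N) i j = 0 := rfl

@[simp] lemma entry_add {M N : Mat_ D} (f g : M ⟶ N) (i j) :
    entry (f + g) i j = entry f i j + entry g i j := rfl

instance [Linear k D] : Linear k (Mat_ D) where
  homModule M N := inferInstanceAs (Module k (∀ i j, M.X i ⟶ N.X j))
  smul_comp _ _ _ r f g := mat_ext fun i l =>
    (Finset.sum_congr rfl fun j _ => Linear.smul_comp _ _ _ r (entry f i j) (entry g j l)).trans
      (Finset.smul_sum).symm
  comp_smul _ _ _ f r g := mat_ext fun i l =>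
    (Finset.sum_congr rfl fun j _ => Linear.comp_smul _ _ _ (entry f i j) r (entry g j l)).trans
      (Finset.smul_sum).symm

@[simp] lemma entry_smul [Linear k D] {M N : Mat_ D} (r : k) (f : M ⟶ N) (i j) :
    entry (r • f) i j = r • entry f i j := rfl

open Classical in
/-- The isomorphism of formal direct sums given by a bijection of the index sets and isomorphisms
of the corresponding entries. -/
def matIso {M N : Mat_ D} (e : M.ι ≃ N.ι) (φ : ∀ i, M.X i ≅ N.X (e i)) : M ≅ N where
  hom := matOf fun i j => if h : e i = j then (φ i).hom ≫ eqToHom (congrArg N.X h) else 0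
  inv := matOf fun j i => if h : e i = j then eqToHom (congrArg N.X h.symm) ≫ (φ i).inv else 0
  hom_inv_id := by
    refine mat_ext fun i i' => ?_
    rw [entry_comp, Finset.sum_eq_single (e i)]
    · by_cases h : i = i'
      · subst h; simp
      · simp [entry_id_of_ne _ h, Ne.symm h]
    · intro j _ hj
      simp [Ne.symm hj]
    · simp
  inv_hom_id := by
    refine mat_ext fun j j' => ?_
    obtain ⟨i, rfl⟩ := e.surjective j
    obtain ⟨i', rfl⟩ := e.surjective j'
    rw [entry_comp, Finset.sum_eq_single i]
    · by_cases h : i = i'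
      · subst h; simp
      · rw [entry_id_of_ne _ (fun h' => h (e.injective h'))]; simp [h]
    · intro l _ hl
      simp [hl]
    · simp

lemma entry_matIso_hom {M N : Mat_ D} (e : M.ι ≃ N.ι) (φ : ∀ i, M.X i ≅ N.X (e i)) (i : M.ι) :
    entry (matIso e φ).hom i (e i) = (φ i).hom := by simp [matIso]

lemma entry_matIso_hom_of_ne {M N : Mat_ D} (e : M.ι ≃ N.ι) (φ : ∀ i, M.X i ≅ N.X (e i)) (i : M.ι)
    (j : N.ι) (h : e i ≠ j) : entry (matIso e φ).hom i j = 0 := by simp [matIso, h]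

lemma entry_matIso_hom_comp {M N K : Mat_ D} (e : M.ι ≃ N.ι) (φ : ∀ i, M.X i ≅ N.X (e i))
    (f : N ⟶ K) (i : M.ι) (l : K.ι) :
    entry ((matIso e φ).hom ≫ f) i l = (φ i).hom ≫ entry f (e i) l := by
  rw [entry_comp, Finset.sum_eq_single (e i), entry_matIso_hom]
  · intro j _ hj
    rw [entry_matIso_hom_of_ne _ _ _ _ (Ne.symm hj), Limits.zero_comp]
  · simp

lemma entry_comp_matIso_hom {M N K : Mat_ D} (e : M.ι ≃ N.ι) (φ : ∀ i, M.X i ≅ N.X (e i))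
    (f : K ⟶ M) (l : K.ι) (i : M.ι) :
    entry (f ≫ (matIso e φ).hom) l (e i) = entry f l i ≫ (φ i).hom := by
  rw [entry_comp, Finset.sum_eq_single i, entry_matIso_hom]
  · intro j _ hj
    rw [entry_matIso_hom_of_ne _ _ _ _ (fun h => hj (e.injective h)), Limits.comp_zero]
  · simp

lemma eq_matIso_hom {M N : Mat_ D} (e : M.ι ≃ N.ι) (φ : ∀ i, M.X i ≅ N.X (e i)) {f : M ⟶ N}
    (h : ∀ i, entry f i (e i) = (φ i).hom) (h' : ∀ i j, e i ≠ j → entry f i j = 0) :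
    f = (matIso e φ).hom := by
  refine mat_ext fun i j => ?_
  by_cases hij : e i = j
  · subst hij
    rw [h, entry_matIso_hom]
  · rw [h' i j hij, entry_matIso_hom_of_ne _ _ _ _ hij]

lemma matIso_refl (M : Mat_ D) :
    (matIso (Equiv.refl M.ι) fun i => Iso.refl (M.X i)).hom = 𝟙 M :=
  (eq_matIso_hom _ _ (fun i => entry_id M i) fun _ _ h => entry_id_of_ne M h).symm

lemma matIso_trans {M N K : Mat_ D} (e : M.ι ≃ N.ι) (φ : ∀ i, M.X i ≅ N.X (e i))
    (e' : N.ι ≃ K.ι) (φ' : ∀ i, N.X i ≅ K.X (e' i)) :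
    (matIso e φ).hom ≫ (matIso e' φ').hom =
      (matIso (e.trans e') fun i => φ i ≪≫ φ' (e i)).hom := by
  refine eq_matIso_hom _ _ (fun i => ?_) (fun i j h => ?_)
  · rw [entry_matIso_hom_comp]
    exact congrArg ((φ i).hom ≫ ·) (entry_matIso_hom e' φ' (e i))
  · rw [entry_matIso_hom_comp, entry_matIso_hom_of_ne e' φ' (e i) j h, Limits.comp_zero]

lemma matIso_hom_congr {M N : Mat_ D} {e e' : M.ι ≃ N.ι} {φ : ∀ i, M.X i ≅ N.X (e i)}
    {φ' : ∀ i, M.X i ≅ N.X (e' i)} (h : ∀ i, e i = e' i)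
    (h' : ∀ i, (φ i).hom ≫ eqToHom (congrArg N.X (h i)) = (φ' i).hom) :
    (matIso e φ).hom = (matIso e' φ').hom := by
  obtain rfl : e = e' := Equiv.ext h
  refine eq_matIso_hom _ _ (fun i => ?_) fun i j hij => entry_matIso_hom_of_ne _ _ _ _ hij
  rw [entry_matIso_hom, ← h']
  simp

variable [MonoidalCategory D] [MonoidalPreadditive D]

/-- The tensor product of formal direct sums, `(⊕ X_i) ⊗ (⊕ Y_j) = ⊕ X_i ⊗ Y_j`. -/
instance : MonoidalCategoryStruct (Mat_ D) where
  tensorObj M N := ⟨M.ι × N.ι, fun p => M.X p.1 ⊗ N.X p.2⟩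
  tensorHom f g := matOf fun p q => entry f p.1 q.1 ⊗ₘ entry g p.2 q.2
  whiskerLeft M _ _ f := matOf fun p q => entry (𝟙 M) p.1 q.1 ⊗ₘ entry f p.2 q.2
  whiskerRight f N := matOf fun p q => entry f p.1 q.1 ⊗ₘ entry (𝟙 N) p.2 q.2
  tensorUnit := ⟨PUnit, fun _ => 𝟙_ D⟩
  associator M N K := matIso (Equiv.prodAssoc M.ι N.ι K.ι) fun p =>
    α_ (M.X p.1.1) (N.X p.1.2) (K.X p.2)
  leftUnitor M := matIso (Equiv.punitProd M.ι) fun p => λ_ (M.X p.2)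
  rightUnitor M := matIso (Equiv.prodPUnit M.ι) fun p => ρ_ (M.X p.1)

lemma associator_eq_matIso (M N K : Mat_ D) : α_ M N K = matIso
    (M := (M ⊗ N) ⊗ K) (N := M ⊗ (N ⊗ K)) (Equiv.prodAssoc M.ι N.ι K.ι)
    fun p => α_ (M.X p.1.1) (N.X p.1.2) (K.X p.2) := rfl

lemma leftUnitor_eq_matIso (M : Mat_ D) : λ_ M = matIso (M := 𝟙_ _ ⊗ M) (N := M)
    (Equiv.punitProd M.ι) fun p => λ_ (M.X p.2) := rfl

lemma rightUnitor_eq_matIso (M : Mat_ D) : ρ_ M = matIso (M := M ⊗ 𝟙_ _) (N := M)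
    (Equiv.prodPUnit M.ι) fun p => ρ_ (M.X p.1) := rfl

lemma entry_tensorHom {M N M' N' : Mat_ D} (f : M ⟶ N) (g : M' ⟶ N')
    (i : M.ι) (i' : M'.ι) (j : N.ι) (j' : N'.ι) :
    entry (f ⊗ₘ g) (i, i') (j, j') = entry f i j ⊗ₘ entry g i' j' := rfl

lemma entry_associator_hom_comp {M N K L : Mat_ D} (f : M ⊗ (N ⊗ K) ⟶ L) (i j l) (q) :
    entry ((α_ M N K).hom ≫ f) ((i, j), l) q = (α_ _ _ _).hom ≫ entry f (i, (j, l)) q :=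
  entry_matIso_hom_comp (M := (M ⊗ N) ⊗ K) (N := M ⊗ (N ⊗ K)) _ _ _ _ _

lemma entry_comp_associator_hom {M N K L : Mat_ D} (f : L ⟶ (M ⊗ N) ⊗ K) (i j l) (q) :
    entry (f ≫ (α_ M N K).hom) q (i, (j, l)) = entry f q ((i, j), l) ≫ (α_ _ _ _).hom :=
  entry_comp_matIso_hom (M := (M ⊗ N) ⊗ K) (N := M ⊗ (N ⊗ K)) (Equiv.prodAssoc M.ι N.ι K.ι) _ _ _
    ((i, j), l)

lemma entry_leftUnitor_hom_comp {M L : Mat_ D} (f : M ⟶ L) (a i q) :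
    entry ((λ_ M).hom ≫ f) (a, i) q = (λ_ _).hom ≫ entry f i q :=
  entry_matIso_hom_comp (M := 𝟙_ _ ⊗ M) (N := M) _ _ _ _ _

lemma entry_comp_leftUnitor_hom {M L : Mat_ D} (f : L ⟶ 𝟙_ _ ⊗ M) (i q) :
    entry (f ≫ (λ_ M).hom) q i = entry f q (PUnit.unit, i) ≫ (λ_ _).hom :=
  entry_comp_matIso_hom (M := 𝟙_ _ ⊗ M) (N := M) (Equiv.punitProd M.ι) _ _ _ (PUnit.unit, i)

lemma entry_rightUnitor_hom_comp {M L : Mat_ D} (f : M ⟶ L) (a i q) :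
    entry ((ρ_ M).hom ≫ f) (i, a) q = (ρ_ _).hom ≫ entry f i q :=
  entry_matIso_hom_comp (M := M ⊗ 𝟙_ _) (N := M) _ _ _ _ _

lemma entry_comp_rightUnitor_hom {M L : Mat_ D} (f : L ⟶ M ⊗ 𝟙_ _) (i q) :
    entry (f ≫ (ρ_ M).hom) q i = entry f q (i, PUnit.unit) ≫ (ρ_ _).hom :=
  entry_comp_matIso_hom (M := M ⊗ 𝟙_ _) (N := M) (Equiv.prodPUnit M.ι) _ _ _ (i, PUnit.unit)

lemma matIso_tensor {M N M' N' : Mat_ D} (e : M.ι ≃ N.ι) (φ : ∀ i, M.X i ≅ N.X (e i))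
    (e' : M'.ι ≃ N'.ι) (φ' : ∀ i, M'.X i ≅ N'.X (e' i)) :
    (matIso e φ).hom ⊗ₘ (matIso e' φ').hom =
      (matIso (M := M ⊗ M') (N := N ⊗ N') (Equiv.prodCongr e e')
        fun p => φ p.1 ⊗ᵢ φ' p.2).hom := by
  refine (eq_matIso_hom (M := M ⊗ M') (N := N ⊗ N') _ _ (fun p => ?_) (fun p q h => ?_))
  · exact congrArg₂ (· ⊗ₘ ·) (entry_matIso_hom e φ p.1) (entry_matIso_hom e' φ' p.2)
  · change entry (matIso e φ).hom p.1 q.1 ⊗ₘ entry (matIso e' φ').hom p.2 q.2 = 0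
    by_cases h1 : e p.1 = q.1
    · rw [entry_matIso_hom_of_ne e' φ' p.2 q.2 (fun h2 => h (Prod.ext h1 h2)),
        MonoidalPreadditive.tensor_zero]
    · rw [entry_matIso_hom_of_ne e φ p.1 q.1 h1, MonoidalPreadditive.zero_tensor]

lemma entry_id_prod (M N : Mat_ D) (i i' : M.ι) (j j' : N.ι) :
    entry (𝟙 (M ⊗ N)) (i, j) (i', j') = entry (𝟙 M) i i' ⊗ₘ entry (𝟙 N) j j' := by
  by_cases h : i = i'
  · subst h
    by_cases h' : j = j'
    · subst h'
      rw [entry_id, entry_id, entry_id, id_tensorHom_id]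
      rfl
    · rw [entry_id_of_ne N h', MonoidalPreadditive.tensor_zero]
      exact entry_id_of_ne (M ⊗ N) (fun e => h' (congrArg Prod.snd e))
  · rw [entry_id_of_ne M h, MonoidalPreadditive.zero_tensor]
    exact entry_id_of_ne (M ⊗ N) (fun e => h (congrArg Prod.fst e))

instance : MonoidalCategory (Mat_ D) := .ofTensorHom
  (id_tensorHom_id := fun M N => mat_ext fun p q => by
    obtain ⟨i, j⟩ := p
    obtain ⟨i', j'⟩ := q
    exact (entry_id_prod M N i i' j j').symm)
  (id_tensorHom := fun _ _ _ _ => rfl)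
  (tensorHom_id := fun _ _ => rfl)
  (tensorHom_comp_tensorHom := fun f₁ f₂ g₁ g₂ => by
    refine mat_ext fun ⟨i, j⟩ ⟨i', j'⟩ => ?_
    rw [entry_comp, entry_tensorHom, entry_comp, entry_comp, sum_tensor]
    simp only [tensor_sum]
    refine (Fintype.sum_prod_type _).trans ?_
    simp [entry_tensorHom])
  (associator_naturality := fun f g h => by
    refine mat_ext fun ⟨⟨i, j⟩, l⟩ ⟨i', ⟨j', l'⟩⟩ => ?_
    rw [entry_comp_associator_hom, entry_associator_hom_comp]
    simp only [entry_tensorHom]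
    exact MonoidalCategory.associator_naturality _ _ _)
  (leftUnitor_naturality := fun f => by
    refine mat_ext fun ⟨a, i⟩ i' => ?_
    rw [entry_comp_leftUnitor_hom, entry_leftUnitor_hom_comp, entry_tensorHom]
    have h : entry (𝟙 (𝟙_ (Mat_ D))) a PUnit.unit = 𝟙 (𝟙_ D) := entry_id (𝟙_ (Mat_ D)) a
    rw [h]
    refine Eq.trans ?_ (MonoidalCategory.leftUnitor_naturality (entry f i i'))
    exact congrArg (· ≫ (λ_ _).hom) (id_tensorHom (𝟙_ D) (entry f i i')))
  (rightUnitor_naturality := fun f => by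
    refine mat_ext fun ⟨i, a⟩ i' => ?_
    rw [entry_comp_rightUnitor_hom, entry_rightUnitor_hom_comp, entry_tensorHom]
    have h : entry (𝟙 (𝟙_ (Mat_ D))) a PUnit.unit = 𝟙 (𝟙_ D) := entry_id (𝟙_ (Mat_ D)) a
    rw [h]
    refine Eq.trans ?_ (MonoidalCategory.rightUnitor_naturality (entry f i i'))
    exact congrArg (· ≫ (ρ_ _).hom) (tensorHom_id (entry f i i') (𝟙_ D)))
  (pentagon := fun M N K L => by
    have h₁ : (α_ M N K).hom ⊗ₘ 𝟙 L = _ :=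
      (congrArg ((α_ M N K).hom ⊗ₘ ·) (matIso_refl L).symm).trans (matIso_tensor _ _ _ _)
    have h₂ : 𝟙 M ⊗ₘ (α_ N K L).hom = _ :=
      (congrArg (· ⊗ₘ (α_ N K L).hom) (matIso_refl M).symm).trans (matIso_tensor _ _ _ _)
    rw [h₁, h₂]
    refine ((congrArg _ (matIso_trans _ _ _ _)).trans (matIso_trans _ _ _ _)).trans
      (Eq.trans ?_ (matIso_trans _ _ _ _).symm)
    refine matIso_hom_congr (fun _ => rfl) fun p => ?_
    obtain ⟨⟨⟨a, b⟩, c⟩, d⟩ := p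
    refine (Category.comp_id _).trans ?_
    have := MonoidalCategory.pentagon (M.X a) (N.X b) (K.X c) (L.X d)
    rw [← tensorHom_id, ← id_tensorHom] at this
    exact this)
  (triangle := fun M N => by
    have h₁ : 𝟙 M ⊗ₘ (λ_ N).hom = _ :=
      (congrArg (· ⊗ₘ (λ_ N).hom) (matIso_refl M).symm).trans (matIso_tensor _ _ _ _)
    have h₂ : (ρ_ M).hom ⊗ₘ 𝟙 N = _ :=
      (congrArg ((ρ_ M).hom ⊗ₘ ·) (matIso_refl N).symm).trans (matIso_tensor _ _ _ _)
    rw [h₁, h₂]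
    refine (matIso_trans _ _ _ _).trans ?_
    refine matIso_hom_congr (fun _ => rfl) fun p => ?_
    obtain ⟨⟨a, b⟩, c⟩ := p
    refine (Category.comp_id _).trans ?_
    have := MonoidalCategory.triangle (M.X a) (N.X c)
    rw [← tensorHom_id, ← id_tensorHom] at this
    exact this)

instance : MonoidalPreadditive (Mat_ D) where
  whiskerLeft_zero := mat_ext fun _ _ => MonoidalPreadditive.tensor_zero _
  zero_whiskerRight := mat_ext fun _ _ => MonoidalPreadditive.zero_tensor _
  whiskerLeft_add _ _ := mat_ext fun _ _ => MonoidalPreadditive.tensor_add _ _ _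
  add_whiskerRight _ _ := mat_ext fun _ _ => MonoidalPreadditive.add_tensor _ _ _

instance [Linear k D] [MonoidalLinear k D] : MonoidalLinear k (Mat_ D) where
  whiskerLeft_smul X Y Z r f := mat_ext fun p q => by
    change (entry (𝟙 X) p.1 q.1 ⊗ₘ (r • entry f p.2 q.2)) =
      r • (entry (𝟙 X) p.1 q.1 ⊗ₘ entry f p.2 q.2)
    simp [MonoidalCategory.tensorHom_def]
  smul_whiskerRight r Y Z f X := mat_ext fun p q => by
    change ((r • entry f p.1 q.1) ⊗ₘ entry (𝟙 X) p.2 q.2) =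
      r • (entry f p.1 q.1 ⊗ₘ entry (𝟙 X) p.2 q.2)
    simp [MonoidalCategory.tensorHom_def]

end DirectSums

/-- The twisted crossed product `C ⋊_θ G = ⊕_g C_g`: its objects are the finite direct sums of
homogeneous objects `[V, g]`. -/
abbrev CrossedProduct {k : Type w} [Field k] {G : Type*} [Group G] {C : Type u} [Category.{v} C]
    [Preadditive C] [Linear k C] [MonoidalCategory C] (A : GroupAction k G C)
    (θ : Cocycle₃ G kˣ) :=
  Mat_ (Homogeneous A θ)

/-! ### The monoidal 2-category of autoequivalences -/

section TwoAut

open Functor.LaxMonoidal (μ ε)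
open Functor.OplaxMonoidal (δ η)

variable {D : Type u} [Category.{v} D] [MonoidalCategory D]

/-- A pseudonatural isomorphism `(U, χ) : F ⇒ G` between monoidal functors: an invertible object
`U` and isomorphisms `χ_V : F(V) ⊗ U ≅ U ⊗ G(V)`, natural in `V` and compatible with the monoidal
structures. -/
structure PseudonatIso (F G : D ⥤ D) [F.Monoidal] [G.Monoidal] where
  U : D
  invertible : ∃ U' : D, Nonempty (U ⊗ U' ≅ 𝟙_ D) ∧ Nonempty (U' ⊗ U ≅ 𝟙_ D)
  χ : ∀ V, F.obj V ⊗ U ≅ U ⊗ G.obj V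
  naturality : ∀ {V W : D} (f : V ⟶ W),
    F.map f ▷ U ≫ (χ W).hom = (χ V).hom ≫ U ◁ G.map f
  unit : ε F ▷ U ≫ (χ (𝟙_ D)).hom = (λ_ U).hom ≫ (ρ_ U).inv ≫ U ◁ ε G
  tensor : ∀ V W, μ F V W ▷ U ≫ (χ (V ⊗ W)).hom =
    (α_ _ _ _).hom ≫ F.obj V ◁ (χ W).hom ≫ (α_ _ _ _).inv ≫ (χ V).hom ▷ G.obj W ≫
      (α_ _ _ _).hom ≫ U ◁ μ G V W

namespace PseudonatIso

attribute [simp] unit tensor naturality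

variable {F G H : D ⥤ D} [F.Monoidal] [G.Monoidal] [H.Monoidal]

/-- The vertical composite `(U_σ ⊗ U_τ, …) : F ⇒ G ⇒ H`. -/
def comp (σ : PseudonatIso F G) (τ : PseudonatIso G H) : PseudonatIso F H where
  U := σ.U ⊗ τ.U
  invertible := by
    obtain ⟨A, ⟨a⟩, ⟨a'⟩⟩ := σ.invertible
    obtain ⟨B, ⟨b⟩, ⟨b'⟩⟩ := τ.invertible
    refine ⟨B ⊗ A, ⟨?_⟩, ⟨?_⟩⟩
    · exact α_ _ _ _ ≪≫ whiskerLeftIso _ ((α_ _ _ _).symm ≪≫ whiskerRightIso b _ ≪≫ λ_ _) ≪≫ a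
    · exact α_ _ _ _ ≪≫ whiskerLeftIso _ ((α_ _ _ _).symm ≪≫ whiskerRightIso a' _ ≪≫ λ_ _) ≪≫ b'
  χ V := (α_ _ _ _).symm ≪≫ whiskerRightIso (σ.χ V) _ ≪≫ α_ _ _ _ ≪≫
    whiskerLeftIso _ (τ.χ V) ≪≫ (α_ _ _ _).symm
  naturality {V W} f := by
    simp only [Iso.trans_hom, Iso.symm_hom, whiskerRightIso_hom, whiskerLeftIso_hom]
    calc _ = 𝟙 (F.obj V ⊗ (σ.U ⊗ τ.U)) ⊗≫ (F.map f ▷ σ.U ≫ (σ.χ W).hom) ▷ τ.U ⊗≫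
          σ.U ◁ (τ.χ W).hom ⊗≫ 𝟙 ((σ.U ⊗ τ.U) ⊗ H.obj W) := by monoidal
      _ = 𝟙 (F.obj V ⊗ (σ.U ⊗ τ.U)) ⊗≫ (σ.χ V).hom ▷ τ.U ⊗≫
          σ.U ◁ (G.map f ▷ τ.U ≫ (τ.χ W).hom) ⊗≫ 𝟙 ((σ.U ⊗ τ.U) ⊗ H.obj W) := by
        rw [σ.naturality f]; monoidal
      _ = _ := by rw [τ.naturality f]; monoidal
  unit := by
    simp only [Iso.trans_hom, Iso.symm_hom, whiskerRightIso_hom, whiskerLeftIso_hom]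
    calc _ = 𝟙 (𝟙_ D ⊗ (σ.U ⊗ τ.U)) ⊗≫ (ε F ▷ σ.U ≫ (σ.χ (𝟙_ D)).hom) ▷ τ.U ⊗≫
          σ.U ◁ (τ.χ (𝟙_ D)).hom ⊗≫ 𝟙 ((σ.U ⊗ τ.U) ⊗ H.obj (𝟙_ D)) := by monoidal
      _ = 𝟙 (𝟙_ D ⊗ (σ.U ⊗ τ.U)) ⊗≫ σ.U ◁ (ε G ▷ τ.U ≫ (τ.χ (𝟙_ D)).hom) ⊗≫
          𝟙 ((σ.U ⊗ τ.U) ⊗ H.obj (𝟙_ D)) := by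
        rw [σ.unit]; monoidal
      _ = _ := by rw [τ.unit]; monoidal
  tensor V W := by
    simp only [Iso.trans_hom, Iso.symm_hom, whiskerRightIso_hom, whiskerLeftIso_hom]
    calc _ = 𝟙 ((F.obj V ⊗ F.obj W) ⊗ (σ.U ⊗ τ.U)) ⊗≫
          (μ F V W ▷ σ.U ≫ (σ.χ (V ⊗ W)).hom) ▷ τ.U ⊗≫
          σ.U ◁ (τ.χ (V ⊗ W)).hom ⊗≫ 𝟙 ((σ.U ⊗ τ.U) ⊗ H.obj (V ⊗ W)) := by monoidal
      _ = 𝟙 ((F.obj V ⊗ F.obj W) ⊗ (σ.U ⊗ τ.U)) ⊗≫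
          F.obj V ◁ (σ.χ W).hom ▷ τ.U ⊗≫ (σ.χ V).hom ▷ G.obj W ▷ τ.U ⊗≫
          σ.U ◁ (μ G V W ▷ τ.U ≫ (τ.χ (V ⊗ W)).hom) ⊗≫ 𝟙 ((σ.U ⊗ τ.U) ⊗ H.obj (V ⊗ W)) := by
        rw [σ.tensor]; monoidal
      _ = 𝟙 ((F.obj V ⊗ F.obj W) ⊗ (σ.U ⊗ τ.U)) ⊗≫ F.obj V ◁ (σ.χ W).hom ▷ τ.U ⊗≫
          ((σ.χ V).hom ▷ (G.obj W ⊗ τ.U) ≫ (σ.U ⊗ G.obj V) ◁ (τ.χ W).hom) ⊗≫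
          σ.U ◁ (τ.χ V).hom ▷ H.obj W ⊗≫ σ.U ◁ τ.U ◁ μ H V W ⊗≫
          𝟙 ((σ.U ⊗ τ.U) ⊗ H.obj (V ⊗ W)) := by
        rw [τ.tensor]; monoidal
      _ = _ := by rw [← whisker_exchange]; monoidal

/-- The composite of a pseudonatural isomorphism with a monoidal functor `K` applied after it. -/
def whiskerLeft (σ : PseudonatIso F G) (K : D ⥤ D) [K.Monoidal] :
    PseudonatIso (F ⋙ K) (G ⋙ K) where
  U := K.obj σ.U
  invertible := by
    obtain ⟨A, ⟨a⟩, ⟨a'⟩⟩ := σ.invertible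
    exact ⟨K.obj A,
      ⟨Functor.Monoidal.μIso K _ _ ≪≫ K.mapIso a ≪≫ (Functor.Monoidal.εIso K).symm⟩,
      ⟨Functor.Monoidal.μIso K _ _ ≪≫ K.mapIso a' ≪≫ (Functor.Monoidal.εIso K).symm⟩⟩
  χ V := Functor.Monoidal.μIso K _ _ ≪≫ K.mapIso (σ.χ V) ≪≫ (Functor.Monoidal.μIso K _ _).symm
  naturality {V W} f := by
    have h := congrArg (fun z => μ K _ _ ≫ K.map z ≫ δ K _ _) (σ.naturality f)
    simp only [Functor.map_comp, Category.assoc] at h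
    simp only [Functor.comp_map, Iso.trans_hom, Iso.symm_hom, Functor.mapIso_hom,
      Functor.Monoidal.μIso_hom, Functor.Monoidal.μIso_inv, Category.assoc,
      Functor.LaxMonoidal.μ_natural_left_assoc, h, Functor.OplaxMonoidal.δ_natural_right]
  unit := by
    have h := congrArg (fun z => μ K _ _ ≫ K.map z ≫ δ K _ _) σ.unit
    simp only [Functor.map_comp, Category.assoc] at h
    simp only [Functor.comp_obj, Functor.LaxMonoidal.comp_ε, Iso.trans_hom, Iso.symm_hom,
      Functor.mapIso_hom, Functor.Monoidal.μIso_hom, Functor.Monoidal.μIso_inv, Category.assoc,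
      comp_whiskerRight, Functor.LaxMonoidal.μ_natural_left_assoc, h,
      MonoidalCategory.whiskerLeft_comp]
    simp
  tensor V W := by
    have h := congrArg (fun z => μ K _ _ ≫ K.map z ≫ δ K _ _) (σ.tensor V W)
    simp only [Functor.map_comp, Category.assoc] at h
    simp only [Functor.comp_obj, Functor.LaxMonoidal.comp_μ, Iso.trans_hom, Iso.symm_hom,
      Functor.mapIso_hom, Functor.Monoidal.μIso_hom, Functor.Monoidal.μIso_inv, Category.assoc,
      comp_whiskerRight, Functor.LaxMonoidal.μ_natural_left_assoc, h,
      MonoidalCategory.whiskerLeft_comp]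
    have hA : μ K (F.obj V) (σ.U ⊗ G.obj W) ≫ K.map (α_ (F.obj V) σ.U (G.obj W)).inv =
        K.obj (F.obj V) ◁ δ K σ.U (G.obj W) ≫ (α_ _ _ _).inv ≫
          μ K (F.obj V) σ.U ▷ K.obj (G.obj W) ≫ μ K (F.obj V ⊗ σ.U) (G.obj W) := by
      rw [← Functor.LaxMonoidal.associativity_inv, ← MonoidalCategory.whiskerLeft_comp_assoc,
        Functor.Monoidal.δ_μ, MonoidalCategory.whiskerLeft_id, Category.id_comp]
    have hB : μ K (σ.U ⊗ G.obj V) (G.obj W) ≫ K.map (α_ σ.U (G.obj V) (G.obj W)).hom =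
        δ K σ.U (G.obj V) ▷ K.obj (G.obj W) ≫ (α_ _ _ _).hom ≫
          K.obj σ.U ◁ μ K (G.obj V) (G.obj W) ≫ μ K σ.U (G.obj V ⊗ G.obj W) := by
      rw [← Functor.LaxMonoidal.associativity, ← comp_whiskerRight_assoc,
        Functor.Monoidal.δ_μ, id_whiskerRight, Category.id_comp]
    rw [Functor.LaxMonoidal.associativity_assoc, ← Functor.LaxMonoidal.μ_natural_right_assoc,
      reassoc_of% hA, ← Functor.LaxMonoidal.μ_natural_left_assoc, reassoc_of% hB,
      ← Functor.LaxMonoidal.μ_natural_right_assoc]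
    simp

/-- The composite of a pseudonatural isomorphism with a monoidal functor `K` applied before it. -/
def whiskerRight (σ : PseudonatIso F G) (K : D ⥤ D) [K.Monoidal] :
    PseudonatIso (K ⋙ F) (K ⋙ G) where
  U := σ.U
  invertible := σ.invertible
  χ V := σ.χ (K.obj V)
  naturality f := σ.naturality (K.map f)
  unit := by
    have h := σ.naturality (ε K)
    simp [Category.assoc, h, reassoc_of% σ.unit]
  tensor V W := by
    have h := σ.naturality (μ K V W)
    simp [Category.assoc, h, reassoc_of% σ.tensor]

/-- The pseudonatural isomorphism with `U = 1` given by a monoidal natural isomorphism. -/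
def ofNatIso (e : F ≅ G) [NatTrans.IsMonoidal e.hom] : PseudonatIso F G where
  U := 𝟙_ D
  invertible := ⟨𝟙_ D, ⟨λ_ _⟩, ⟨λ_ _⟩⟩
  χ V := ρ_ _ ≪≫ e.app V ≪≫ (λ_ _).symm
  naturality {V W} f := by
    have h := e.hom.naturality f
    calc _ = F.map f ▷ 𝟙_ D ≫ (ρ_ _).hom ≫ e.hom.app W ≫ (λ_ _).inv := rfl
      _ = (ρ_ _).hom ≫ (F.map f ≫ e.hom.app W) ≫ (λ_ _).inv := by monoidal
      _ = ((ρ_ _).hom ≫ e.hom.app V ≫ (λ_ _).inv) ≫ 𝟙_ D ◁ G.map f := by rw [h]; monoidal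
      _ = _ := rfl
  unit := by
    have h := NatTrans.IsMonoidal.unit (τ := e.hom)
    calc _ = ε F ▷ 𝟙_ D ≫ (ρ_ _).hom ≫ e.hom.app _ ≫ (λ_ _).inv := rfl
      _ = (ρ_ _).hom ≫ (ε F ≫ e.hom.app _) ≫ (λ_ _).inv := by monoidal
      _ = _ := by rw [h]; monoidal
  tensor V W := by
    have h := NatTrans.IsMonoidal.tensor (τ := e.hom) V W
    calc _ = μ F V W ▷ 𝟙_ D ≫ (ρ_ _).hom ≫ e.hom.app _ ≫ (λ_ _).inv := rfl
      _ = (ρ_ _).hom ≫ (μ F V W ≫ e.hom.app _) ≫ (λ_ _).inv := by monoidal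
      _ = (ρ_ _).hom ≫ (e.hom.app V ⊗ₘ e.hom.app W) ≫ (λ_ _).inv ≫ 𝟙_ D ◁ μ G V W := by
        rw [h]; monoidal
      _ = (α_ _ _ _).hom ≫ F.obj V ◁ ((ρ_ _).hom ≫ e.hom.app W ≫ (λ_ _).inv) ≫ (α_ _ _ _).inv ≫
          ((ρ_ _).hom ≫ e.hom.app V ≫ (λ_ _).inv) ▷ G.obj W ≫ (α_ _ _ _).hom ≫
          𝟙_ D ◁ μ G V W := by
        rw [tensorHom_def']; monoidal
      _ = _ := rfl

/-- Strict associativity of the composition of functors. -/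
def reassoc {K J : D ⥤ D} [K.Monoidal] [J.Monoidal] (σ : PseudonatIso (H ⋙ (K ⋙ J)) G) :
    PseudonatIso ((H ⋙ K) ⋙ J) G where
  U := σ.U
  invertible := σ.invertible
  χ V := σ.χ V
  naturality f := σ.naturality f
  unit := by
    have := σ.unit
    simpa using this
  tensor V W := by
    have := σ.tensor V W
    simpa using this

end PseudonatIso

/-- An invertible modification `σ ⇛ τ`. -/
structure Modification {F G : D ⥤ D} [F.Monoidal] [G.Monoidal] (σ τ : PseudonatIso F G) where
  Γ : σ.U ≅ τ.U
  comm : ∀ V, F.obj V ◁ Γ.hom ≫ (τ.χ V).hom = (σ.χ V).hom ≫ Γ.hom ▷ G.obj V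

end TwoAut

section AnomalousAction

open Functor.LaxMonoidal (μ)

variable (k : Type w) [Field k] (D : Type u) [Category.{v} D] [Preadditive D] [Linear k D]
  [MonoidalCategory D]

/-- A `k`-linear monoidal autoequivalence of `D`. -/
structure LinMonAut where
  functor : D ⥤ D
  monoidal : functor.Monoidal
  additive : functor.Additive
  linear : functor.Linear k
  isEquivalence : functor.IsEquivalence

attribute [instance] LinMonAut.monoidal LinMonAut.additive LinMonAut.linear
  LinMonAut.isEquivalence

/-- A `π`-anomalous action of `Q` on `D`, that is, a `kˣ`-linear monoidal `2`-functor from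
`3-Gr(Q, π)` to the monoidal `2`-category of linear monoidal autoequivalences of `D`,
pseudonatural isomorphisms and invertible modifications. Its source has the elements of `Q` as
objects, only identity `1`-morphisms, and the scalars `kˣ` as `2`-morphisms; its structure is
strict except for the pentagonator `π(q, r, s, t)`, which goes from the composite of three
associators to the composite of two. -/
structure AnomalousAction {Q : Type*} [Group Q] (π : Cocycle₄ Q kˣ) where
  /-- The autoequivalences `F(q)`. -/
  F : Q → LinMonAut k D
  /-- `χ_{q,r} : F(q) ∘ F(r) ⇒ F(qr)`; the last index is kept as a variable equal to `qr`. -/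
  χ : ∀ {q r p : Q}, q * r = p → PseudonatIso ((F r).functor ⋙ (F q).functor) (F p).functor
  /-- `ι : id ⇒ F(1)`. -/
  ι : PseudonatIso (𝟭 D) (F 1).functor
  /-- `Ω_{q,r,s} : χ_{q,rs} ∘ (1 ⊗ χ_{r,s}) ⇛ χ_{qr,s} ∘ (χ_{q,r} ⊗ 1)`. -/
  Ω : ∀ {q r s qr rs p : Q} (h₁ : q * r = qr) (h₂ : r * s = rs) (h₃ : q * rs = p)
    (h₄ : qr * s = p), Modification (((χ h₂).whiskerLeft (F q).functor).comp (χ h₃))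
      (((χ h₁).whiskerRight (F s).functor).comp (χ h₄)).reassoc
  /-- `γ_q : χ_{1,q} ∘ (ι ⊗ 1) ⇛ 1`. -/
  γ : ∀ q, Modification ((ι.whiskerRight (F q).functor).comp (χ (one_mul q)))
    (PseudonatIso.ofNatIso (F q).functor.rightUnitor)
  /-- `δ_q : χ_{q,1} ∘ (1 ⊗ ι) ⇛ 1`. -/
  δ : ∀ q, Modification ((ι.whiskerLeft (F q).functor).comp (χ (mul_one q)))
    (PseudonatIso.ofNatIso (F q).functor.leftUnitor)
  /-- The composite of three `Ω` is `π(q, r, s, t)` times the composite of two. -/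
  pentagon : ∀ {q r s t qr rs st qrs rst p : Q} (hqr : q * r = qr) (hrs : r * s = rs)
    (hst : s * t = st) (h_qr_s : qr * s = qrs) (h_q_rs : q * rs = qrs) (h_rs_t : rs * t = rst)
    (h_r_st : r * st = rst) (h_qrs_t : qrs * t = p) (h_q_rst : q * rst = p)
    (h_qr_st : qr * st = p),
    (α_ ((F q).functor.obj ((F r).functor.obj (χ hst).U)) ((F q).functor.obj (χ h_r_st).U)
        (χ h_q_rst).U).inv ≫
      μ (F q).functor _ _ ▷ (χ h_q_rst).U ≫
      (F q).functor.map (Ω hrs hst h_r_st h_rs_t).Γ.hom ▷ (χ h_q_rst).U ≫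
      Functor.OplaxMonoidal.δ (F q).functor (χ hrs).U (χ h_rs_t).U ▷ (χ h_q_rst).U ≫
      (α_ _ _ _).hom ≫
      (F q).functor.obj (χ hrs).U ◁ (Ω h_q_rs h_rs_t h_q_rst h_qrs_t).Γ.hom ≫
      (α_ ((F q).functor.obj (χ hrs).U) (χ h_q_rs).U (χ h_qrs_t).U).inv ≫
      (Ω hqr hrs h_q_rs h_qr_s).Γ.hom ▷ (χ h_qrs_t).U =
    (π q r s t : k) •
      ((F q).functor.obj ((F r).functor.obj (χ hst).U) ◁ (Ω hqr h_r_st h_q_rst h_qr_st).Γ.hom ≫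
      (α_ ((F q).functor.obj ((F r).functor.obj (χ hst).U)) (χ hqr).U (χ h_qr_st).U).inv ≫
      ((χ hqr).χ (χ hst).U).hom ▷ (χ h_qr_st).U ≫
      (α_ _ _ _).hom ≫
      (χ hqr).U ◁ (Ω h_qr_s hst h_qr_st h_qrs_t).Γ.hom ≫
      (α_ (χ hqr).U (χ h_qr_s).U (χ h_qrs_t).U).inv)
  /-- Compatibility of `Ω_{q,1,r}` with `γ_r` and `δ_q`. -/
  triangle : ∀ {q r p : Q} (h : q * r = p),
    (F q).functor.obj ι.U ◁ (Ω (mul_one q) (one_mul r) h h).Γ.hom ≫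
      (α_ ((F q).functor.obj ι.U) (χ (mul_one q)).U (χ h).U).inv ≫
      (δ q).Γ.hom ▷ (χ h).U ≫ (λ_ (χ h).U).hom =
    (α_ ((F q).functor.obj ι.U) ((F q).functor.obj (χ (one_mul r)).U) (χ h).U).inv ≫
      μ (F q).functor _ _ ▷ (χ h).U ≫
      (F q).functor.map (γ r).Γ.hom ▷ (χ h).U ≫
      Functor.OplaxMonoidal.η (F q).functor ▷ (χ h).U ≫ (λ_ (χ h).U).hom

end AnomalousAction

end Anomalous

end

noncomputable section

namespace Anomalous

universe v u w

/-! If `ω` were a cocycle on all of `G`, then `D = C ⋊_ω K` would sit inside `C ⋊_ω G`, and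
conjugation by the invertible objects `[1, s(q)]`, for a set-theoretic section `s` of `ρ`, would
give an action of `Q` on `D` whose coherence is inherited from the associator of the larger
category. The obstruction `dω = ρ^*π` disappears after enlarging the coefficients: over `Fun(Q,
kˣ)`, with `G` acting by translation through `ρ`, the pullback of `π` becomes a coboundary.
Precisely, `c(x,y,z)(b) = ω(x,y,z)⁻¹ π(ρx,ρy,ρz,b)` satisfies the translated `3`-cocycle identity,
because `dω` cancels the one term of `dπ` that does not involve `b`.

Accordingly `E` has as objects the direct sums of `[V, g]` with `g ∈ G`, and as morphisms families
indexed by `Q`. Tensoring on the right with an object of degree `g` translates the index by `ρ(g)`,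
and the associator carries the factor `c`. This is the category `Mat_ (Twisted (crossedTwist ω hω
A))`. Since `π` is normalized, `c` reduces to `ω⁻¹` as soon as one degree lies in `K`. Hence `D`
embeds monoidally in `E` by constant families (`kernelInclusion`, `matFunctor`), and every
structural morphism of `E` with an argument from `D` is constant.

Put `T q = [1, s(q)]`. There are constant isomorphisms `J(F_q V) ⊗ T q ≅ T q ⊗ J V` and `T q ⊗ T r ≅
J(U) ⊗ T(qr)`. Constant morphisms `J X ⊗ T q ⟶ J Y ⊗ T q` come from unique morphisms of `D`; lifting
them produces the monoidal structure of `F_q`, the half braidings in `χ` and `ι`, and the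
modifications. The associator of the objects `T` is not constant, but its inverse times the function
`π(q,r,s,·)` is, and `Ω_{q,r,s}` is the lift obtained in this way.

The relation `Over θ θ' Γ p` records that `Γ` in `D` covers the comparison of `θ` with `θ'` in `E`
up to a function `p`. Such relations compose, multiplying the functions. The pentagon of `E` makes
both sides of the anomalous pentagon cover the same comparison, with the functions `π(r,s,t,b)
π(q,rs,t,b) π(q,r,s,tb)` (`over_three`) and `π(q,r,st,b) π(qr,s,t,b)` (`over_two`). The argument
`tb` comes from tensoring `Ω_{q,r,s}` on the right with `T t`. At `b = 1` normalization leaves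
`π(q,r,s,t)` and `1`, which is the anomaly. The triangle is the same argument with both functions
equal to `1`. -/

section Intertwiner

open Functor.LaxMonoidal (μ ε)
open Functor.OplaxMonoidal (δ η)

variable {D : Type*} [Category D] [MonoidalCategory D]
  {E : Type*} [Category E] [MonoidalCategory E]

/-! ### Moving objects past a fixed object -/

/-- Moving an object past `U ⊗ T`, first past `U` and then past `T`. -/
def braidComp {X Y Z U T : E} (s : X ⊗ U ⟶ U ⊗ Y) (t : Y ⊗ T ⟶ T ⊗ Z) :
    X ⊗ (U ⊗ T) ⟶ (U ⊗ T) ⊗ Z :=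
  (α_ _ _ _).inv ≫ s ▷ T ≫ (α_ _ _ _).hom ≫ U ◁ t ≫ (α_ _ _ _).inv

/-- `braidComp` of isomorphisms. -/
@[simps]
def braidCompIso {X Y Z U T : E} (s : X ⊗ U ≅ U ⊗ Y) (t : Y ⊗ T ≅ T ⊗ Z) :
    X ⊗ (U ⊗ T) ≅ (U ⊗ T) ⊗ Z where
  hom := braidComp s.hom t.hom
  inv := (α_ _ _ _).hom ≫ U ◁ t.inv ≫ (α_ _ _ _).inv ≫ s.inv ▷ T ≫ (α_ _ _ _).hom
  hom_inv_id := by simp [braidComp]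
  inv_hom_id := by simp [braidComp]

/-- Moving the unit object past `U`. -/
def braidUnit (U : E) : 𝟙_ E ⊗ U ⟶ U ⊗ 𝟙_ E := (λ_ U).hom ≫ (ρ_ U).inv

/-- Moving `X ⊗ X'` past `U`, one factor at a time. -/
def braidTensor {X X' Y Y' U : E} (s : X ⊗ U ⟶ U ⊗ Y) (s' : X' ⊗ U ⟶ U ⊗ Y') :
    (X ⊗ X') ⊗ U ⟶ U ⊗ (Y ⊗ Y') :=
  (α_ _ _ _).hom ≫ X ◁ s' ≫ (α_ _ _ _).inv ≫ s ▷ Y' ≫ (α_ _ _ _).hom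

/-- `braidTensor` of isomorphisms. -/
@[simps]
def braidTensorIso {X X' Y Y' U : E} (s : X ⊗ U ≅ U ⊗ Y) (s' : X' ⊗ U ≅ U ⊗ Y') :
    (X ⊗ X') ⊗ U ≅ U ⊗ (Y ⊗ Y') where
  hom := braidTensor s.hom s'.hom
  inv := (α_ _ _ _).inv ≫ s.inv ▷ Y' ≫ (α_ _ _ _).hom ≫ X ◁ s'.inv ≫ (α_ _ _ _).inv
  hom_inv_id := by simp [braidTensor]
  inv_hom_id := by simp [braidTensor]

/-- The morphisms `f` and `g` correspond to each other under moving past `U`. -/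
def Square {X Y X' Y' : E} (U : E) (s : X ⊗ U ⟶ U ⊗ Y) (s' : X' ⊗ U ⟶ U ⊗ Y') (f : X ⟶ X')
    (g : Y ⟶ Y') : Prop :=
  f ▷ U ≫ s' = s ≫ U ◁ g

/-- Tensoring with `T` on the right is faithful. -/
def RightFaithful (T : E) : Prop := ∀ {X Y : E} (f g : X ⟶ Y), f ▷ T = g ▷ T → f = g

section Square

variable {X X' X'' Y Y' Y'' Z Z' U T : E}

lemma Square.comp {s : X ⊗ U ⟶ U ⊗ Y} {s' : X' ⊗ U ⟶ U ⊗ Y'} {s'' : X'' ⊗ U ⟶ U ⊗ Y''}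
    {f : X ⟶ X'} {f' : X' ⟶ X''} {g : Y ⟶ Y'} {g' : Y' ⟶ Y''}
    (h : Square U s s' f g) (h' : Square U s' s'' f' g') :
    Square U s s'' (f ≫ f') (g ≫ g') := by
  unfold Square at *
  rw [comp_whiskerRight, Category.assoc, h', reassoc_of% h, MonoidalCategory.whiskerLeft_comp]

lemma Square.id (s : X ⊗ U ⟶ U ⊗ Y) : Square U s s (𝟙 X) (𝟙 Y) := by simp [Square]

lemma Square.inv {s : X ⊗ U ⟶ U ⊗ Y} {s' : X' ⊗ U ⟶ U ⊗ Y'} {f : X ≅ X'} {g : Y ≅ Y'}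
    (h : Square U s s' f.hom g.hom) : Square U s' s f.inv g.inv := by
  unfold Square at *
  rw [← cancel_epi (f.hom ▷ U), reassoc_of% h]
  simp

lemma Square.tensor {W W' V V' : E} {s : X ⊗ U ⟶ U ⊗ Y} {s' : X' ⊗ U ⟶ U ⊗ Y'}
    {r : W ⊗ U ⟶ U ⊗ V} {r' : W' ⊗ U ⟶ U ⊗ V'}
    {f : X ⟶ W} {f' : X' ⟶ W'} {g : Y ⟶ V} {g' : Y' ⟶ V'}
    (h : Square U s r f g) (h' : Square U s' r' f' g') :
    Square U (braidTensor s s') (braidTensor r r') (f ⊗ₘ f') (g ⊗ₘ g') := by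
  unfold Square at *
  calc _ = 𝟙 _ ⊗≫ f ▷ (X' ⊗ U) ⊗≫ W ◁ (f' ▷ U ≫ r') ⊗≫ r ▷ V' ⊗≫ 𝟙 _ := by
        rw [MonoidalCategory.tensorHom_def]; simp only [braidTensor]; monoidal
    _ = 𝟙 _ ⊗≫ (f ▷ (X' ⊗ U) ≫ W ◁ s') ⊗≫ ((W ⊗ U) ◁ g' ≫ r ▷ V') ⊗≫ 𝟙 _ := by
        rw [h']; monoidal
    _ = 𝟙 _ ⊗≫ X ◁ s' ⊗≫ (f ▷ U ≫ r) ▷ Y' ⊗≫ U ◁ V ◁ g' ⊗≫ 𝟙 _ := by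
        rw [whisker_exchange, ← whisker_exchange]; monoidal
    _ = _ := by rw [h, MonoidalCategory.tensorHom_def]; simp only [braidTensor]; monoidal

lemma Square.whiskerRight {W V : E} {s : X ⊗ U ⟶ U ⊗ Y} {r : W ⊗ U ⟶ U ⊗ V} {f : X ⟶ W} {g : Y ⟶ V}
    (h : Square U s r f g) (s' : X' ⊗ U ⟶ U ⊗ Y') :
    Square U (braidTensor s s') (braidTensor r s') (f ▷ X') (g ▷ Y') := by
  simpa using h.tensor (.id s')

lemma Square.whiskerLeft {W V : E} {s : X ⊗ U ⟶ U ⊗ Y} {r : W ⊗ U ⟶ U ⊗ V} {f : X ⟶ W} {g : Y ⟶ V}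
    (h : Square U s r f g) (s' : X' ⊗ U ⟶ U ⊗ Y') :
    Square U (braidTensor s' s) (braidTensor s' r) (X' ◁ f) (Y' ◁ g) := by
  simpa using (Square.id s').tensor h

lemma Square.associator (s : X ⊗ U ⟶ U ⊗ Y) (s' : X' ⊗ U ⟶ U ⊗ Y') (s'' : X'' ⊗ U ⟶ U ⊗ Y'') :
    Square U (braidTensor (braidTensor s s') s'') (braidTensor s (braidTensor s' s''))
      (α_ _ _ _).hom (α_ _ _ _).hom := by
  simp only [braidTensor, Square]; monoidal

lemma Square.leftUnitor (s : X ⊗ U ⟶ U ⊗ Y) :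
    Square U (braidTensor (braidUnit U) s) s (λ_ X).hom (λ_ Y).hom := by
  simp only [braidTensor, braidUnit, Square]; monoidal

lemma Square.rightUnitor (s : X ⊗ U ⟶ U ⊗ Y) :
    Square U (braidTensor s (braidUnit U)) s (ρ_ X).hom (ρ_ Y).hom := by
  simp only [braidTensor, braidUnit, Square]; monoidal

lemma Square.unitObject (f : X ⟶ Y) :
    Square (𝟙_ E) ((ρ_ X).hom ≫ (λ_ X).inv) ((ρ_ Y).hom ≫ (λ_ Y).inv) f f := by
  simp [Square]

lemma Square.braidComp {s : X ⊗ U ⟶ U ⊗ Y} {s' : X' ⊗ U ⟶ U ⊗ Y'} {t : Y ⊗ T ⟶ T ⊗ Z}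
    {t' : Y' ⊗ T ⟶ T ⊗ Z'} {f : X ⟶ X'} {g : Y ⟶ Y'} {h : Z ⟶ Z'}
    (hs : Square U s s' f g) (ht : Square T t t' g h) :
    Square (U ⊗ T) (braidComp s t) (braidComp s' t') f h := by
  unfold Square at *
  calc _ = 𝟙 _ ⊗≫ (f ▷ U ≫ s') ▷ T ⊗≫ U ◁ t' ⊗≫ 𝟙 _ := by
        simp only [Anomalous.braidComp]; monoidal
    _ = 𝟙 _ ⊗≫ s ▷ T ⊗≫ U ◁ (g ▷ T ≫ t') ⊗≫ 𝟙 _ := by rw [hs]; monoidal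
    _ = _ := by rw [ht]; simp only [Anomalous.braidComp]; monoidal

lemma braidComp_braidUnit (U T : E) : braidComp (braidUnit U) (braidUnit T) = braidUnit (U ⊗ T) := by
  simp only [braidComp, braidUnit]; monoidal

lemma braidComp_braidTensor (s : X ⊗ U ⟶ U ⊗ Y) (s' : X' ⊗ U ⟶ U ⊗ Y') (t : Y ⊗ T ⟶ T ⊗ Z)
    (t' : Y' ⊗ T ⟶ T ⊗ Z') :
    braidComp (braidTensor s s') (braidTensor t t') =
      braidTensor (braidComp s t) (braidComp s' t') := by
  symm
  calc _ = 𝟙 _ ⊗≫ X ◁ s' ▷ T ⊗≫ ((X ⊗ U) ◁ t' ≫ s ▷ (T ⊗ Z')) ⊗≫ U ◁ t ▷ Z' ⊗≫ 𝟙 _ := by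
        simp only [braidTensor, braidComp]; monoidal
    _ = _ := by rw [whisker_exchange]; simp only [braidTensor, braidComp]; monoidal

lemma braidTensor_unitObject (X Y : E) :
    braidTensor ((ρ_ X).hom ≫ (λ_ X).inv) ((ρ_ Y).hom ≫ (λ_ Y).inv) =
      (ρ_ (X ⊗ Y)).hom ≫ (λ_ (X ⊗ Y)).inv := by
  simp only [braidTensor]; monoidal

/-- Moving past isomorphic objects. -/
lemma Square.transport {θ : T ≅ U} {b : X ⊗ T ⟶ T ⊗ Y} {b' : X' ⊗ T ⟶ T ⊗ Y'}
    {c : X ⊗ U ⟶ U ⊗ Y} {c' : X' ⊗ U ⟶ U ⊗ Y'} {f : X ⟶ X'} {g : Y ⟶ Y'}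
    (hb : Square T b b' f g) (h : X ◁ θ.hom ≫ c = b ≫ θ.hom ▷ Y)
    (h' : X' ◁ θ.hom ≫ c' = b' ≫ θ.hom ▷ Y') : Square U c c' f g := by
  unfold Square at *
  rw [← cancel_epi (X ◁ θ.hom), reassoc_of% h, whisker_exchange_assoc, h', reassoc_of% hb,
    whisker_exchange]

lemma braidUnit_natural (θ : T ⟶ U) : 𝟙_ E ◁ θ ≫ braidUnit U = braidUnit T ≫ θ ▷ 𝟙_ E := by
  simp [braidUnit]

lemma braidTensor_natural {θ : T ⟶ U} {b : X ⊗ T ⟶ T ⊗ Y} {b' : X' ⊗ T ⟶ T ⊗ Y'}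
    {c : X ⊗ U ⟶ U ⊗ Y} {c' : X' ⊗ U ⟶ U ⊗ Y'} (h : X ◁ θ ≫ c = b ≫ θ ▷ Y)
    (h' : X' ◁ θ ≫ c' = b' ≫ θ ▷ Y') :
    (X ⊗ X') ◁ θ ≫ braidTensor c c' = braidTensor b b' ≫ θ ▷ (Y ⊗ Y') := by
  calc _ = 𝟙 _ ⊗≫ X ◁ (X' ◁ θ ≫ c') ⊗≫ c ▷ Y' ⊗≫ 𝟙 _ := by
        simp only [braidTensor]; monoidal
    _ = 𝟙 _ ⊗≫ X ◁ b' ⊗≫ (X ◁ θ ≫ c) ▷ Y' ⊗≫ 𝟙 _ := by rw [h']; monoidal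
    _ = _ := by rw [h]; simp only [braidTensor]; monoidal

/-- A morphism is determined by its conjugate. Identities between structure morphisms of a
conjugation functor thereby follow from the corresponding identities for `J`. -/
lemma eq_of_square (hU : RightFaithful U) {s : X ⊗ U ⟶ U ⊗ Y} {s' : X' ⊗ U ⟶ U ⊗ Y'} [Mono s']
    {f f' : X ⟶ X'} {g : Y ⟶ Y'} (h : Square U s s' f g) (h' : Square U s s' f' g) : f = f' :=
  hU _ _ ((cancel_mono s').1 (Eq.trans h (Eq.symm h')))

/-- A cancellation converse to `Square.braidComp`: a correspondence past `U ⊗ T` together with one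
past `T` leaves a correspondence past `U`. It isolates `U` from the comparison `P.T ≅ J(U) ⊗ T q`.
-/
lemma Square.of_braidComp (hT : RightFaithful T) {s : X ⊗ U ⟶ U ⊗ Y} {s' : X' ⊗ U ⟶ U ⊗ Y'}
    {t : Y ⊗ T ⟶ T ⊗ Z} {t' : Y' ⊗ T ⟶ T ⊗ Z'} [IsIso t'] {f : X ⟶ X'} {g : Y ⟶ Y'} {h : Z ⟶ Z'}
    (ht : Square T t t' g h)
    (hst : Square (U ⊗ T) (Anomalous.braidComp s t) (Anomalous.braidComp s' t') f h) :
    Square U s s' f g := by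
  unfold Square at *
  apply hT
  have : (f ▷ U ≫ s') ▷ T ≫ (α_ _ _ _).hom ≫ U ◁ t' ≫ (α_ _ _ _).inv =
      (s ≫ U ◁ g) ▷ T ≫ (α_ _ _ _).hom ≫ U ◁ t' ≫ (α_ _ _ _).inv := by
    calc _ = (α_ _ _ _).hom ≫ (f ▷ (U ⊗ T) ≫ Anomalous.braidComp s' t') := by
          simp only [Anomalous.braidComp]; monoidal
      _ = 𝟙 _ ⊗≫ s ▷ T ⊗≫ U ◁ (t ≫ T ◁ h) ⊗≫ 𝟙 _ := by
          rw [hst]; simp only [Anomalous.braidComp]; monoidal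
      _ = _ := by rw [← ht]; monoidal
  simpa only [cancel_mono] using this

end Square

/-! ### Intertwiners between monoidal functors -/

/-- An object `T` of `E` together with natural isomorphisms `F(V) ⊗ T ≅ T ⊗ G(V)` compatible with
the monoidal structures of `F` and `G`. -/
structure Intertwiner (F G : D ⥤ E) [F.Monoidal] [G.Monoidal] where
  T : E
  β : ∀ V, F.obj V ⊗ T ≅ T ⊗ G.obj V
  naturality : ∀ {V W : D} (f : V ⟶ W), Square T (β V).hom (β W).hom (F.map f) (G.map f)
  unit : Square T (braidUnit T) (β (𝟙_ D)).hom (ε F) (ε G)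
  tensor : ∀ V W, Square T (braidTensor (β V).hom (β W).hom) (β (V ⊗ W)).hom (μ F V W) (μ G V W)

namespace Intertwiner

variable {F G H : D ⥤ E} [F.Monoidal] [G.Monoidal] [H.Monoidal]

/-- Vertical composition of intertwiners. -/
@[simps]
def comp (P : Intertwiner F G) (P' : Intertwiner G H) : Intertwiner F H where
  T := P.T ⊗ P'.T
  β V := braidCompIso (P.β V) (P'.β V)
  naturality f := (P.naturality f).braidComp (P'.naturality f)
  unit := braidComp_braidUnit P.T P'.T ▸ P.unit.braidComp P'.unit
  tensor V W := braidComp_braidTensor (P.β V).hom _ _ _ ▸ (P.tensor V W).braidComp (P'.tensor V W)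

/-- Precomposition of an intertwiner with a monoidal functor. -/
@[simps]
def precomp (P : Intertwiner F G) (K : D ⥤ D) [K.Monoidal] :
    Intertwiner (K ⋙ F) (K ⋙ G) where
  T := P.T
  β V := P.β (K.obj V)
  naturality f := P.naturality (K.map f)
  unit := P.unit.comp (P.naturality (ε K))
  tensor V W := (P.tensor _ _).comp (P.naturality (μ K V W))

/-- The identity intertwiner of `F`. -/
@[simps]
def id (F : D ⥤ E) [F.Monoidal] : Intertwiner F F where
  T := 𝟙_ E
  β V := ρ_ _ ≪≫ (λ_ _).symm
  naturality f := Square.unitObject _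
  unit := by
    have : braidUnit (𝟙_ E) = (ρ_ (𝟙_ E)).hom ≫ (λ_ (𝟙_ E)).inv := by
      simp only [braidUnit]; monoidal
    rw [this]
    exact Square.unitObject _
  tensor V W := braidTensor_unitObject (F.obj V) (F.obj W) ▸ Square.unitObject (μ F V W)

end Intertwiner

/-! ### Half braidings relative to a monoidal functor `J : D ⥤ E` -/

variable (J : D ⥤ E) [J.Monoidal]

/-- An intertwiner from `F` to the identity, over `J`. -/
abbrev HalfBraiding (F : D ⥤ D) [F.Monoidal] := Intertwiner (F ⋙ J) J

namespace HalfBraiding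

variable {J} {F K L : D ⥤ D} [F.Monoidal] [K.Monoidal] [L.Monoidal]

variable (J) in
/-- The half braiding of the unit object. -/
@[simps]
def identity : HalfBraiding J (𝟭 D) where
  T := 𝟙_ E
  β V := (Intertwiner.id J).β V
  naturality f := (Intertwiner.id J).naturality f
  unit := by
    rw [show ε (𝟭 D ⋙ J) = ε J by simp]
    exact (Intertwiner.id J).unit
  tensor V W := by
    rw [show μ (𝟭 D ⋙ J) V W = μ J V W by simp]
    exact (Intertwiner.id J).tensor V W

/-- The half braiding of the composite `F ⋙ K`. -/
@[simps]
def comp (P : HalfBraiding J K) (P' : HalfBraiding J F) : HalfBraiding J (F ⋙ K) where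
  T := P.T ⊗ P'.T
  β V := braidCompIso (P.β (F.obj V)) (P'.β V)
  naturality f := ((P.precomp F).comp P').naturality f
  unit := by
    -- The two bracketings of the triple composite have equal structure maps, so the vertical
    -- composite of intertwiners can be reused.
    rw [show ε ((F ⋙ K) ⋙ J) = ε (F ⋙ (K ⋙ J)) by simp]
    exact ((P.precomp F).comp P').unit
  tensor V W := by
    rw [show μ ((F ⋙ K) ⋙ J) V W = μ (F ⋙ (K ⋙ J)) V W by simp]
    exact ((P.precomp F).comp P').tensor V W

end HalfBraiding

/-- A functor `F` with a natural family of isomorphisms `J(F(V)) ⊗ T ≅ T ⊗ J(V)` inherits a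
monoidal structure as soon as the conjugated structure morphisms lift along `J`. -/
@[simps]
def coreMonoidalOfConj {J : D ⥤ E} [J.Monoidal] [J.Faithful] {F : D ⥤ D} {T : E} (hT : RightFaithful T)
    (β : ∀ V, J.obj (F.obj V) ⊗ T ≅ T ⊗ J.obj V)
    (hβ : ∀ {V W : D} (f : V ⟶ W), Square T (β V).hom (β W).hom (J.map (F.map f)) (J.map f))
    (e : 𝟙_ D ≅ F.obj (𝟙_ D)) (m : ∀ V W, F.obj V ⊗ F.obj W ≅ F.obj (V ⊗ W))
    (he : Square T (braidUnit T) (β (𝟙_ D)).hom (ε J ≫ J.map e.hom) (ε J))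
    (hm : ∀ V W, Square T (braidTensor (β V).hom (β W).hom) (β (V ⊗ W)).hom
      (μ J _ _ ≫ J.map (m V W).hom) (μ J V W)) :
    F.CoreMonoidal where
  εIso := e
  μIso := m
  μIso_hom_natural_left {V W} f Z := by
    apply J.map_injective
    rw [← cancel_epi (μ J _ _), J.map_comp, J.map_comp, ← Functor.LaxMonoidal.μ_natural_left_assoc]
    -- Each side of the naturality square conjugates to a composite of the same kind for `J` alone;
    -- the two conjugates agree by naturality of `μ J`, which is the content of the closing `simpa`.
    -- The remaining axioms are treated in the same way.
    refine eq_of_square hT (((hβ f).whiskerRight (β Z).hom).comp (hm W Z)) ?_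
    simpa using (hm V Z).comp (hβ (f ▷ Z))
  μIso_hom_natural_right {V W} Z f := by
    apply J.map_injective
    rw [← cancel_epi (μ J _ _), J.map_comp, J.map_comp, ← Functor.LaxMonoidal.μ_natural_right_assoc]
    refine eq_of_square hT (((hβ f).whiskerLeft (β Z).hom).comp (hm Z W)) ?_
    simpa using (hm Z V).comp (hβ (Z ◁ f))
  associativity X Y Z := by
    apply J.map_injective
    rw [← cancel_epi (μ J _ _), ← cancel_epi (μ J _ _ ▷ _)]
    have h₁ := (((hm X Y).whiskerRight (β Z).hom).comp (hm (X ⊗ Y) Z)).comp (hβ (α_ X Y Z).hom)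
    have h₂ := (Square.associator (β X).hom (β Y).hom (β Z).hom).comp
      (((hm Y Z).whiskerLeft (β X).hom).comp (hm X (Y ⊗ Z)))
    have h₃ := eq_of_square hT h₁ (by simpa using h₂)
    simpa using h₃
  left_unitality X := by
    apply J.map_injective
    rw [← cancel_epi (μ J _ _), ← cancel_epi (ε J ▷ _)]
    have h₁ := ((he.whiskerRight (β X).hom).comp (hm (𝟙_ D) X)).comp (hβ (λ_ X).hom)
    have h₂ := Square.leftUnitor (β X).hom
    have h₃ := eq_of_square hT h₂ (by simpa using h₁)
    simpa using h₃
  right_unitality X := by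
    apply J.map_injective
    rw [← cancel_epi (μ J _ _), ← cancel_epi (_ ◁ ε J)]
    have h₁ := ((he.whiskerLeft (β X).hom).comp (hm X (𝟙_ D))).comp (hβ (ρ_ X).hom)
    have h₂ := Square.rightUnitor (β X).hom
    have h₃ := eq_of_square hT h₂ (by simpa using h₁)
    simpa using h₃

end Intertwiner

/-! ### Pseudonatural isomorphisms and modifications obtained from half braidings. -/

section Compat

open Functor.LaxMonoidal (μ ε)
open Functor.OplaxMonoidal (δ η)

variable {D : Type*} [Category* D] [MonoidalCategory D]
  {E : Type*} [Category* E] [MonoidalCategory E]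

section

variable {X X' Y Y' Z U U' V W A B C T T' : E}

lemma braidComp_assoc (p : X ⊗ U ⟶ U ⊗ Y) (q : Y ⊗ T ⟶ T ⊗ Z) (r : Z ⊗ T' ⟶ T' ⊗ W) :
    X ◁ (α_ _ _ _).hom ≫ braidComp p (braidComp q r) =
      braidComp (braidComp p q) r ≫ (α_ _ _ _).hom ▷ W := by
  simp only [braidComp]; monoidal

/-- The content of `Compat.comp` inside `E`, with the functors forgotten so that only coherence and
two interchanges remain: `θ'` slides past `s`, and `m` slides past `c`. -/
lemma compat_comp {θ : A ⟶ U ⊗ B} {θ' : B ⟶ V ⊗ C} {m : U ⊗ V ⟶ W} {s : X ⊗ U ⟶ U ⊗ Y}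
    {t : Y ⊗ V ⟶ V ⊗ Z} {r : X ⊗ W ⟶ W ⊗ Z} {a : X ⊗ A ⟶ A ⊗ T} {b : Y ⊗ B ⟶ B ⊗ T}
    {c : Z ⊗ C ⟶ C ⊗ T} (h₁ : X ◁ θ ≫ braidComp s b = a ≫ θ ▷ T)
    (h₂ : Y ◁ θ' ≫ braidComp t c = b ≫ θ' ▷ T) (h₃ : X ◁ m ≫ r = braidComp s t ≫ m ▷ Z) :
    X ◁ (θ ≫ U ◁ θ' ≫ (α_ _ _ _).inv ≫ m ▷ C) ≫ braidComp r c =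
      a ≫ (θ ≫ U ◁ θ' ≫ (α_ _ _ _).inv ≫ m ▷ C) ▷ T := by
  calc _ = X ◁ θ ⊗≫ X ◁ U ◁ θ' ⊗≫ (X ◁ m ≫ r) ▷ C ⊗≫ W ◁ c ⊗≫ 𝟙 _ := by
        simp only [braidComp]; monoidal
    _ = X ◁ θ ⊗≫ ((X ⊗ U) ◁ θ' ≫ s ▷ (V ⊗ C)) ⊗≫ U ◁ t ▷ C ⊗≫ (m ▷ (Z ⊗ C) ≫ W ◁ c) ⊗≫ 𝟙 _ := by
        rw [h₃]; simp only [braidComp]; monoidal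
    _ = X ◁ θ ⊗≫ s ▷ B ⊗≫ U ◁ (Y ◁ θ' ≫ braidComp t c) ⊗≫ m ▷ (C ⊗ T) ⊗≫ 𝟙 _ := by
        rw [whisker_exchange, ← whisker_exchange m c]; simp only [braidComp]; monoidal
    _ = (X ◁ θ ≫ braidComp s b) ⊗≫ U ◁ θ' ▷ T ⊗≫ m ▷ (C ⊗ T) ⊗≫ 𝟙 _ := by
        rw [h₂]; simp only [braidComp]; monoidal
    _ = _ := by rw [h₁]; monoidal

lemma compat_whiskerRight {θ : A ⟶ U ⊗ B} {s : X ⊗ U ⟶ U ⊗ Y} {a : X ⊗ A ⟶ A ⊗ Z}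
    {b : Y ⊗ B ⟶ B ⊗ Z} (h : X ◁ θ ≫ braidComp s b = a ≫ θ ▷ Z) (t : Z ⊗ T ⟶ T ⊗ W) :
    X ◁ (θ ▷ T ≫ (α_ _ _ _).hom) ≫ braidComp s (braidComp b t) =
      braidComp a t ≫ (θ ▷ T ≫ (α_ _ _ _).hom) ▷ W := by
  calc _ = 𝟙 _ ⊗≫ (X ◁ θ ≫ braidComp s b) ▷ T ⊗≫ (U ⊗ B) ◁ t ⊗≫ 𝟙 _ := by
        simp only [braidComp]; monoidal
    _ = 𝟙 _ ⊗≫ a ▷ T ⊗≫ (θ ▷ (Z ⊗ T) ≫ (U ⊗ B) ◁ t) ⊗≫ 𝟙 _ := by rw [h]; monoidal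
    _ = _ := by rw [← whisker_exchange]; simp only [braidComp]; monoidal

/-- Here `s'` is the conjugate of `s` by `T`. Solving `hs` for `u.inv` reduces the claim to `h`
tensored on the left with `T`. -/
lemma compat_whiskerLeft {θ : A ⟶ U ⊗ B} {s : X ⊗ U ⟶ U ⊗ Y} {a : X ⊗ A ⟶ A ⊗ Z}
    {b : Y ⊗ B ⟶ B ⊗ Z} (h : X ◁ θ ≫ braidComp s b = a ≫ θ ▷ Z) {s' : X' ⊗ U' ⟶ U' ⊗ Y'}
    {x : X' ⊗ T ⟶ T ⊗ X} {u : U' ⊗ T ≅ T ⊗ U} {y : Y' ⊗ T ⟶ T ⊗ Y}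
    (hs : Square T (braidTensor x u.hom) (braidTensor u.hom y) s' s) :
    X' ◁ (T ◁ θ ≫ (α_ _ _ _).inv ≫ u.inv ▷ B ≫ (α_ _ _ _).hom) ≫ braidComp s' (braidComp y b) =
      braidComp x a ≫ (T ◁ θ ≫ (α_ _ _ _).inv ≫ u.inv ▷ B ≫ (α_ _ _ _).hom) ▷ Z := by
  have hs' : X' ◁ u.inv ≫ (α_ _ _ _).inv ≫ s' ▷ T ≫ (α_ _ _ _).hom ≫ U' ◁ y =
      (α_ _ _ _).inv ≫ x ▷ U ≫ (α_ _ _ _).hom ≫ T ◁ s ≫ (α_ _ _ _).inv ≫ u.inv ▷ Y ≫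
        (α_ _ _ _).hom := by
    have e : s' ▷ T ≫ (α_ _ _ _).hom ≫ U' ◁ y =
        (s' ▷ T ≫ braidTensor u.hom y) ≫ (α_ _ _ _).inv ≫ u.inv ▷ Y ≫ (α_ _ _ _).hom := by
      simp [braidTensor]
    rw [e, hs]
    simp [braidTensor]
  calc _ = X' ◁ T ◁ θ ⊗≫ (X' ◁ u.inv ≫ (α_ _ _ _).inv ≫ s' ▷ T ≫ (α_ _ _ _).hom ≫ U' ◁ y) ▷ B ⊗≫
          U' ◁ T ◁ b ⊗≫ 𝟙 _ := by
        simp only [braidComp]; monoidal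
    _ = 𝟙 _ ⊗≫ ((X' ⊗ T) ◁ θ ≫ x ▷ (U ⊗ B)) ⊗≫ T ◁ s ▷ B ⊗≫
          (u.inv ▷ (Y ⊗ B) ≫ (U' ⊗ T) ◁ b) ⊗≫ 𝟙 _ := by
        rw [hs']; monoidal
    _ = 𝟙 _ ⊗≫ x ▷ A ⊗≫ T ◁ (X ◁ θ ≫ braidComp s b) ⊗≫ u.inv ▷ (B ⊗ Z) ⊗≫ 𝟙 _ := by
        rw [whisker_exchange, ← whisker_exchange u.inv]; simp only [braidComp]; monoidal
    _ = _ := by rw [h]; simp only [braidComp]; monoidal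

lemma compat_associator {P Q R : E} {p : X ⊗ P ⟶ P ⊗ Y} {q : Y ⊗ Q ⟶ Q ⊗ Z} {r : Z ⊗ R ⟶ R ⊗ W}
    {s : X ⊗ U ⟶ U ⊗ V} {b : V ⊗ T ⟶ T ⊗ W} {θ : (P ⊗ Q) ⊗ R ⟶ U ⊗ T}
    (h : X ◁ θ ≫ braidComp s b = braidComp (braidComp p q) r ≫ θ ▷ W) :
    X ◁ ((α_ P Q R).inv ≫ θ) ≫ braidComp s b =
      braidComp p (braidComp q r) ≫ ((α_ P Q R).inv ≫ θ) ▷ W := by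
  rw [← cancel_epi (X ◁ (α_ P Q R).hom), reassoc_of% braidComp_assoc p q r]
  simpa using h

lemma compat_unit {e : 𝟙_ E ⟶ U} {f : X ⟶ Y} {φ : A ⟶ B} {s : X ⊗ U ⟶ U ⊗ Y} {a : X ⊗ A ⟶ A ⊗ Z}
    {b : Y ⊗ B ⟶ B ⊗ Z} (h : f ▷ A ≫ Y ◁ φ ≫ b = a ≫ φ ▷ Z)
    (hs : X ◁ e ≫ s = (ρ_ _).hom ≫ f ≫ (λ_ _).inv ≫ e ▷ Y) :
    X ◁ (φ ≫ (λ_ B).inv ≫ e ▷ B) ≫ braidComp s b = a ≫ (φ ≫ (λ_ B).inv ≫ e ▷ B) ▷ Z := by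
  calc _ = X ◁ φ ⊗≫ (X ◁ e ≫ s) ▷ B ⊗≫ U ◁ b ⊗≫ 𝟙 _ := by
        simp only [braidComp]; monoidal
    _ = (X ◁ φ ≫ f ▷ B) ⊗≫ (e ▷ (Y ⊗ B) ≫ U ◁ b) ⊗≫ 𝟙 _ := by rw [hs]; monoidal
    _ = (f ▷ A ≫ Y ◁ φ ≫ b) ⊗≫ e ▷ (B ⊗ Z) ⊗≫ 𝟙 _ := by
        rw [whisker_exchange, ← whisker_exchange e]; monoidal
    _ = _ := by rw [h]; monoidal

/-- By interchange the invertible `b` appears last on both sides, so it cancels, and then `T`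
cancels by faithfulness. This extracts the modification axiom from an identity involving `T q`. -/
lemma eq_of_braidComp (hT : RightFaithful T) {g : U ⟶ V} {s : X ⊗ U ⟶ U ⊗ Y} {s' : X ⊗ V ⟶ V ⊗ Y}
    {b : Y ⊗ T ⟶ T ⊗ Z} [IsIso b]
    (h : X ◁ g ▷ T ≫ braidComp s' b = braidComp s b ≫ g ▷ T ▷ Z) : X ◁ g ≫ s' = s ≫ g ▷ Y := by
  apply hT
  rw [← cancel_mono ((α_ _ _ _).hom ≫ V ◁ b ≫ (α_ _ _ _).inv), ← cancel_epi (α_ _ _ _).inv]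
  calc _ = X ◁ g ▷ T ≫ braidComp s' b := by simp [braidComp]
    _ = 𝟙 _ ⊗≫ s ▷ T ⊗≫ (U ◁ b ≫ g ▷ (T ⊗ Z)) ⊗≫ 𝟙 _ := by
        rw [h]; simp only [braidComp]; monoidal
    _ = _ := by rw [whisker_exchange]; monoidal

end

variable {F G H K : D ⥤ D} [F.Monoidal] [G.Monoidal] [H.Monoidal] [K.Monoidal]
variable (J : D ⥤ E) [J.Monoidal]

/-- A half braiding morphism of `D`, transported along `J`. -/
def imageHom {X U V Y : D} (f : X ⊗ U ⟶ V ⊗ Y) :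
    J.obj X ⊗ J.obj U ⟶ J.obj V ⊗ J.obj Y := μ J _ _ ≫ J.map f ≫ δ J _ _

variable {J}

lemma μ_map_associator_inv (X Y Z : D) : μ J X (Y ⊗ Z) ≫ J.map (α_ X Y Z).inv =
    J.obj X ◁ δ J Y Z ≫ (α_ _ _ _).inv ≫ μ J X Y ▷ J.obj Z ≫ μ J (X ⊗ Y) Z := by
  rw [← Functor.LaxMonoidal.associativity_inv, ← MonoidalCategory.whiskerLeft_comp_assoc,
    Functor.Monoidal.δ_μ, MonoidalCategory.whiskerLeft_id, Category.id_comp]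

lemma μ_map_associator_hom (X Y Z : D) : μ J (X ⊗ Y) Z ≫ J.map (α_ X Y Z).hom =
    δ J X Y ▷ J.obj Z ≫ (α_ _ _ _).hom ≫ J.obj X ◁ μ J Y Z ≫ μ J X (Y ⊗ Z) := by
  rw [← Functor.LaxMonoidal.associativity, ← comp_whiskerRight_assoc,
    Functor.Monoidal.δ_μ, id_whiskerRight, Category.id_comp]

lemma μ_map_associator_inv_assoc (X Y Z : D) {T : E} (f : J.obj ((X ⊗ Y) ⊗ Z) ⟶ T) :
    μ J X (Y ⊗ Z) ≫ J.map (α_ X Y Z).inv ≫ f =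
      J.obj X ◁ δ J Y Z ≫ (α_ _ _ _).inv ≫ μ J X Y ▷ J.obj Z ≫ μ J (X ⊗ Y) Z ≫ f := by
  simpa only [Category.assoc] using congrArg (· ≫ f) (μ_map_associator_inv X Y Z)

lemma μ_map_associator_hom_assoc (X Y Z : D) {T : E} (f : J.obj (X ⊗ Y ⊗ Z) ⟶ T) :
    μ J (X ⊗ Y) Z ≫ J.map (α_ X Y Z).hom ≫ f =
      δ J X Y ▷ J.obj Z ≫ (α_ _ _ _).hom ≫ J.obj X ◁ μ J Y Z ≫ μ J X (Y ⊗ Z) ≫ f := by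
  simpa only [Category.assoc] using congrArg (· ≫ f) (μ_map_associator_hom X Y Z)

/-- The maps `μ J` and `δ J` at the two ends are invertible and cancel, so faithfulness of `J`
allows the axioms of a pseudonatural isomorphism of `D` to be tested in `E`. -/
lemma square_imageHom [J.Faithful] {X Y X' Y' U : D} {s : X ⊗ U ⟶ U ⊗ Y} {s' : X' ⊗ U ⟶ U ⊗ Y'}
    {f : X ⟶ X'} {g : Y ⟶ Y'}
    (h : Square (J.obj U) (imageHom J s) (imageHom J s') (J.map f) (J.map g)) :
    Square U s s' f g := by
  simp only [Square, imageHom] at h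
  rw [Functor.LaxMonoidal.μ_natural_left_assoc, Category.assoc, Category.assoc,
    Functor.OplaxMonoidal.δ_natural_right, cancel_epi, ← J.map_comp_assoc, ← J.map_comp_assoc,
    cancel_mono] at h
  exact J.map_injective h

lemma imageHom_braidUnit (U : D) :
    Square (J.obj U) (braidUnit (J.obj U)) (imageHom J (braidUnit U)) (ε J) (ε J) := by
  simp [Square, imageHom, braidUnit]

lemma imageHom_braidTensor {X Y X' Y' U : D} (s : X ⊗ U ⟶ U ⊗ Y) (s' : X' ⊗ U ⟶ U ⊗ Y') :
    Square (J.obj U) (braidTensor (imageHom J s) (imageHom J s')) (imageHom J (braidTensor s s'))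
      (μ J _ _) (μ J _ _) := by
  simp only [Square, imageHom, braidTensor, J.map_comp, Category.assoc,
    ← Functor.LaxMonoidal.μ_natural_right_assoc,
    μ_map_associator_inv_assoc, ← Functor.LaxMonoidal.μ_natural_left_assoc,
    μ_map_associator_hom_assoc]
  simp

/-- A pseudonatural isomorphism `F ⇒ G` obtained by comparing half braidings for `F` and `G`. -/
@[simps]
def PseudonatIso.ofHalfBraidings [J.Faithful] (P : HalfBraiding J F) (P' : HalfBraiding J G)
    (hT : RightFaithful P'.T) {U : D}
    (hU : ∃ U' : D, Nonempty (U ⊗ U' ≅ 𝟙_ D) ∧ Nonempty (U' ⊗ U ≅ 𝟙_ D))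
    (θ : P.T ≅ J.obj U ⊗ P'.T) (χ : ∀ V, F.obj V ⊗ U ≅ U ⊗ G.obj V)
    (h : ∀ V, J.obj (F.obj V) ◁ θ.hom ≫ braidComp (imageHom J (χ V).hom) (P'.β V).hom =
      (P.β V).hom ≫ θ.hom ▷ J.obj V) : PseudonatIso F G where
  U := U
  invertible := hU
  χ := χ
  naturality {V W} f := square_imageHom <|
    -- The square past `P.T` is carried along `θ` to one past `J U ⊗ P'.T`; the known square past
    -- `P'.T` is then cancelled. The unit and tensor axioms use the same two moves.
    .of_braidComp hT (P'.naturality f) ((P.naturality f).transport (h V) (h W))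
  unit := by
    have h₁ : Square _ _ _ _ _ := .of_braidComp hT P'.unit (P.unit.transport (θ := θ)
      (by rw [braidComp_braidUnit]; exact braidUnit_natural _) (h _))
    have h₂ := (imageHom_braidUnit (J := J) U).inv (f := Functor.Monoidal.εIso J)
      (g := Functor.Monoidal.εIso J)
    have h₃ := square_imageHom (f := ε F) (g := ε G) (by simpa using h₂.comp h₁)
    simpa [Square, braidUnit] using h₃
  tensor V W := by
    have h₁ : Square _ _ _ _ _ := .of_braidComp hT (P'.tensor V W) ((P.tensor V W).transport (θ := θ)
      (by rw [braidComp_braidTensor]; exact braidTensor_natural (h V) (h W)) (h _))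
    have h₂ := (imageHom_braidTensor (J := J) (χ V).hom (χ W).hom).inv
      (f := Functor.Monoidal.μIso J _ _) (g := Functor.Monoidal.μIso J _ _)
    have h₃ := square_imageHom (f := μ F V W) (g := μ G V W) (by simpa using h₂.comp h₁)
    simpa [Square, braidTensor] using h₃

/-! ### Compatibility of a pseudonatural isomorphism with half braidings -/

section thetaIsos

variable {A B C T X : E} {U V : D}

/-- Vertical composition of isomorphisms `A ≅ J(U) ⊗ B` and `B ≅ J(V) ⊗ C`. -/
@[simps!]
def thetaComp (θ : A ≅ J.obj U ⊗ B) (θ' : B ≅ J.obj V ⊗ C) : A ≅ J.obj (U ⊗ V) ⊗ C :=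
  θ ≪≫ whiskerLeftIso _ θ' ≪≫ (α_ _ _ _).symm ≪≫ whiskerRightIso (Functor.Monoidal.μIso J U V) C

/-- Tensoring an isomorphism `A ≅ J(U) ⊗ B` with `T` on the right. -/
@[simps!]
def thetaRight (θ : A ≅ J.obj U ⊗ B) (T : E) : A ⊗ T ≅ J.obj U ⊗ (B ⊗ T) :=
  whiskerRightIso θ T ≪≫ α_ _ _ _

/-- Tensoring an isomorphism `A ≅ J(U) ⊗ B` with `T` on the left. -/
@[simps!]
def thetaLeft (b : X ⊗ T ≅ T ⊗ J.obj U) (θ : A ≅ J.obj U ⊗ B) : T ⊗ A ≅ X ⊗ (T ⊗ B) :=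
  whiskerLeftIso T θ ≪≫ (α_ _ _ _).symm ≪≫ whiskerRightIso b.symm B ≪≫ α_ _ _ _

variable (J) in
/-- The canonical isomorphism `A ≅ J(𝟙) ⊗ A`. -/
@[simps!]
def thetaUnit (A : E) : A ≅ J.obj (𝟙_ D) ⊗ A :=
  (λ_ A).symm ≪≫ whiskerRightIso (Functor.Monoidal.εIso J) A

end thetaIsos

/-- The isomorphism `θ` identifies the half braiding `P` with the composite of `σ` and `P'`. -/
def Compat (P : HalfBraiding J F) (P' : HalfBraiding J G) (σ : PseudonatIso F G)
    (θ : P.T ≅ J.obj σ.U ⊗ P'.T) : Prop :=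
  ∀ V, J.obj (F.obj V) ◁ θ.hom ≫ braidComp (imageHom J (σ.χ V).hom) (P'.β V).hom =
    (P.β V).hom ≫ θ.hom ▷ J.obj V

namespace Compat

variable {P : HalfBraiding J F} {P' : HalfBraiding J G} {P'' : HalfBraiding J H}

lemma comp {σ : PseudonatIso F G} {θ : P.T ≅ J.obj σ.U ⊗ P'.T}
    {τ : PseudonatIso G H} {θ' : P'.T ≅ J.obj τ.U ⊗ P''.T}
    (h : Compat P P' σ θ) (h' : Compat P' P'' τ θ') :
    Compat P P'' (σ.comp τ) (thetaComp θ θ') := fun V => by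
  have e : J.obj (F.obj V) ◁ μ J σ.U τ.U ≫ imageHom J ((σ.comp τ).χ V).hom =
      braidComp (imageHom J (σ.χ V).hom) (imageHom J (τ.χ V).hom) ≫
        μ J σ.U τ.U ▷ J.obj (H.obj V) := by
    simp only [imageHom, braidComp, PseudonatIso.comp, Iso.trans_hom, Iso.symm_hom,
      whiskerRightIso_hom, whiskerLeftIso_hom, J.map_comp, Category.assoc,
      μ_map_associator_inv_assoc, ← Functor.LaxMonoidal.μ_natural_left_assoc,
      μ_map_associator_hom_assoc, ← Functor.LaxMonoidal.μ_natural_right_assoc]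
    simp
  exact compat_comp (h V) (h' V) e

lemma whiskerRight {σ : PseudonatIso F G} {θ : P.T ≅ J.obj σ.U ⊗ P'.T} (h : Compat P P' σ θ)
    (R : HalfBraiding J K) :
    Compat (F := K ⋙ F) (G := K ⋙ G) (HalfBraiding.comp P R) (HalfBraiding.comp P' R)
      (σ.whiskerRight K) (thetaRight θ R.T) := fun V => by
  exact compat_whiskerRight (h (K.obj V)) (R.β V).hom

lemma whiskerLeft {σ : PseudonatIso F G} {θ : P.T ≅ J.obj σ.U ⊗ P'.T} (h : Compat P P' σ θ)
    (R : HalfBraiding J K) :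
    Compat (F := F ⋙ K) (G := G ⋙ K) (HalfBraiding.comp R P) (HalfBraiding.comp R P')
      (σ.whiskerLeft K) (thetaLeft (R.β σ.U) θ) := fun V => by
  -- This is naturality of the half braiding `R` at the morphism `σ.χ V` of `D`, with the
  -- tensorators of `K ⋙ J` and `J` inserted at the two ends.
  have e : Square R.T (braidTensor (R.β (F.obj V)).hom (R.β σ.U).hom)
      (braidTensor (R.β σ.U).hom (R.β (G.obj V)).hom)
      (imageHom J ((σ.whiskerLeft K).χ V).hom) (imageHom J (σ.χ V).hom) := by
    have := ((R.tensor (F.obj V) σ.U).comp (R.naturality (σ.χ V).hom)).comp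
      ((R.tensor σ.U (G.obj V)).inv (f := Functor.Monoidal.μIso (K ⋙ J) _ _)
        (g := Functor.Monoidal.μIso J _ _))
    simpa [imageHom, PseudonatIso.whiskerLeft] using this
  exact compat_whiskerLeft (h V) (u := R.β σ.U) e

lemma reassoc {L : D ⥤ D} [L.Monoidal] {R : HalfBraiding J K} {S : HalfBraiding J H}
    {Q : HalfBraiding J L} {σ : PseudonatIso (H ⋙ (K ⋙ L)) G}
    {θ : (HalfBraiding.comp (HalfBraiding.comp Q R) S).T ≅ J.obj σ.U ⊗ P'.T}
    (h : Compat (HalfBraiding.comp (HalfBraiding.comp Q R) S) P' σ θ) :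
    Compat (HalfBraiding.comp Q (HalfBraiding.comp R S)) P' σ.reassoc
      ((α_ Q.T R.T S.T).symm ≪≫ θ) := fun V => by
  exact compat_associator (h V)

lemma ofNatIso (e : F ≅ G) [NatTrans.IsMonoidal e.hom] (φ : P.T ≅ P'.T)
    (h : ∀ V, J.map (e.hom.app V) ▷ P.T ≫ J.obj (G.obj V) ◁ φ.hom ≫ (P'.β V).hom =
      (P.β V).hom ≫ φ.hom ▷ J.obj V) :
    Compat P P' (PseudonatIso.ofNatIso e) (φ ≪≫ thetaUnit J P'.T) := fun V => by
  have e₁ : J.obj (F.obj V) ◁ ε J ≫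
      imageHom J ((ρ_ (F.obj V)).hom ≫ e.hom.app V ≫ (λ_ (G.obj V)).inv) =
      (ρ_ _).hom ≫ J.map (e.hom.app V) ≫ (λ_ _).inv ≫ ε J ▷ J.obj (G.obj V) := by
    rw [imageHom, J.map_comp, J.map_comp, Functor.LaxMonoidal.right_unitality J (F.obj V),
      ← Functor.LaxMonoidal.left_unitality_inv J (G.obj V)]
    simp only [Category.assoc, Functor.Monoidal.μ_δ, Category.comp_id]
  exact compat_unit (h V) e₁

end Compat

/-- An isomorphism between pseudonatural isomorphisms that is compatible with half braidings is a
modification. -/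
def Modification.ofCompat [J.Faithful] {P : HalfBraiding J F} {P' : HalfBraiding J G}
    (hT : RightFaithful P'.T)
    {σ τ : PseudonatIso F G} {θ : P.T ≅ J.obj σ.U ⊗ P'.T} (h : Compat P P' σ θ)
    (Γ : σ.U ≅ τ.U)
    (hΓ : ∀ V, J.obj (F.obj V) ◁ (θ.hom ≫ J.map Γ.hom ▷ P'.T) ≫
        braidComp (imageHom J (τ.χ V).hom) (P'.β V).hom =
      (P.β V).hom ≫ (θ.hom ≫ J.map Γ.hom ▷ P'.T) ▷ J.obj V) : Modification σ τ where
  Γ := Γ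
  comm V := by
    have h₁ := hΓ V
    -- Both `θ` and its composite with `J Γ` intertwine the half braidings; cancelling the
    -- invertible `θ` leaves the modification axiom tensored with `P'.T`.
    rw [comp_whiskerRight, ← reassoc_of% h V, MonoidalCategory.whiskerLeft_comp, Category.assoc,
      cancel_epi] at h₁
    have h₃ := eq_of_braidComp hT h₁
    apply J.map_injective
    rw [J.map_comp, J.map_comp, ← cancel_epi (μ J _ _), ← cancel_mono (δ J _ _)]
    simpa [imageHom] using h₃

end Compat

section Over

open Functor.LaxMonoidal (μ ε)
open Functor.OplaxMonoidal (δ η)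

variable {D : Type*} [Category* D] [MonoidalCategory D]
  {E : Type*} [Category* E] [MonoidalCategory E]
variable {J : D ⥤ E} [J.Monoidal]
variable {A A' B C T S X : E} {U V W U' V' : D}

/-- The half braiding of `V`. -/
abbrev HalfBraiding.braid {K : D ⥤ D} [K.Monoidal] (P : HalfBraiding J K) (V : D) :
    J.obj (K.obj V) ⊗ P.T ≅ P.T ⊗ J.obj V := P.β V

/-! ### Coherence of the isomorphisms `A ≅ J(U) ⊗ B` -/

/-- This and the following identities move associators to the front of a comparison isomorphism.
They make the target of one `Over` relation literally the source of the next in the pentagon and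
triangle. -/
lemma thetaComp_trans (φ : A' ≅ A) (θ : A ≅ J.obj U ⊗ B) (θ' : B ≅ J.obj V ⊗ C) :
    thetaComp (φ ≪≫ θ) θ' = φ ≪≫ thetaComp θ θ' := by
  ext; simp

lemma thetaRight_trans (φ : A' ≅ A) (θ : A ≅ J.obj U ⊗ B) (T : E) :
    thetaRight (φ ≪≫ θ) T = whiskerRightIso φ T ≪≫ thetaRight θ T := by
  ext; simp

lemma thetaLeft_trans {X : D} (b : J.obj X ⊗ T ≅ T ⊗ J.obj U) (φ : A' ≅ A) (θ : A ≅ J.obj U ⊗ B) :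
    thetaLeft b (φ ≪≫ θ) = whiskerLeftIso T φ ≪≫ thetaLeft b θ := by
  ext; simp

lemma thetaRight_thetaComp (θ : A ≅ J.obj U ⊗ B) (θ' : B ≅ J.obj V ⊗ C) (T : E) :
    thetaRight (thetaComp θ θ') T = thetaComp (thetaRight θ T) (thetaRight θ' T) := by
  ext; simp only [thetaRight_hom, thetaComp_hom]; monoidal

lemma thetaRight_thetaUnit (A T : E) : thetaRight (thetaUnit J A) T = thetaUnit J (A ⊗ T) := by
  ext; simp only [thetaRight_hom, thetaUnit_hom]; monoidal

lemma thetaComp_thetaRight_assoc (θ : A ≅ J.obj U ⊗ B) (ψ : (B ⊗ S) ⊗ T ≅ J.obj V ⊗ C) :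
    thetaComp (thetaRight θ (S ⊗ T)) ((α_ B S T).symm ≪≫ ψ) =
      (α_ A S T).symm ≪≫ thetaComp (thetaRight (thetaRight θ S) T) ψ := by
  ext; simp only [thetaRight_hom, thetaComp_hom, Iso.trans_hom, Iso.symm_hom]; monoidal

lemma thetaComp_thetaLeft_thetaRight {X : D} (b : J.obj X ⊗ S ≅ S ⊗ J.obj U) (θ : A ≅ J.obj U ⊗ B)
    (ψ : (S ⊗ B) ⊗ T ≅ J.obj V ⊗ C) :
    thetaComp (thetaLeft b (thetaRight θ T)) ((α_ S B T).symm ≪≫ ψ) =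
      (α_ S A T).symm ≪≫ thetaComp (thetaRight (thetaLeft b θ) T) ψ := by
  ext
  simp only [thetaRight_hom, thetaComp_hom, thetaLeft_hom, Iso.trans_hom, Iso.symm_hom]
  monoidal

/-- Successive conjugation by `T` and by `S` is conjugation by `S ⊗ T`, up to the associator. -/
lemma thetaComp_thetaLeft_thetaLeft {X Y : D} (b : J.obj X ⊗ S ≅ S ⊗ J.obj Y)
    (c : J.obj Y ⊗ T ≅ T ⊗ J.obj U) (θ : A ≅ J.obj U ⊗ B) (ψ : (S ⊗ T) ⊗ B ≅ J.obj V ⊗ C) :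
    thetaComp (thetaLeft b (thetaLeft c θ)) ((α_ S T B).symm ≪≫ ψ) =
      (α_ S T A).symm ≪≫ thetaComp (thetaLeft (braidCompIso b c) θ) ψ := by
  ext
  simp only [thetaComp_hom, thetaLeft_hom, Iso.trans_hom, Iso.symm_hom, braidCompIso_inv]
  monoidal

section

variable {X Y Z U V W A B C S T : E}

/-- The hypothesis is inverted to move `m` across `T`; what is left is the interchange of `θ'` with
`a.inv`. Applied to a half braiding, this says that the tensorator of the functor covers the
identity of `E`. -/
lemma conj_tensor {a : X ⊗ T ≅ T ⊗ U} {b : Y ⊗ T ≅ T ⊗ V} {c : Z ⊗ T ≅ T ⊗ W} {n : X ⊗ Y ⟶ Z}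
    {m : U ⊗ V ⟶ W} (h : Square T (braidTensor a.hom b.hom) c.hom n m) (θ : A ⟶ U ⊗ B)
    (θ' : B ⟶ V ⊗ C) :
    (T ◁ θ ≫ (α_ _ _ _).inv ≫ a.inv ▷ B ≫ (α_ _ _ _).hom) ≫
        X ◁ (T ◁ θ' ≫ (α_ _ _ _).inv ≫ b.inv ▷ C ≫ (α_ _ _ _).hom) ≫ (α_ _ _ _).inv ≫
          n ▷ (T ⊗ C) =
      T ◁ (θ ≫ U ◁ θ' ≫ (α_ _ _ _).inv ≫ m ▷ C) ≫ (α_ _ _ _).inv ≫ c.inv ▷ C ≫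
        (α_ _ _ _).hom := by
  have h' : (braidTensorIso a b).inv ≫ n ▷ T = T ◁ m ≫ c.inv := by
    rw [Iso.inv_comp_eq, ← Category.assoc, Iso.eq_comp_inv]
    exact h
  symm
  calc _ = T ◁ (θ ≫ U ◁ θ') ⊗≫ (T ◁ m ≫ c.inv) ▷ C ⊗≫ 𝟙 _ := by monoidal
    _ = T ◁ θ ⊗≫ ((T ⊗ U) ◁ θ' ≫ a.inv ▷ (V ⊗ C)) ⊗≫ X ◁ b.inv ▷ C ⊗≫ n ▷ (T ⊗ C) ⊗≫ 𝟙 _ := by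
        rw [← h', braidTensorIso_inv]; monoidal
    _ = _ := by rw [whisker_exchange]; monoidal

lemma conj_unit {c : Z ⊗ T ≅ T ⊗ W} {n : 𝟙_ E ⟶ Z} {m : 𝟙_ E ⟶ W}
    (h : Square T (braidUnit T) c.hom n m) (A : E) :
    T ◁ ((λ_ A).inv ≫ m ▷ A) ≫ (α_ _ _ _).inv ≫ c.inv ▷ A ≫ (α_ _ _ _).hom =
      (λ_ _).inv ≫ n ▷ (T ⊗ A) := by
  have h' : (ρ_ T).hom ≫ (λ_ T).inv ≫ n ▷ T = T ◁ m ≫ c.inv := by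
    rw [Iso.eq_comp_inv]
    simp only [Category.assoc]
    rw [show n ▷ T ≫ c.hom = _ from h]
    simp [braidUnit]
  calc _ = 𝟙 _ ⊗≫ (T ◁ m ≫ c.inv) ▷ A ⊗≫ 𝟙 _ := by monoidal
    _ = _ := by rw [← h']; monoidal

/-- The interchange of `θ` and `θ'` in `E`, rewritten after conjugating `V` through `S` and through
`T`; the discrepancy between the two conjugates is `s`. -/
lemma conj_exchange {s : X ⊗ U ⟶ U ⊗ Y} {a : X ⊗ S ≅ S ⊗ V} {b : Y ⊗ T ≅ T ⊗ V} {θ : S ⟶ U ⊗ T}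
    (h : X ◁ θ ≫ braidComp s b.hom = a.hom ≫ θ ▷ V) (θ' : A ⟶ V ⊗ B) :
    (S ◁ θ' ≫ (α_ _ _ _).inv ≫ a.inv ▷ B ≫ (α_ _ _ _).hom) ≫
        X ◁ (θ ▷ B ≫ (α_ _ _ _).hom) ≫ (α_ _ _ _).inv ≫ s ▷ (T ⊗ B) =
      (θ ▷ A ≫ (α_ _ _ _).hom) ≫
        U ◁ (T ◁ θ' ≫ (α_ _ _ _).inv ≫ b.inv ▷ B ≫ (α_ _ _ _).hom) ≫ (α_ _ _ _).inv := by
  have h' : a.inv ≫ X ◁ θ ≫ (α_ _ _ _).inv ≫ s ▷ T =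
      θ ▷ V ≫ (α_ _ _ _).hom ≫ U ◁ b.inv ≫ (α_ _ _ _).inv := by
    rw [Iso.inv_comp_eq, ← reassoc_of% h]
    simp [braidComp]
  calc _ = S ◁ θ' ⊗≫ (a.inv ≫ X ◁ θ ≫ (α_ _ _ _).inv ≫ s ▷ T) ▷ B ⊗≫ 𝟙 _ := by monoidal
    _ = (S ◁ θ' ≫ θ ▷ (V ⊗ B)) ⊗≫ U ◁ b.inv ▷ B ⊗≫ 𝟙 _ := by rw [h']; monoidal
    _ = _ := by rw [whisker_exchange]; monoidal

end

/-! ### Morphisms lying over a scalar -/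

variable [Preadditive E] {R : Type*} [CommRing R] [Linear R E]

/-- The morphism `Γ` identifies `θ` with `θ'` up to the scalar `p`. -/
def Over (θ : A ≅ J.obj U ⊗ T) (θ' : A ≅ J.obj V ⊗ T) (Γ : U ⟶ V) (p : R) : Prop :=
  θ.hom ≫ J.map Γ ▷ T = p • θ'.hom

/-- Tensoring on the left is `R`-linear. -/
def LeftLinear (R E : Type*) [CommRing R] [Category E] [Preadditive E] [MonoidalCategory E]
    [Linear R E] : Prop :=
  ∀ (p : R) {X Y : E} (Z : E) (f : X ⟶ Y), Z ◁ (p • f) = p • (Z ◁ f)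

namespace Over

variable {p p' : R}

lemma congr {θ : A ≅ J.obj U ⊗ T} {θ' θ'' : A ≅ J.obj V ⊗ T} {Γ : U ⟶ V} (h : Over θ θ' Γ p)
    (e : θ' = θ'') : Over θ θ'' Γ p :=
  e ▸ h

lemma congr_scalar {θ : A ≅ J.obj U ⊗ T} {θ' : A ≅ J.obj V ⊗ T} {Γ : U ⟶ V} (h : Over θ θ' Γ p)
    (e : p = p') : Over θ θ' Γ p' :=
  e ▸ h

lemma comp {θ : A ≅ J.obj U ⊗ T} {θ' : A ≅ J.obj V ⊗ T} {θ'' : A ≅ J.obj W ⊗ T} {Γ : U ⟶ V}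
    {Γ' : V ⟶ W} (h : Over θ θ' Γ p) (h' : Over θ' θ'' Γ' p') : Over θ θ'' (Γ ≫ Γ') (p * p') := by
  unfold Over at *
  rw [J.map_comp, comp_whiskerRight, reassoc_of% h, Linear.smul_comp, h', smul_smul]

/-- Scalar `1` is enough: only associators and tensorators are ever inverted, never `Ω`. -/
lemma inv {θ : A ≅ J.obj U ⊗ T} {θ' : A ≅ J.obj V ⊗ T} {Γ : U ≅ V}
    (h : Over θ θ' Γ.hom (1 : R)) : Over θ' θ Γ.inv (1 : R) := by
  unfold Over at *
  rw [one_smul] at *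
  rw [← h, Category.assoc, ← comp_whiskerRight, ← J.map_comp]
  simp

lemma trans {θ : A ≅ J.obj U ⊗ T} {θ' : A ≅ J.obj V ⊗ T} {Γ : U ⟶ V}
    (h : Over θ θ' Γ p) (φ : A' ≅ A) : Over (φ ≪≫ θ) (φ ≪≫ θ') Γ p := by
  unfold Over at *
  rw [Iso.trans_hom, Iso.trans_hom, Category.assoc, h, Linear.comp_smul]

lemma whiskerRight {θ : A ≅ J.obj U ⊗ B} {θ' : A ≅ J.obj V ⊗ B} {Γ : U ⟶ V} (h : Over θ θ' Γ p)
    (ψ : B ≅ J.obj W ⊗ T) : Over (thetaComp θ ψ) (thetaComp θ' ψ) (Γ ▷ W) p := by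
  unfold Over at *
  have n : J.map Γ ▷ J.obj W ▷ T ≫ μ J V W ▷ T = μ J U W ▷ T ≫ J.map (Γ ▷ W) ▷ T := by
    rw [← comp_whiskerRight, Functor.LaxMonoidal.μ_natural_left, comp_whiskerRight]
  calc _ = (θ.hom ≫ J.map Γ ▷ B) ≫ J.obj V ◁ ψ.hom ≫ (α_ _ _ _).inv ≫ μ J V W ▷ T := by
        rw [Category.assoc, ← whisker_exchange_assoc, associator_inv_naturality_left_assoc, n]
        simp
    _ = _ := by rw [h]; simp

lemma whiskerLeft (hR : LeftLinear R E) {θ : B ≅ J.obj U ⊗ T} {θ' : B ≅ J.obj V ⊗ T} {Γ : U ⟶ V}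
    (h : Over θ θ' Γ p) (ψ : A ≅ J.obj W ⊗ B) :
    Over (thetaComp ψ θ) (thetaComp ψ θ') (W ◁ Γ) p := by
  unfold Over at *
  have n : (J.obj W ◁ J.map Γ) ▷ T ≫ μ J W V ▷ T = μ J W U ▷ T ≫ J.map (W ◁ Γ) ▷ T := by
    rw [← comp_whiskerRight, Functor.LaxMonoidal.μ_natural_right, comp_whiskerRight]
  calc _ = ψ.hom ≫ J.obj W ◁ (θ.hom ≫ J.map Γ ▷ T) ≫ (α_ _ _ _).inv ≫ μ J W V ▷ T := by
        rw [MonoidalCategory.whiskerLeft_comp, Category.assoc,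
          associator_inv_naturality_middle_assoc, n]
        simp
    _ = _ := by rw [h, hR]; simp

/-- The scalar is allowed to change because tensoring on the right in `E` translates functions on
`Q`. For `T = T t` one has `p' b = p (t b)`, and this is the only source of the anomaly. -/
lemma thetaRight {θ : A ≅ J.obj U ⊗ B} {θ' : A ≅ J.obj V ⊗ B} {Γ : U ⟶ V} (h : Over θ θ' Γ p)
    (hT : ∀ {X Y : E} (f : X ⟶ Y), (p • f) ▷ T = p' • (f ▷ T)) :
    Over (thetaRight θ T) (thetaRight θ' T) Γ p' := by
  unfold Over at *
  calc _ = (θ.hom ≫ J.map Γ ▷ B) ▷ T ≫ (α_ _ _ _).hom := by simp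
    _ = _ := by rw [h, hT]; simp

lemma thetaLeft (hR : LeftLinear R E) {U₁ V₁ : D} {θ : A ≅ J.obj U ⊗ B} {θ' : A ≅ J.obj V ⊗ B}
    {Γ : U ⟶ V} (h : Over θ θ' Γ p) {b : J.obj U₁ ⊗ T ≅ T ⊗ J.obj U} {b' : J.obj V₁ ⊗ T ≅ T ⊗ J.obj V}
    {Γ₁ : U₁ ⟶ V₁} (hb : Square T b.hom b'.hom (J.map Γ₁) (J.map Γ)) :
    Over (thetaLeft b θ) (thetaLeft b' θ') Γ₁ p := by
  unfold Over at *
  have hb' : b.inv ≫ J.map Γ₁ ▷ T = T ◁ J.map Γ ≫ b'.inv := by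
    rw [Iso.inv_comp_eq, ← Category.assoc, Iso.eq_comp_inv]
    exact hb
  calc _ = T ◁ θ.hom ≫ (α_ _ _ _).inv ≫ (b.inv ≫ J.map Γ₁ ▷ T) ▷ B ≫ (α_ _ _ _).hom := by simp
    _ = T ◁ (θ.hom ≫ J.map Γ ▷ B) ≫ (α_ _ _ _).inv ≫ b'.inv ▷ B ≫ (α_ _ _ _).hom := by
        rw [hb']; simp
    _ = _ := by rw [h, hR]; simp

lemma associator (θ : A ≅ J.obj U ⊗ B) (θ' : B ≅ J.obj V ⊗ C) (θ'' : C ≅ J.obj W ⊗ T) :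
    Over (thetaComp (thetaComp θ θ') θ'') (thetaComp θ (thetaComp θ' θ'')) (α_ U V W).hom
      (1 : R) := by
  have n : μ J U V ▷ (J.obj W ⊗ T) ≫ (α_ _ _ _).inv ≫ μ J (U ⊗ V) W ▷ T ≫
      J.map (α_ U V W).hom ▷ T = (α_ _ _ _).inv ≫
        ((α_ _ _ _).hom ≫ J.obj U ◁ μ J V W ≫ μ J U (V ⊗ W)) ▷ T := by
    rw [associator_inv_naturality_left_assoc, ← Functor.LaxMonoidal.associativity]
    simp only [comp_whiskerRight]
  simp only [Over, thetaComp_hom, one_smul, Category.assoc]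
  rw [← whisker_exchange_assoc, n]
  simp

lemma leftUnitor (θ : A ≅ J.obj U ⊗ B) :
    Over (thetaComp (thetaUnit J A) θ) θ (λ_ U).hom (1 : R) := by
  have n : ε J ▷ (J.obj U ⊗ B) ≫ (α_ _ _ _).inv ≫ μ J (𝟙_ D) U ▷ B ≫ J.map (λ_ U).hom ▷ B =
      (α_ _ _ _).inv ≫ (λ_ _).hom ▷ B := by
    rw [associator_inv_naturality_left_assoc, Functor.LaxMonoidal.left_unitality]
    simp only [comp_whiskerRight]
  simp only [Over, thetaComp_hom, thetaUnit_hom, one_smul, Category.assoc]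
  rw [← whisker_exchange_assoc, n]
  monoidal

lemma μ_thetaLeft {K : D ⥤ D} [K.Monoidal] (P : HalfBraiding J K) (θ : A ≅ J.obj U ⊗ B)
    (θ' : B ≅ J.obj V ⊗ C) :
    Over (thetaComp (Anomalous.thetaLeft (P.braid U) θ) (Anomalous.thetaLeft (P.braid V) θ'))
      (Anomalous.thetaLeft (P.braid (U ⊗ V)) (thetaComp θ θ')) (μ K U V) (1 : R) := by
  have h : Square P.T (braidTensor (P.braid U).hom (P.braid V).hom) (P.braid (U ⊗ V)).hom
      (μ J _ _ ≫ J.map (μ K U V)) (μ J U V) := by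
    simpa using P.tensor U V
  have := conj_tensor h θ.hom θ'.hom
  simpa [Over] using this

lemma η_thetaLeft {K : D ⥤ D} [K.Monoidal] (P : HalfBraiding J K) (A : E) :
    Over (Anomalous.thetaLeft (P.braid (𝟙_ D)) (thetaUnit J A)) (thetaUnit J (P.T ⊗ A)) (η K)
      (1 : R) := by
  have h : Square P.T (braidUnit P.T) (P.braid (𝟙_ D)).hom (ε J ≫ J.map (ε K)) (ε J) := by
    simpa using P.unit
  have h' := congrArg (· ≫ J.map (η K) ▷ (P.T ⊗ A)) (conj_unit h A)
  simp only [Category.assoc, ← comp_whiskerRight, ← J.map_comp, Functor.Monoidal.ε_η,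
    J.map_id, Category.comp_id] at h'
  simpa [Over] using h'

/-- The interchanger of the monoidal `2`-category, which is the half braiding of `σ` at `V`, covers
the ordinary interchange law of `E` and contributes no scalar. -/
lemma exchange {F G : D ⥤ D} [F.Monoidal] [G.Monoidal] {P : HalfBraiding J F}
    {P' : HalfBraiding J G} {σ : PseudonatIso F G} {θ : P.T ≅ J.obj σ.U ⊗ P'.T}
    (h : Compat P P' σ θ) (θ' : A ≅ J.obj V ⊗ B) :
    Over (thetaComp (Anomalous.thetaLeft (P.braid V) θ') (Anomalous.thetaRight θ B))
      (thetaComp (Anomalous.thetaRight θ A) (Anomalous.thetaLeft (P'.braid V) θ'))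
      (σ.χ V).hom (1 : R) := by
  have h' := congrArg (· ≫ μ J _ _ ▷ (P'.T ⊗ B))
    (conj_exchange (a := P.braid V) (b := P'.braid V) (h V) θ'.hom)
  simp only [Category.assoc, imageHom, ← comp_whiskerRight, Functor.Monoidal.δ_μ,
    Category.comp_id] at h'
  simpa [Over] using h'

end Over

end Over

/-! ### Conjugation systems, and the data `F`, `χ`, `ι`, `Ω`, `γ`, `δ` that they produce. -/

section ConjugationSystem

open Functor.LaxMonoidal (μ ε)
open Functor.OplaxMonoidal (δ η)

/-- The morphism `i` is the image under `J` of a component of a functor unitor; it equals the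
identity by `J.map_id`, hence the hypothesis `hi`. -/
lemma leftUnitor_braidComp {E : Type*} [Category* E] [MonoidalCategory E] {X T Y : E} {i : X ⟶ X}
    (hi : i = 𝟙 X) (b : X ⊗ T ⟶ T ⊗ Y) :
    i ▷ (𝟙_ E ⊗ T) ≫ X ◁ (λ_ T).hom ≫ b =
      braidComp ((ρ_ X).hom ≫ (λ_ X).inv) b ≫ (λ_ T).hom ▷ Y := by
  rw [hi, braidComp]; monoidal

lemma rightUnitor_braidComp {E : Type*} [Category* E] [MonoidalCategory E] {X T Y : E} {i : X ⟶ X}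
    (hi : i = 𝟙 X) (b : X ⊗ T ⟶ T ⊗ Y) :
    i ▷ (T ⊗ 𝟙_ E) ≫ X ◁ (ρ_ T).hom ≫ b =
      braidComp b ((ρ_ Y).hom ≫ (λ_ Y).inv) ≫ (ρ_ T).hom ▷ Y := by
  rw [hi, braidComp]; monoidal

/-- A class of morphisms of `E` that contains the image of `J` and is closed under the monoidal
operations, and that contains the associators with one argument in the image of `J`. -/
structure IsConstantClass {D : Type*} [Category* D] [MonoidalCategory D]
    {E : Type*} [Category* E] [MonoidalCategory E] (J : D ⥤ E) [J.Monoidal]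
    (W : MorphismProperty E) : Prop where
  comp : ∀ {X Y Z : E} {f : X ⟶ Y} {g : Y ⟶ Z}, W f → W g → W (f ≫ g)
  whiskerLeft : ∀ (X : E) {Y Z : E} {f : Y ⟶ Z}, W f → W (X ◁ f)
  whiskerRight : ∀ {Y Z : E} {f : Y ⟶ Z} (X : E), W f → W (f ▷ X)
  inv : ∀ {X Y : E} (e : X ≅ Y), W e.hom → W e.inv
  map : ∀ {X Y : D} (f : X ⟶ Y), W (J.map f)
  unit : W (ε J)
  tensor : ∀ X Y, W (μ J X Y)
  associator_left : ∀ (X : D) (Y Z : E), W (α_ (J.obj X) Y Z).hom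
  associator_middle : ∀ (X : E) (Y : D) (Z : E), W (α_ X (J.obj Y) Z).hom
  associator_right : ∀ (X Y : E) (Z : D), W (α_ X Y (J.obj Z)).hom
  leftUnitor : ∀ X : E, W (λ_ X).hom
  rightUnitor : ∀ X : E, W (ρ_ X).hom

namespace IsConstantClass

variable {D : Type*} [Category* D] [MonoidalCategory D]
    {E : Type*} [Category* E] [MonoidalCategory E] {J : D ⥤ E} [J.Monoidal]
    {W : MorphismProperty E} (hW : IsConstantClass J W)

include hW

lemma counit : W (η J) := hW.inv (Functor.Monoidal.εIso J) hW.unit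

lemma cotensor (X Y : D) : W (δ J X Y) := hW.inv (Functor.Monoidal.μIso J X Y) (hW.tensor X Y)

/-- Every associator that occurs has an object of the form `J.obj _` in some slot. The same holds in
the next lemmas; associators of three arbitrary objects of `E` need not be constant. -/
lemma braidTensor {X X' Y Y' : D} {U : E} {s : J.obj X ⊗ U ⟶ U ⊗ J.obj Y}
    {s' : J.obj X' ⊗ U ⟶ U ⊗ J.obj Y'} (hs : W s) (hs' : W s') : W (braidTensor s s') :=
  hW.comp (hW.associator_left _ _ _) <| hW.comp (hW.whiskerLeft _ hs') <|
    hW.comp (hW.inv _ (hW.associator_left _ _ _)) <| hW.comp (hW.whiskerRight _ hs)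
      (hW.associator_right _ _ _)

lemma braidComp {X Y Z : D} {U T : E} {s : J.obj X ⊗ U ⟶ U ⊗ J.obj Y}
    {t : J.obj Y ⊗ T ⟶ T ⊗ J.obj Z} (hs : W s) (ht : W t) : W (braidComp s t) :=
  hW.comp (hW.inv _ (hW.associator_left _ _ _)) <| hW.comp (hW.whiskerRight _ hs) <|
    hW.comp (hW.associator_middle _ _ _) <| hW.comp (hW.whiskerLeft _ ht)
      (hW.inv _ (hW.associator_right _ _ _))

variable {U V : D} {A B C : E}

lemma thetaComp {θ : A ≅ J.obj U ⊗ B} {θ' : B ≅ J.obj V ⊗ C} (h : W θ.hom) (h' : W θ'.hom) :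
    W (thetaComp θ θ').hom :=
  hW.comp h <| hW.comp (hW.whiskerLeft _ h') <| hW.comp (hW.inv _ (hW.associator_left _ _ _))
    (hW.whiskerRight _ (hW.tensor _ _))

lemma thetaRight {θ : A ≅ J.obj U ⊗ B} (h : W θ.hom) (T : E) : W (thetaRight θ T).hom :=
  hW.comp (hW.whiskerRight _ h) (hW.associator_left _ _ _)

lemma thetaLeft {X : D} {T : E} {b : J.obj X ⊗ T ≅ T ⊗ J.obj U} {θ : A ≅ J.obj U ⊗ B}
    (hb : W b.hom) (h : W θ.hom) : W (thetaLeft b θ).hom :=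
  hW.comp (hW.whiskerLeft _ h) <| hW.comp (hW.inv _ (hW.associator_middle _ _ _)) <|
    hW.comp (hW.whiskerRight _ (hW.inv _ hb)) (hW.associator_left _ _ _)

lemma thetaUnit (A : E) : W (thetaUnit J A).hom :=
  hW.comp (hW.inv _ (hW.leftUnitor _)) (hW.whiskerRight _ hW.unit)

end IsConstantClass

/-- A scalar multiple of an isomorphism. -/
@[simps]
def smulIso {E : Type*} [Category* E] [Preadditive E] {R : Type*} [CommRing R] [Linear R E]
    {X Y : E} (p : Rˣ) (e : X ≅ Y) : X ≅ Y where
  hom := (p : R) • e.hom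
  inv := ((p⁻¹ : Rˣ) : R) • e.inv
  hom_inv_id := by simp [smul_smul]
  inv_hom_id := by simp [smul_smul]

variable (k : Type w) [Field k] (D : Type*) [Category* D] [Preadditive D] [Linear k D]
  [MonoidalCategory D] (E : Type*) [Category* E] [Preadditive E] [MonoidalCategory E]
  {Q : Type*} [Group Q] [Linear (Q → k) E] (π : Cocycle₄ Q kˣ)

/-- Objects `T q` of a larger monoidal category `E`, indexed by `Q` and multiplicative up to
objects of `D`, together with the autoequivalences `F q` of `D` that are conjugations by them. -/
structure ConjugationSystem where
  J : D ⥤ E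
  [monoidal : J.Monoidal]
  [faithful : J.Faithful]
  /-- The constant morphisms. -/
  W : MorphismProperty E
  isConstantClass : IsConstantClass J W
  T : Q → E
  rightFaithful : ∀ q, RightFaithful (T q)
  -- With `rightFaithful` and faithfulness of `J`, this identifies morphisms of `D` with constant
  -- morphisms of `E` after tensoring with `T q`; all data of the action are lifts along this
  -- identification.
  full : ∀ q {X Y : D} (φ : J.obj X ⊗ T q ⟶ J.obj Y ⊗ T q), W φ → ∃ f, J.map f ▷ T q = φ
  leftLinear : LeftLinear (Q → k) E
  smul_whiskerRight_J : ∀ (p : Q → k) {X Y : E} (f : X ⟶ Y) (V : D),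
    (p • f) ▷ J.obj V = p • (f ▷ J.obj V)
  -- Right tensoring is only semilinear over `Fun(Q, k)`: objects from `D` have trivial image in `Q`
  -- and act linearly, whereas `T q` translates by `q`.
  smul_whiskerRight_T : ∀ (p : Q → k) {X Y : E} (f : X ⟶ Y) (q : Q),
    (p • f) ▷ T q = (fun b => p (q * b)) • (f ▷ T q)
  -- Images of morphisms of `D` are constant, so an equality of families may be read at the base
  -- point `1`, where functions become scalars.
  eval : ∀ (p p' : Q → k) (q) {X Y : D} (f f' : X ⟶ Y),
    p • (J.map f ▷ T q) = p' • (J.map f' ▷ T q) → p 1 • f = p' 1 • f'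
  F : Q → D ⥤ D
  additive : ∀ q, (F q).Additive
  linear : ∀ q, (F q).Linear k
  isEquivalence : ∀ q, (F q).IsEquivalence
  β : ∀ q V, J.obj ((F q).obj V) ⊗ T q ≅ T q ⊗ J.obj V
  β_naturality : ∀ q {V V' : D} (f : V ⟶ V'),
    Square (T q) (β q V).hom (β q V').hom (J.map ((F q).map f)) (J.map f)
  β_constant : ∀ q V, W (β q V).hom
  U : ∀ {q r p : Q}, q * r = p → D
  U_invertible : ∀ {q r p : Q} (h : q * r = p),
    ∃ U' : D, Nonempty (U h ⊗ U' ≅ 𝟙_ D) ∧ Nonempty (U' ⊗ U h ≅ 𝟙_ D)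
  θ : ∀ {q r p : Q} (h : q * r = p), T q ⊗ T r ≅ J.obj (U h) ⊗ T p
  θ_constant : ∀ {q r p : Q} (h : q * r = p), W (θ h).hom
  U₀ : D
  U₀_invertible : ∃ U' : D, Nonempty (U₀ ⊗ U' ≅ 𝟙_ D) ∧ Nonempty (U' ⊗ U₀ ≅ 𝟙_ D)
  θ₀ : 𝟙_ E ≅ J.obj U₀ ⊗ T 1
  θ₀_constant : W θ₀.hom
  -- The associator of three objects `T` depends on `b` exactly through `π(q, r, s, b)`. Its inverse
  -- therefore needs this factor to become constant.
  associator_constant : ∀ q r s : Q,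
    W ((fun b => (π q r s b : k)) • (α_ (T q) (T r) (T s)).inv)

namespace ConjugationSystem

attribute [instance] monoidal faithful

variable {k D E π} (S : ConjugationSystem k D E π)

/-- The isomorphism of `D` underlying a constant isomorphism of `E`. -/
def lift (q : Q) {X Y : D} (φ : S.J.obj X ⊗ S.T q ≅ S.J.obj Y ⊗ S.T q) (h : S.W φ.hom) : X ≅ Y where
  hom := (S.full q φ.hom h).choose
  inv := (S.full q φ.inv (S.isConstantClass.inv _ h)).choose
  hom_inv_id := S.J.map_injective <| S.rightFaithful q _ _ <| by
    rw [S.J.map_comp, comp_whiskerRight, (S.full q φ.hom h).choose_spec,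
      (S.full q φ.inv (S.isConstantClass.inv _ h)).choose_spec]
    simp
  inv_hom_id := S.J.map_injective <| S.rightFaithful q _ _ <| by
    rw [S.J.map_comp, comp_whiskerRight, (S.full q φ.hom h).choose_spec,
      (S.full q φ.inv (S.isConstantClass.inv _ h)).choose_spec]
    simp

lemma map_lift (q : Q) {X Y : D} (φ : S.J.obj X ⊗ S.T q ≅ S.J.obj Y ⊗ S.T q) (h : S.W φ.hom) :
    S.J.map (S.lift q φ h).hom ▷ S.T q = φ.hom :=
  (S.full q φ.hom h).choose_spec

/-- The unit isomorphism of `F q`. -/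
def unitIso (q : Q) : 𝟙_ D ≅ (S.F q).obj (𝟙_ D) :=
  S.lift q (whiskerRightIso (Functor.Monoidal.εIso S.J).symm _ ≪≫ λ_ _ ≪≫ (ρ_ _).symm ≪≫
      whiskerLeftIso _ (Functor.Monoidal.εIso S.J) ≪≫ (S.β q _).symm) <| by
    have hW := S.isConstantClass
    exact hW.comp (hW.whiskerRight _ hW.counit) <| hW.comp (hW.leftUnitor _) <|
      hW.comp (hW.inv _ (hW.rightUnitor _)) <| hW.comp (hW.whiskerLeft _ hW.unit)
        (hW.inv _ (S.β_constant q _))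

/-- The tensorator of `F q`. -/
def tensorIso (q : Q) (V V' : D) : (S.F q).obj V ⊗ (S.F q).obj V' ≅ (S.F q).obj (V ⊗ V') :=
  S.lift q (whiskerRightIso (Functor.Monoidal.μIso S.J _ _).symm _ ≪≫
      braidTensorIso (S.β q V) (S.β q V') ≪≫
      whiskerLeftIso _ (Functor.Monoidal.μIso S.J _ _) ≪≫ (S.β q _).symm) <| by
    have hW := S.isConstantClass
    exact hW.comp (hW.whiskerRight _ (hW.cotensor _ _)) <|
      hW.comp (hW.braidTensor (S.β_constant q _) (S.β_constant q _)) <|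
      hW.comp (hW.whiskerLeft _ (hW.tensor _ _)) (hW.inv _ (S.β_constant q _))

lemma square_unitIso (q : Q) : Square (S.T q) (braidUnit _) (S.β q _).hom
    (ε S.J ≫ S.J.map (S.unitIso q).hom) (ε S.J) := by
  rw [Square, comp_whiskerRight, unitIso, map_lift]
  simp [braidUnit]

lemma square_tensorIso (q : Q) (V V' : D) :
    Square (S.T q) (braidTensor (S.β q V).hom (S.β q V').hom) (S.β q _).hom
      (μ S.J _ _ ≫ S.J.map (S.tensorIso q V V').hom) (μ S.J _ _) := by
  rw [Square, comp_whiskerRight, tensorIso, map_lift]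
  simp

/-- The autoequivalence `F q`. -/
@[simps functor]
def aut (q : Q) : LinMonAut k D where
  functor := S.F q
  monoidal := (coreMonoidalOfConj (S.rightFaithful q) (S.β q) (S.β_naturality q) (S.unitIso q)
    (S.tensorIso q) (S.square_unitIso q) (S.square_tensorIso q)).toMonoidal
  additive := S.additive q
  linear := S.linear q
  isEquivalence := S.isEquivalence q

/-- The half braiding of `T q`. -/
@[simps]
def halfBraiding (q : Q) : HalfBraiding S.J (S.aut q).functor where
  T := S.T q
  β := S.β q
  naturality := S.β_naturality q
  unit := by rw [Functor.LaxMonoidal.comp_ε]; exact S.square_unitIso q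
  tensor V V' := by rw [Functor.LaxMonoidal.comp_μ]; exact S.square_tensorIso q V V'

section pseudonat

variable {F : D ⥤ D} [F.Monoidal] (P : HalfBraiding S.J F) (hP : ∀ V, S.W (P.β V).hom) {q : Q}
  {U : D} (hU : ∃ U' : D, Nonempty (U ⊗ U' ≅ 𝟙_ D) ∧ Nonempty (U' ⊗ U ≅ 𝟙_ D))
  (θ : P.T ≅ S.J.obj U ⊗ S.T q) (hθ : S.W θ.hom)

/-- The half braiding of `U` obtained by comparing those of `P.T` and `T q`. -/
def pseudonatApp (V : D) : F.obj V ⊗ U ≅ U ⊗ (S.F q).obj V :=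
  S.lift q (whiskerRightIso (Functor.Monoidal.μIso S.J _ _).symm _ ≪≫ α_ _ _ _ ≪≫
      whiskerLeftIso _ θ.symm ≪≫ P.β V ≪≫ whiskerRightIso θ _ ≪≫ α_ _ _ _ ≪≫
      whiskerLeftIso _ (S.β q V).symm ≪≫ (α_ _ _ _).symm ≪≫
      whiskerRightIso (Functor.Monoidal.μIso S.J _ _) _) <| by
    have hW := S.isConstantClass
    exact hW.comp (hW.whiskerRight _ (hW.cotensor _ _)) <|
      hW.comp (hW.associator_left _ _ _) <| hW.comp (hW.whiskerLeft _ (hW.inv _ hθ)) <|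
      hW.comp (hP V) <| hW.comp (hW.whiskerRight _ hθ) <| hW.comp (hW.associator_left _ _ _) <|
      hW.comp (hW.whiskerLeft _ (hW.inv _ (S.β_constant q V))) <|
      hW.comp (hW.inv _ (hW.associator_left _ _ _)) (hW.whiskerRight _ (hW.tensor _ _))

/-- `pseudonatApp` is the lift of the solution of this equation for the half braiding of `U`, so the
equation holds after substituting `map_lift`. -/
lemma compat_pseudonatApp (V : D) :
    S.J.obj (F.obj V) ◁ θ.hom ≫ braidComp (imageHom S.J (S.pseudonatApp P hP θ hθ V).hom)
      (S.β q V).hom = (P.β V).hom ≫ θ.hom ▷ S.J.obj V := by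
  have h : imageHom S.J (S.pseudonatApp P hP θ hθ V).hom ▷ S.T q =
      (α_ _ _ _).hom ≫ S.J.obj (F.obj V) ◁ θ.inv ≫ (P.β V).hom ≫ θ.hom ▷ S.J.obj V ≫
        (α_ _ _ _).hom ≫ S.J.obj U ◁ (S.β q V).inv ≫ (α_ _ _ _).inv := by
    rw [imageHom, comp_whiskerRight, comp_whiskerRight, pseudonatApp, map_lift]
    simp
  rw [braidComp, h]
  simp

/-- The pseudonatural isomorphism `F ⇒ F q` obtained by comparing half braidings. -/
def pseudonat : PseudonatIso F (S.aut q).functor :=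
  PseudonatIso.ofHalfBraidings P (S.halfBraiding q) (S.rightFaithful q) hU θ
    (S.pseudonatApp P hP θ hθ) (S.compat_pseudonatApp P hP θ hθ)

lemma compat_pseudonat : Compat P (S.halfBraiding q) (S.pseudonat P hP hU θ hθ) θ :=
  S.compat_pseudonatApp P hP θ hθ

end pseudonat

lemma comp_constant {F K : D ⥤ D} [F.Monoidal] [K.Monoidal] {P : HalfBraiding S.J F}
    {P' : HalfBraiding S.J K} (hP : ∀ V, S.W (P.β V).hom) (hP' : ∀ V, S.W (P'.β V).hom) (V : D) :
    S.W ((HalfBraiding.comp P P').β V).hom :=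
  S.isConstantClass.braidComp (hP _) (hP' _)

/-- The half braiding of `T q ⊗ T r`. -/
abbrev halfBraiding₂ (q r : Q) : HalfBraiding S.J ((S.aut r).functor ⋙ (S.aut q).functor) :=
  HalfBraiding.comp (S.halfBraiding q) (S.halfBraiding r)

/-- The pseudonatural isomorphism `χ_{q,r}`. -/
def χ {q r p : Q} (h : q * r = p) :
    PseudonatIso ((S.aut r).functor ⋙ (S.aut q).functor) (S.aut p).functor :=
  S.pseudonat (S.halfBraiding₂ q r) (S.comp_constant (S.β_constant q) (S.β_constant r))
    (S.U_invertible h) (S.θ h) (S.θ_constant h)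

lemma compat_χ {q r p : Q} (h : q * r = p) :
    Compat (S.halfBraiding₂ q r) (S.halfBraiding p) (S.χ h) (S.θ h) :=
  S.compat_pseudonat _ _ _ _ _

/-- The pseudonatural isomorphism `ι`. -/
def ι : PseudonatIso (𝟭 D) (S.aut 1).functor :=
  S.pseudonat (HalfBraiding.identity S.J) (fun V => by
      have hW := S.isConstantClass
      exact hW.comp (hW.rightUnitor _) (hW.inv _ (hW.leftUnitor _)))
    S.U₀_invertible S.θ₀ S.θ₀_constant

lemma compat_ι : Compat (HalfBraiding.identity S.J) (S.halfBraiding 1) S.ι S.θ₀ :=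
  S.compat_pseudonat _ _ _ _ _

/-- A function on `Q` passes through left tensoring and through right tensoring with objects of `D`.
Rescaling by `π(q, r, s, ·)` therefore preserves compatibility with half braidings, so the lifts are
modifications. -/
lemma compat_smul {p : Q → k} {X A B : E} {V : D} {θ θ' : A ⟶ B} (e : θ' = p • θ)
    {a : X ⊗ A ⟶ A ⊗ S.J.obj V} {b : X ⊗ B ⟶ B ⊗ S.J.obj V}
    (h : X ◁ θ ≫ b = a ≫ θ ▷ S.J.obj V) :
    X ◁ θ' ≫ b = a ≫ θ' ▷ S.J.obj V := by
  rw [e, S.leftLinear, S.smul_whiskerRight_J, Linear.smul_comp, Linear.comp_smul, h]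

section modification

variable {A : E} {U V : D} {q : Q} {θσ : A ≅ S.J.obj U ⊗ S.T q} {θτ : A ≅ S.J.obj V ⊗ S.T q}
  (p : (Q → k)ˣ) (h : S.W θσ.hom) (h' : S.W ((p : Q → k) • θτ.hom))

/-- The isomorphism underlying a modification between pseudonatural isomorphisms compatible with
half braidings. -/
def modificationIso : U ≅ V :=
  S.lift q (θσ.symm ≪≫ smulIso p θτ) (S.isConstantClass.comp (S.isConstantClass.inv _ h) h')

lemma over_modificationIso :
    Over θσ θτ (S.modificationIso p h h').hom (p : Q → k) := by
  rw [Over, modificationIso, map_lift]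
  simp

/-- The modification between two pseudonatural isomorphisms compatible with half braidings. -/
def modification {F : D ⥤ D} [F.Monoidal] {P : HalfBraiding S.J F} (p : (Q → k)ˣ)
    (σ τ : PseudonatIso F (S.aut q).functor) {θσ : P.T ≅ S.J.obj σ.U ⊗ S.T q}
    {θτ : P.T ≅ S.J.obj τ.U ⊗ S.T q} (hσ : Compat P (S.halfBraiding q) σ θσ)
    (hτ : Compat P (S.halfBraiding q) τ θτ) (Γ : σ.U ≅ τ.U)
    (hΓ : Over θσ θτ Γ.hom (p : Q → k)) : Modification σ τ :=
  Modification.ofCompat (S.rightFaithful q) hσ Γ fun V =>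
    S.compat_smul hΓ (hτ V)

end modification

/-! ### The modifications `Ω`, `γ`, `δ` -/

section Omega

variable {q r s qr rs p : Q} (hqr : q * r = qr) (hrs : r * s = rs) (h : q * rs = p)
  (h' : qr * s = p)

/-- The comparison isomorphism of `χ_{q,rs} ∘ (1 ⊗ χ_{r,s})`. -/
abbrev θLeft : S.T q ⊗ (S.T r ⊗ S.T s) ≅
    S.J.obj ((S.aut q).functor.obj (S.U hrs) ⊗ S.U h) ⊗ S.T p :=
  thetaComp (thetaLeft ((S.halfBraiding q).braid (S.U hrs)) (S.θ hrs)) (S.θ h)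

/-- The comparison isomorphism of `χ_{qr,s} ∘ (χ_{q,r} ⊗ 1)`. -/
abbrev θRight : (S.T q ⊗ S.T r) ⊗ S.T s ≅ S.J.obj (S.U hqr ⊗ S.U h') ⊗ S.T p :=
  thetaComp (thetaRight (S.θ hqr) (S.T s)) (S.θ h')

/-- The values of `π` as scalars. -/
@[simps]
def scalar (π : Cocycle₄ Q kˣ) (q r s : Q) : (Q → k)ˣ where
  val b := π q r s b
  inv b := ((π q r s b)⁻¹ : kˣ)
  val_inv := by ext; simp
  inv_val := by ext; simp

lemma θLeft_constant : S.W (S.θLeft hrs h).hom :=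
  S.isConstantClass.thetaComp (S.isConstantClass.thetaLeft (S.β_constant q _) (S.θ_constant hrs))
    (S.θ_constant h)

lemma θRight_constant : S.W (S.θRight hqr h').hom :=
  S.isConstantClass.thetaComp (S.isConstantClass.thetaRight (S.θ_constant hqr) _) (S.θ_constant h')

/-- The scalar and the inverse associator are constant only together; this is what makes the lift
`Ω` exist. -/
lemma smul_θRight_constant :
    S.W (((scalar π q r s : (Q → k)ˣ) : Q → k) • ((α_ _ _ _).symm ≪≫ S.θRight hqr h').hom) := by
  rw [Iso.trans_hom, ← Linear.smul_comp]
  exact S.isConstantClass.comp (S.associator_constant q r s) (S.θRight_constant hqr h')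

/-- The modification `Ω_{q,r,s}`. -/
def Ω : Modification (((S.χ hrs).whiskerLeft (S.aut q).functor).comp (S.χ h))
      (((S.χ hqr).whiskerRight (S.aut s).functor).comp (S.χ h')).reassoc :=
  S.modification (scalar π q r s) _ _
    (((S.compat_χ hrs).whiskerLeft (S.halfBraiding q)).comp (S.compat_χ h))
    (Compat.reassoc (((S.compat_χ hqr).whiskerRight (S.halfBraiding s)).comp (S.compat_χ h')))
    (S.modificationIso (scalar π q r s) (S.θLeft_constant hrs h) (S.smul_θRight_constant hqr h'))
    (S.over_modificationIso _ _ _)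

/-- `Ω` covers the inverse associator of `E` with scalar `π(q, r, s, ·)`. The pentagon and the
triangle use nothing else about it. -/
lemma over_Ω : Over (S.θLeft hrs h) ((α_ _ _ _).symm ≪≫ S.θRight hqr h')
    (S.Ω hqr hrs h h').Γ.hom (fun b => (π q r s b : k)) :=
  S.over_modificationIso (scalar π q r s) (S.θLeft_constant hrs h) (S.smul_θRight_constant hqr h')

end Omega

/-- The comparison isomorphism of `χ_{1,q} ∘ (ι ⊗ 1)`. -/
abbrev θγ (q : Q) : 𝟙_ E ⊗ S.T q ≅ S.J.obj (S.U₀ ⊗ S.U (one_mul q)) ⊗ S.T q :=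
  thetaComp (thetaRight S.θ₀ (S.T q)) (S.θ (one_mul q))

/-- The comparison isomorphism of `χ_{q,1} ∘ (1 ⊗ ι)`. -/
abbrev θδ (q : Q) :
    S.T q ⊗ 𝟙_ E ≅ S.J.obj ((S.aut q).functor.obj S.U₀ ⊗ S.U (mul_one q)) ⊗ S.T q :=
  thetaComp (thetaLeft ((S.halfBraiding q).braid S.U₀) S.θ₀) (S.θ (mul_one q))

lemma θγ_constant (q : Q) : S.W (S.θγ q).hom :=
  S.isConstantClass.thetaComp (S.isConstantClass.thetaRight S.θ₀_constant _) (S.θ_constant _)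

lemma θδ_constant (q : Q) : S.W (S.θδ q).hom :=
  S.isConstantClass.thetaComp (S.isConstantClass.thetaLeft (S.β_constant q _) S.θ₀_constant)
    (S.θ_constant _)

lemma thetaUnit_constant {X A : E} (φ : X ≅ A) (h : S.W φ.hom) :
    S.W (((1 : (Q → k)ˣ) : Q → k) • (φ ≪≫ thetaUnit S.J A).hom) := by
  rw [Units.val_one, one_smul]
  exact S.isConstantClass.comp h (S.isConstantClass.thetaUnit A)

/-- The modification `γ_q`. -/
def γ (q : Q) : Modification ((S.ι.whiskerRight (S.aut q).functor).comp (S.χ (one_mul q)))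
    (PseudonatIso.ofNatIso (S.aut q).functor.rightUnitor) :=
  S.modification 1 _ _ ((S.compat_ι.whiskerRight (S.halfBraiding q)).comp (S.compat_χ (one_mul q)))
    (Compat.ofNatIso (P := HalfBraiding.comp (HalfBraiding.identity S.J) (S.halfBraiding q))
      (P' := S.halfBraiding q) (S.aut q).functor.rightUnitor (λ_ (S.T q)) fun V =>
      leftUnitor_braidComp (S.J.map_id _) (S.β q V).hom)
    (S.modificationIso 1 (S.θγ_constant q)
      (S.thetaUnit_constant (λ_ (S.T q)) (S.isConstantClass.leftUnitor _)))
    (S.over_modificationIso _ _ _)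

lemma over_γ (q : Q) :
    Over (S.θγ q) (λ_ (S.T q) ≪≫ thetaUnit S.J (S.T q)) (S.γ q).Γ.hom (1 : Q → k) :=
  S.over_modificationIso 1 (S.θγ_constant q)
    (S.thetaUnit_constant _ (S.isConstantClass.leftUnitor _))

/-- The modification `δ_q`. -/
def δ (q : Q) : Modification ((S.ι.whiskerLeft (S.aut q).functor).comp (S.χ (mul_one q)))
    (PseudonatIso.ofNatIso (S.aut q).functor.leftUnitor) :=
  S.modification 1 _ _ ((S.compat_ι.whiskerLeft (S.halfBraiding q)).comp (S.compat_χ (mul_one q)))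
    (Compat.ofNatIso (P := HalfBraiding.comp (S.halfBraiding q) (HalfBraiding.identity S.J))
      (P' := S.halfBraiding q) (S.aut q).functor.leftUnitor (ρ_ (S.T q)) fun V =>
      rightUnitor_braidComp (S.J.map_id _) (S.β q V).hom)
    (S.modificationIso 1 (S.θδ_constant q)
      (S.thetaUnit_constant (ρ_ (S.T q)) (S.isConstantClass.rightUnitor _)))
    (S.over_modificationIso _ _ _)

lemma over_δ (q : Q) :
    Over (S.θδ q) (ρ_ (S.T q) ≪≫ thetaUnit S.J (S.T q)) (S.δ q).Γ.hom (1 : Q → k) :=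
  S.over_modificationIso 1 (S.θδ_constant q)
    (S.thetaUnit_constant _ (S.isConstantClass.rightUnitor _))

end ConjugationSystem

end ConjugationSystem

/-! ### The anomalous pentagon and the triangle for a conjugation system. -/

namespace ConjugationSystem

open Functor.LaxMonoidal (μ ε)

variable {k : Type w} [Field k] {D : Type*} [Category* D] [Preadditive D] [Linear k D]
  [MonoidalCategory D] {E : Type*} [Category* E] [Preadditive E] [MonoidalCategory E]
  {Q : Type*} [Group Q] [Linear (Q → k) E] {π : Cocycle₄ Q kˣ} (S : ConjugationSystem k D E π)

/-- Cross-multiplying the two relations by `p'` and `p` gives an equality of families, which is then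
evaluated at `1`. -/
lemma eq_of_over {A : E} {U V : D} {q : Q} {θ : A ≅ S.J.obj U ⊗ S.T q} {θ' : A ≅ S.J.obj V ⊗ S.T q}
    {Γ Γ' : U ⟶ V} {p p' : Q → k} (h : Over θ θ' Γ p) (h' : Over θ θ' Γ' p') :
    p' 1 • Γ = p 1 • Γ' := by
  refine S.eval p' p q _ _ ?_
  rw [← cancel_epi θ.hom, Linear.comp_smul, Linear.comp_smul, h, h', smul_smul, smul_smul,
    mul_comm]

section pentagon

variable {q r s t qr rs st qrs rst p : Q} (hqr : q * r = qr) (hrs : r * s = rs)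
    (hst : s * t = st) (h_qr_s : qr * s = qrs) (h_q_rs : q * rs = qrs) (h_rs_t : rs * t = rst)
    (h_r_st : r * st = rst) (h_qrs_t : qrs * t = p) (h_q_rst : q * rst = p)
    (h_qr_st : qr * st = p)

/-- The common source of the two sides of the pentagon. -/
abbrev pentagonSource :=
  thetaComp (thetaLeft ((S.halfBraiding q).braid _)
    (thetaLeft ((S.halfBraiding r).braid _) (S.θ hst)))
    (thetaComp (thetaLeft ((S.halfBraiding q).braid _) (S.θ h_r_st)) (S.θ h_q_rst))

/-- The common target of the two sides of the pentagon, up to associativity. -/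
abbrev pentagonTarget :=
  thetaComp (thetaRight (S.θRight hqr h_qr_s) (S.T t)) (S.θ h_qrs_t)

/-- Each of the eight factors covers a known morphism of `E`. Structural factors have scalar `1`,
and the three `Ω` cover the three inverse associators on the long side of the pentagon of the
objects `T`. -/
lemma over_three : Over (S.pentagonSource hst h_r_st h_q_rst)
    (whiskerLeftIso (S.T q) (α_ (S.T r) (S.T s) (S.T t)).symm ≪≫ (α_ _ _ _).symm ≪≫
      whiskerRightIso (α_ _ _ _).symm _ ≪≫ S.pentagonTarget hqr h_qr_s h_qrs_t)
    ((α_ ((S.aut q).functor.obj ((S.aut r).functor.obj (S.χ hst).U))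
          ((S.aut q).functor.obj (S.χ h_r_st).U) (S.χ h_q_rst).U).inv ≫
      μ (S.aut q).functor _ _ ▷ (S.χ h_q_rst).U ≫
      (S.aut q).functor.map (S.Ω hrs hst h_r_st h_rs_t).Γ.hom ▷ (S.χ h_q_rst).U ≫
      Functor.OplaxMonoidal.δ (S.aut q).functor (S.χ hrs).U (S.χ h_rs_t).U ▷ (S.χ h_q_rst).U ≫
      (α_ _ _ _).hom ≫
      (S.aut q).functor.obj (S.χ hrs).U ◁ (S.Ω h_q_rs h_rs_t h_q_rst h_qrs_t).Γ.hom ≫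
      (α_ ((S.aut q).functor.obj (S.χ hrs).U) (S.χ h_q_rs).U (S.χ h_qrs_t).U).inv ≫
      (S.Ω hqr hrs h_q_rs h_qr_s).Γ.hom ▷ (S.χ h_qrs_t).U)
    (fun b => (π r s t b * π q rs t b * π q r s (t * b) : k)) := by
  have h₁ := (Over.associator (R := Q → k) (thetaLeft ((S.halfBraiding q).braid _)
    (thetaLeft ((S.halfBraiding r).braid _) (S.θ hst)))
    (thetaLeft ((S.halfBraiding q).braid _) (S.θ h_r_st)) (S.θ h_q_rst)).inv
  have h₂ := (Over.μ_thetaLeft (R := Q → k) (S.halfBraiding q)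
    (thetaLeft ((S.halfBraiding r).braid _) (S.θ hst)) (S.θ h_r_st)).whiskerRight (S.θ h_q_rst)
  have h₃ := ((S.over_Ω hrs hst h_r_st h_rs_t).thetaLeft S.leftLinear
    ((S.halfBraiding q).naturality _)).whiskerRight (S.θ h_q_rst)
  have h₄ := (((Over.μ_thetaLeft (R := Q → k) (S.halfBraiding q) (thetaRight (S.θ hrs) (S.T t))
    (S.θ h_rs_t)).inv (Γ := Functor.Monoidal.μIso (S.aut q).functor _ _)).whiskerRight
    (S.θ h_q_rst)).trans (whiskerLeftIso (S.T q) (α_ (S.T r) (S.T s) (S.T t)).symm)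
  have h₅ := (Over.associator (R := Q → k)
    (thetaLeft ((S.halfBraiding q).braid _) (thetaRight (S.θ hrs) (S.T t)))
    (thetaLeft ((S.halfBraiding q).braid _) (S.θ h_rs_t)) (S.θ h_q_rst)).trans
      (whiskerLeftIso (S.T q) (α_ (S.T r) (S.T s) (S.T t)).symm)
  have h₆ := ((S.over_Ω h_q_rs h_rs_t h_q_rst h_qrs_t).whiskerLeft S.leftLinear
    (thetaLeft ((S.halfBraiding q).braid _) (thetaRight (S.θ hrs) (S.T t)))).trans
      (whiskerLeftIso (S.T q) (α_ (S.T r) (S.T s) (S.T t)).symm)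
  have h₇ := (((Over.associator (R := Q → k)
    (thetaRight (thetaLeft ((S.halfBraiding q).braid _) (S.θ hrs)) (S.T t))
    (thetaRight (S.θ h_q_rs) (S.T t)) (S.θ h_qrs_t)).inv).trans (α_ _ _ _).symm).trans
      (whiskerLeftIso (S.T q) (α_ (S.T r) (S.T s) (S.T t)).symm)
  -- Tensoring `Ω_{q,r,s}` on the right with `T t` replaces `π(q, r, s, b)` by `π(q, r, s, tb)`.
  have h₈ := ((((S.over_Ω hqr hrs h_q_rs h_qr_s).thetaRight
    (fun f => S.smul_whiskerRight_T _ f t)).whiskerRight (S.θ h_qrs_t)).trans (α_ _ _ _).symm).trans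
      (whiskerLeftIso (S.T q) (α_ (S.T r) (S.T s) (S.T t)).symm)
  have e₃ := (congrArg (thetaComp · (S.θ h_q_rst)) (thetaLeft_trans ((S.halfBraiding q).braid _)
    (α_ (S.T r) (S.T s) (S.T t)).symm (S.θRight hrs h_rs_t))).trans
    (thetaComp_trans _ _ (S.θ h_q_rst))
  have e₆ := congrArg (whiskerLeftIso (S.T q) (α_ (S.T r) (S.T s) (S.T t)).symm ≪≫ ·)
    (thetaComp_thetaLeft_thetaRight ((S.halfBraiding q).braid _) (S.θ hrs)
    (S.θRight h_q_rs h_qrs_t))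
  have e₇ := congrArg (fun z => whiskerLeftIso (S.T q) (α_ (S.T r) (S.T s) (S.T t)).symm ≪≫
    (α_ _ _ _).symm ≪≫ thetaComp z (S.θ h_qrs_t)) (thetaRight_thetaComp
      (thetaLeft ((S.halfBraiding q).braid _) (S.θ hrs)) (S.θ h_q_rs) (S.T t)).symm
  have e₈ := congrArg (fun z => whiskerLeftIso (S.T q) (α_ (S.T r) (S.T s) (S.T t)).symm ≪≫
    (α_ _ _ _).symm ≪≫ z) ((congrArg (thetaComp · (S.θ h_qrs_t)) (thetaRight_trans (α_ _ _ _).symm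
      (S.θRight hqr h_qr_s) (S.T t))).trans (thetaComp_trans _ _ (S.θ h_qrs_t)))
  have h := h₁.comp (h₂.comp ((h₃.congr e₃).comp (h₄.comp (h₅.comp
    ((h₆.congr e₆).comp ((h₇.congr e₇).comp (h₈.congr e₈)))))))
  exact h.congr_scalar (by ext b; simp [mul_assoc])

lemma over_two : Over (S.pentagonSource hst h_r_st h_q_rst)
    (whiskerLeftIso (S.T q) (α_ (S.T r) (S.T s) (S.T t)).symm ≪≫ (α_ _ _ _).symm ≪≫
      whiskerRightIso (α_ _ _ _).symm _ ≪≫ S.pentagonTarget hqr h_qr_s h_qrs_t)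
    ((S.aut q).functor.obj ((S.aut r).functor.obj (S.χ hst).U) ◁
        (S.Ω hqr h_r_st h_q_rst h_qr_st).Γ.hom ≫
      (α_ ((S.aut q).functor.obj ((S.aut r).functor.obj (S.χ hst).U)) (S.χ hqr).U
        (S.χ h_qr_st).U).inv ≫
      ((S.χ hqr).χ (S.χ hst).U).hom ▷ (S.χ h_qr_st).U ≫
      (α_ _ _ _).hom ≫
      (S.χ hqr).U ◁ (S.Ω h_qr_s hst h_qr_st h_qrs_t).Γ.hom ≫
      (α_ (S.χ hqr).U (S.χ h_qr_s).U (S.χ h_qrs_t).U).inv)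
    (fun b => (π q r st b * π qr s t b : k)) := by
  have h₁ := (S.over_Ω hqr h_r_st h_q_rst h_qr_st).whiskerLeft S.leftLinear
    (thetaLeft ((S.halfBraiding q).braid _) (thetaLeft ((S.halfBraiding r).braid _) (S.θ hst)))
  have e₁ := thetaComp_thetaLeft_thetaLeft ((S.halfBraiding q).braid _)
    ((S.halfBraiding r).braid _) (S.θ hst) (S.θRight hqr h_qr_st)
  have h₂ := ((Over.associator (R := Q → k)
    (thetaLeft ((S.halfBraiding₂ q r).braid _) (S.θ hst))
    (thetaRight (S.θ hqr) (S.T st)) (S.θ h_qr_st)).inv).trans (α_ _ _ _).symm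
  -- The half braiding of `χ_{q,r}` in the composite of two `Ω` is the interchanger of `χ_{q,r}` and
  -- `χ_{s,t}`.
  have h₃ := ((Over.exchange (R := Q → k) (S.compat_χ hqr) (S.θ hst)).whiskerRight
    (S.θ h_qr_st)).trans (α_ _ _ _).symm
  have h₄ := (Over.associator (R := Q → k) (thetaRight (S.θ hqr) (S.T s ⊗ S.T t))
    (thetaLeft ((S.halfBraiding qr).braid _) (S.θ hst)) (S.θ h_qr_st)).trans (α_ _ _ _).symm
  have h₅ := ((S.over_Ω h_qr_s hst h_qr_st h_qrs_t).whiskerLeft S.leftLinear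
    (thetaRight (S.θ hqr) (S.T s ⊗ S.T t))).trans (α_ _ _ _).symm
  have e₅ := congrArg ((α_ _ _ _).symm ≪≫ ·)
    (thetaComp_thetaRight_assoc (S.θ hqr) (S.θRight h_qr_s h_qrs_t))
  have h₆ := ((((Over.associator (R := Q → k)
    (thetaRight (thetaRight (S.θ hqr) (S.T s)) (S.T t))
    (thetaRight (S.θ h_qr_s) (S.T t)) (S.θ h_qrs_t)).inv).trans (α_ _ _ _).symm).trans
      (α_ _ _ _).symm)
  have e₆ := congrArg (fun z => (α_ _ _ _).symm ≪≫ (α_ _ _ _).symm ≪≫ thetaComp z (S.θ h_qrs_t))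
    (thetaRight_thetaComp (thetaRight (S.θ hqr) (S.T s)) (S.θ h_qr_s) (S.T t)).symm
  have h := (h₁.congr e₁).comp (h₂.comp (h₃.comp (h₄.comp ((h₅.congr e₅).comp (h₆.congr e₆)))))
  refine (h.congr ?_).congr_scalar (by ext b; simp)
  ext
  -- The pentagon of `E` replaces the two inverse associators by three, so that the target agrees
  -- with that of `over_three`.
  exact (MonoidalCategory.pentagon_inv_assoc _).symm

end pentagon

section triangle

variable {q r p : Q} (h : q * r = p)

/-- The common source of the two sides of the triangle. -/
abbrev triangleSource :=
  thetaComp (thetaLeft ((S.halfBraiding q).braid _) (thetaRight S.θ₀ (S.T r)))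
    (thetaComp (thetaLeft ((S.halfBraiding q).braid _) (S.θ (one_mul r))) (S.θ h))

lemma over_Ω_δ : Over (S.triangleSource h) (whiskerLeftIso _ (λ_ _) ≪≫ S.θ h)
    ((S.aut q).functor.obj S.ι.U ◁ (S.Ω (mul_one q) (one_mul r) h h).Γ.hom ≫
      (α_ ((S.aut q).functor.obj S.ι.U) (S.χ (mul_one q)).U (S.χ h).U).inv ≫
      (S.δ q).Γ.hom ▷ (S.χ h).U ≫ (λ_ (S.χ h).U).hom) (1 : Q → k) := by
  have h₁ := (S.over_Ω (mul_one q) (one_mul r) h h).whiskerLeft S.leftLinear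
    (thetaLeft ((S.halfBraiding q).braid _) (thetaRight S.θ₀ (S.T r)))
  have e₁ := thetaComp_thetaLeft_thetaRight ((S.halfBraiding q).braid _) S.θ₀
    (S.θRight (mul_one q) h)
  have h₂ := ((Over.associator (R := Q → k)
    (thetaRight (thetaLeft ((S.halfBraiding q).braid _) S.θ₀) (S.T r))
    (thetaRight (S.θ (mul_one q)) (S.T r)) (S.θ h)).inv).trans (α_ _ _ _).symm
  have e₂ := congrArg (fun z => (α_ _ _ _).symm ≪≫ thetaComp z (S.θ h))
    (thetaRight_thetaComp (thetaLeft ((S.halfBraiding q).braid _) S.θ₀) (S.θ (mul_one q))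
      (S.T r)).symm
  have h₃ := (((S.over_δ q).thetaRight
    (fun f => S.smul_whiskerRight_T _ f r)).whiskerRight (S.θ h)).trans (α_ _ _ _).symm
  have e₃ := congrArg ((α_ _ _ _).symm ≪≫ ·) ((congrArg (thetaComp · (S.θ h))
    ((thetaRight_trans (ρ_ (S.T q)) (thetaUnit S.J (S.T q)) (S.T r)).trans
      (congrArg (whiskerRightIso (ρ_ (S.T q)) (S.T r) ≪≫ ·)
        (thetaRight_thetaUnit (S.T q) (S.T r))))).trans (thetaComp_trans _ _ (S.θ h)))
  have h₄ := ((Over.leftUnitor (R := Q → k) (S.θ h)).trans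
    (whiskerRightIso (ρ_ (S.T q)) (S.T r))).trans (α_ _ _ _).symm
  have h₅ := (h₁.congr e₁).comp ((h₂.congr e₂).comp ((h₃.congr e₃).comp h₄))
  refine (h₅.congr ?_).congr_scalar ?_
  · ext
    -- The triangle of `E` for `T q` and `T r`; the scalar of `Ω_{q,1,r}` is `1` because `π` is
    -- normalized.
    exact MonoidalCategory.triangle_assoc_comp_right_assoc (S.T q) (S.T r) _
  · ext b
    simp [π.normalized q 1 r b (by simp)]

lemma over_γ_map : Over (S.triangleSource h) (whiskerLeftIso _ (λ_ _) ≪≫ S.θ h)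
    ((α_ ((S.aut q).functor.obj S.ι.U) ((S.aut q).functor.obj (S.χ (one_mul r)).U) (S.χ h).U).inv ≫
      μ (S.aut q).functor _ _ ▷ (S.χ h).U ≫
      (S.aut q).functor.map (S.γ r).Γ.hom ▷ (S.χ h).U ≫
      Functor.OplaxMonoidal.η (S.aut q).functor ▷ (S.χ h).U ≫ (λ_ (S.χ h).U).hom) (1 : Q → k) := by
  have h₁ := (Over.associator (R := Q → k)
    (thetaLeft ((S.halfBraiding q).braid _) (thetaRight S.θ₀ (S.T r)))
    (thetaLeft ((S.halfBraiding q).braid _) (S.θ (one_mul r))) (S.θ h)).inv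
  have h₂ := (Over.μ_thetaLeft (R := Q → k) (S.halfBraiding q) (thetaRight S.θ₀ (S.T r))
    (S.θ (one_mul r))).whiskerRight (S.θ h)
  have h₃ := ((S.over_γ r).thetaLeft S.leftLinear
    ((S.halfBraiding q).naturality _)).whiskerRight (S.θ h)
  have e₃ := (congrArg (thetaComp · (S.θ h)) (thetaLeft_trans ((S.halfBraiding q).braid _)
    (λ_ (S.T r)) (thetaUnit S.J (S.T r)))).trans (thetaComp_trans _ _ (S.θ h))
  have h₄ := ((Over.η_thetaLeft (R := Q → k) (S.halfBraiding q) (S.T r)).whiskerRight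
    (S.θ h)).trans (whiskerLeftIso (S.T q) (λ_ (S.T r)))
  have h₅ := (Over.leftUnitor (R := Q → k) (S.θ h)).trans (whiskerLeftIso (S.T q) (λ_ (S.T r)))
  have h₆ := h₁.comp (h₂.comp ((h₃.congr e₃).comp (h₄.comp h₅)))
  exact h₆.congr_scalar (by simp)

end triangle

/-- The anomalous action given by a conjugation system. -/
def action : AnomalousAction k D π where
  F := S.aut
  χ := S.χ
  ι := S.ι
  Ω := S.Ω
  γ := S.γ
  δ := S.δ
  pentagon {q r s t qr rs st qrs rst p} hqr hrs hst h_qr_s h_q_rs h_rs_t h_r_st h_qrs_t h_q_rst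
      h_qr_st := by
    have h := S.eq_of_over
      (S.over_three hqr hrs hst h_qr_s h_q_rs h_rs_t h_r_st h_qrs_t h_q_rst)
      (S.over_two hqr hst h_qr_s h_r_st h_qrs_t h_q_rst h_qr_st)
    -- At `b = 1` every value of `π` whose last argument is `b` becomes `1`; only `π(q, r, s, t ·
    -- 1)` survives.
    simp only [π.normalized _ _ _ 1 (by simp), mul_one, Units.val_one, one_mul, one_smul] at h
    exact h
  triangle h := by
    have h := S.eq_of_over (S.over_Ω_δ h) (S.over_γ_map h)
    simp only [Pi.one_apply, one_smul] at h
    exact h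

end ConjugationSystem

/-! ### Functors between categories of formal direct sums -/

section MatFunctor

open Functor.LaxMonoidal (μ ε)

variable {M : Type*} [Category* M] [Preadditive M] {M' : Type*} [Category* M'] [Preadditive M']
  (F : M ⥤ M') [F.Additive]

/-- The extension of an additive functor to formal direct sums. -/
def matFunctor : Mat_ M ⥤ Mat_ M' where
  obj X := ⟨X.ι, fun i => F.obj (X.X i)⟩
  map f := matOf fun i j => F.map (entry f i j)
  map_id X := by
    refine mat_ext fun i j => ?_
    by_cases h : i = j
    · subst h
      exact (congrArg F.map (entry_id X i)).trans
        ((F.map_id _).trans (entry_id (⟨X.ι, fun i => F.obj (X.X i)⟩ : Mat_ M') i).symm)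
    · exact (congrArg F.map (entry_id_of_ne X h)).trans
        ((F.map_zero _ _).trans
          (entry_id_of_ne (⟨X.ι, fun i => F.obj (X.X i)⟩ : Mat_ M') h).symm)
  map_comp f g := by
    refine mat_ext fun i j => ?_
    simp only [entry_comp, entry_matOf, F.map_sum, F.map_comp]

lemma matFunctor_map_matIso {X Y : Mat_ M} (e : X.ι ≃ Y.ι) (φ : ∀ i, X.X i ≅ Y.X (e i)) :
    (matFunctor F).map (matIso e φ).hom =
      (matIso (M := (matFunctor F).obj X) (N := (matFunctor F).obj Y) e
        fun i => F.mapIso (φ i)).hom := by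
  exact eq_matIso_hom (M := (matFunctor F).obj X) (N := (matFunctor F).obj Y) e _
    (fun i => congrArg F.map (entry_matIso_hom e φ i))
    (fun i j h => (congrArg F.map (entry_matIso_hom_of_ne e φ i j h)).trans (F.map_zero _ _))

lemma entry_id_matFunctor (X : Mat_ M) (i j : X.ι) :
    entry (𝟙 ((matFunctor F).obj X)) i j = F.map (entry (𝟙 X) i j) := by
  rw [← (matFunctor F).map_id X]
  rfl

instance : (matFunctor F).Additive where
  map_add := mat_ext fun _ _ => F.map_add

instance {k : Type*} [Field k] [Linear k M] [Linear k M'] [F.Linear k] :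
    (matFunctor F).Linear k where
  map_smul _ _ := mat_ext fun _ _ => F.map_smul _ _

instance [F.Faithful] : (matFunctor F).Faithful where
  map_injective h := mat_ext fun i j => F.map_injective (congrFun (congrFun h i) j)

instance [F.Full] : (matFunctor F).Full where
  map_surjective f := ⟨matOf fun i j => F.preimage (entry f i j),
    mat_ext fun _ _ => F.map_preimage _⟩

instance [F.EssSurj] : (matFunctor F).EssSurj where
  mem_essImage Y := ⟨⟨Y.ι, fun i => F.objPreimage (Y.X i)⟩,
    ⟨matIso (Equiv.refl Y.ι) fun i => F.objObjPreimageIso (Y.X i)⟩⟩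

instance [F.IsEquivalence] : (matFunctor F).IsEquivalence where

variable [MonoidalCategory M] [MonoidalPreadditive M] [MonoidalCategory M'] [MonoidalPreadditive M']
  [F.Monoidal]

/-- The tensorator of `matFunctor F`. -/
def matFunctorμIso (X Y : Mat_ M) :
    (matFunctor F).obj X ⊗ (matFunctor F).obj Y ≅ (matFunctor F).obj (X ⊗ Y) :=
  matIso (M := (matFunctor F).obj X ⊗ (matFunctor F).obj Y) (N := (matFunctor F).obj (X ⊗ Y))
    (Equiv.refl _) fun p => Functor.Monoidal.μIso F (X.X p.1) (Y.X p.2)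

/-- The unit of `matFunctor F`. -/
def matFunctorεIso : 𝟙_ (Mat_ M') ≅ (matFunctor F).obj (𝟙_ (Mat_ M)) :=
  matIso (M := 𝟙_ (Mat_ M')) (N := (matFunctor F).obj (𝟙_ (Mat_ M))) (Equiv.refl _)
    fun _ => Functor.Monoidal.εIso F

/-- Once whiskerings of `matIso` are again of this form, a coherence identity for direct sums
reduces, through `matIso_trans` and `matIso_hom_congr`, to the same identity on entries. -/
lemma matIso_whiskerRight {X Y : Mat_ M} (e : X.ι ≃ Y.ι) (φ : ∀ i, X.X i ≅ Y.X (e i))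
    (Z : Mat_ M) : (matIso e φ).hom ▷ Z =
      (matIso (M := X ⊗ Z) (N := Y ⊗ Z) (Equiv.prodCongr e (Equiv.refl _))
        fun p => whiskerRightIso (φ p.1) (Z.X p.2)).hom := by
  refine ((congrArg ((matIso e φ).hom ⊗ₘ ·) (matIso_refl Z).symm).trans
    (matIso_tensor _ _ _ _)).trans (congrArg Iso.hom ?_)
  congr 1
  ext p
  exact tensorHom_id _ _

lemma matIso_whiskerLeft {X Y : Mat_ M} (e : X.ι ≃ Y.ι) (φ : ∀ i, X.X i ≅ Y.X (e i))
    (Z : Mat_ M) : Z ◁ (matIso e φ).hom =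
      (matIso (M := Z ⊗ X) (N := Z ⊗ Y) (Equiv.prodCongr (Equiv.refl _) e)
        fun p => whiskerLeftIso (Z.X p.1) (φ p.2)).hom := by
  refine ((congrArg (· ⊗ₘ (matIso e φ).hom) (matIso_refl Z).symm).trans
    (matIso_tensor _ _ _ _)).trans (congrArg Iso.hom ?_)
  congr 1
  ext p
  exact id_tensorHom _ _

/-- The entries of a whiskered morphism. -/
lemma entry_whiskerRight {X Y : Mat_ M} (f : X ⟶ Y) (Z : Mat_ M) (i i' j j') :
    entry (f ▷ Z) (i, j) (i', j') = entry f i i' ⊗ₘ entry (𝟙 Z) j j' := rfl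

lemma entry_whiskerLeft {X Y : Mat_ M} (f : X ⟶ Y) (Z : Mat_ M) (i i' j j') :
    entry (Z ◁ f) (j, i) (j', i') = entry (𝟙 Z) j j' ⊗ₘ entry f i i' := rfl

instance : (matFunctor F).Monoidal := Functor.CoreMonoidal.toMonoidal
  { εIso := matFunctorεIso F
    μIso := matFunctorμIso F
    μIso_hom_natural_left := fun {X Y} f Z => by
      refine mat_ext fun ⟨i, j⟩ ⟨i', j'⟩ => ?_
      refine (entry_comp_matIso_hom (M := (matFunctor F).obj Y ⊗ (matFunctor F).obj Z)
        (N := (matFunctor F).obj (Y ⊗ Z)) (Equiv.refl _) _ ((matFunctor F).map f ▷ _) (i, j)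
        (i', j')).trans ?_
      refine Eq.trans ?_ (entry_matIso_hom_comp (M := (matFunctor F).obj X ⊗ (matFunctor F).obj Z)
        (N := (matFunctor F).obj (X ⊗ Z)) (Equiv.refl _) _ ((matFunctor F).map (f ▷ Z)) (i, j)
        (i', j')).symm
      refine (congrArg (fun z => (F.map (entry f i i') ⊗ₘ z) ≫ μ F _ _)
        (entry_id_matFunctor F Z j j')).trans ?_
      exact Functor.LaxMonoidal.μ_natural F _ _
    μIso_hom_natural_right := fun {X Y} Z f => by
      refine mat_ext fun ⟨j, i⟩ ⟨j', i'⟩ => ?_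
      refine (entry_comp_matIso_hom (M := (matFunctor F).obj Z ⊗ (matFunctor F).obj Y)
        (N := (matFunctor F).obj (Z ⊗ Y)) (Equiv.refl _) _ (_ ◁ (matFunctor F).map f) (j, i)
        (j', i')).trans ?_
      refine Eq.trans ?_ (entry_matIso_hom_comp (M := (matFunctor F).obj Z ⊗ (matFunctor F).obj X)
        (N := (matFunctor F).obj (Z ⊗ X)) (Equiv.refl _) _ ((matFunctor F).map (Z ◁ f)) (j, i)
        (j', i')).symm
      refine (congrArg (fun z => (z ⊗ₘ F.map (entry f i i')) ≫ μ F _ _)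
        (entry_id_matFunctor F Z j j')).trans ?_
      exact Functor.LaxMonoidal.μ_natural F _ _
    associativity := fun X Y Z => by
      refine (congrArg₂ (· ≫ ·) (matIso_whiskerRight _ _ _) (congrArg₂ (· ≫ ·) rfl
        (matFunctor_map_matIso F (X := (X ⊗ Y) ⊗ Z) (Y := X ⊗ (Y ⊗ Z)) _ _))).trans ?_
      refine Eq.trans ?_ (congrArg₂ (· ≫ ·) rfl (congrArg₂ (· ≫ ·)
        (matIso_whiskerLeft _ _ _).symm rfl))
      refine ((congrArg _ (matIso_trans _ _ _ _)).trans (matIso_trans _ _ _ _)).trans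
        (Eq.trans ?_ ((congrArg _ (matIso_trans _ _ _ _)).trans (matIso_trans _ _ _ _)).symm)
      refine matIso_hom_congr (fun _ => rfl) fun p => ?_
      refine (Category.comp_id _).trans ?_
      exact Functor.LaxMonoidal.associativity F _ _ _
    left_unitality := fun X => by
      refine Eq.trans ?_ (congrArg₂ (· ≫ ·) (matIso_whiskerRight _ _ _).symm
        (congrArg₂ (· ≫ ·) rfl
          (matFunctor_map_matIso F (X := 𝟙_ _ ⊗ X) (Y := X) _ _).symm))
      refine Eq.trans ?_ ((congrArg _ (matIso_trans _ _ _ _)).trans (matIso_trans _ _ _ _)).symm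
      refine matIso_hom_congr (fun _ => rfl) fun p => ?_
      refine (Category.comp_id _).trans ?_
      exact Functor.LaxMonoidal.left_unitality F _
    right_unitality := fun X => by
      refine Eq.trans ?_ (congrArg₂ (· ≫ ·) (matIso_whiskerLeft _ _ _).symm
        (congrArg₂ (· ≫ ·) rfl
          (matFunctor_map_matIso F (X := X ⊗ 𝟙_ _) (Y := X) _ _).symm))
      refine Eq.trans ?_ ((congrArg _ (matIso_trans _ _ _ _)).trans (matIso_trans _ _ _ _)).symm
      refine matIso_hom_congr (fun _ => rfl) fun p => ?_
      refine (Category.comp_id _).trans ?_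
      exact Functor.LaxMonoidal.right_unitality F _ }

end MatFunctor

/-! ### Families of morphisms, with a twisted associator -/

section Twist

variable (k : Type w) [Field k] (M : Type*) [Category* M] [Preadditive M] [Linear k M]
  [MonoidalCategory M] {G Q : Type*} [Group G] [Group Q] (ρ : G →* Q)

/-- A grading of a monoidal category by `G`, with scalars depending on a point of `Q` by which the
associator is to be multiplied. -/
structure Twist where
  deg : M → G
  deg_unit : deg (𝟙_ M) = 1
  deg_tensor : ∀ X Y, deg (X ⊗ Y) = deg X * deg Y
  -- Translation amounts and associator scalars depend on degrees, so naturality and interchange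
  -- require nonzero morphisms to preserve the degree.
  hom_eq_zero : ∀ {X Y : M} (f : X ⟶ Y), deg X ≠ deg Y → f = 0
  c : G → G → G → Q → kˣ
  c_one : ∀ x z b, c x 1 z b = 1
  -- The `3`-cocycle identity with coefficients in `Fun(Q, kˣ)`: translation by `ρ w` enters in the
  -- one term where an associator is tensored on the right with an object of degree `w`.
  pentagon : ∀ x y z w b,
    c x y z (ρ w * b) * c x (y * z) w b * c y z w b = c (x * y) z w b * c x y (z * w) b

variable {k M ρ}

/-- The objects of `M`, whose morphisms are families of morphisms of `M` indexed by `Q`. -/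
structure Twisted (t : Twist k M ρ) where
  obj : M

namespace Twisted

variable {t : Twist k M ρ}

instance : Category (Twisted t) where
  Hom X Y := Q → (X.obj ⟶ Y.obj)
  id X _ := 𝟙 X.obj
  comp f g b := f b ≫ g b

/-- The member at `b` of a family of morphisms. -/
def value (b : Q) {X Y : Twisted t} (f : X ⟶ Y) : X.obj ⟶ Y.obj := f b

@[ext]
lemma hom_ext {X Y : Twisted t} {f g : X ⟶ Y} (h : ∀ b, value b f = value b g) : f = g := funext h

/-- A family of morphisms. -/
def family {X Y : Twisted t} (f : Q → (X.obj ⟶ Y.obj)) : X ⟶ Y := f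

@[simp] lemma value_family {X Y : Twisted t} (f : Q → (X.obj ⟶ Y.obj)) (b : Q) :
    value b (family f) = f b := rfl

@[simp] lemma value_id (X : Twisted t) (b : Q) : value b (𝟙 X) = 𝟙 X.obj := rfl

@[simp] lemma value_comp {X Y Z : Twisted t} (f : X ⟶ Y) (g : Y ⟶ Z) (b : Q) :
    value b (f ≫ g) = value b f ≫ value b g := rfl

instance : Preadditive (Twisted t) where
  homGroup X Y := inferInstanceAs (AddCommGroup (Q → (X.obj ⟶ Y.obj)))
  add_comp _ _ _ f f' g := funext fun b => Preadditive.add_comp _ _ _ (value b f) (value b f') (value b g)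
  comp_add _ _ _ f g g' := funext fun b => Preadditive.comp_add _ _ _ (value b f) (value b g) (value b g')

instance : Linear (Q → k) (Twisted t) where
  homModule X Y := inferInstanceAs (Module (Q → k) (Q → (X.obj ⟶ Y.obj)))
  smul_comp _ _ _ p f g := funext fun b => Linear.smul_comp _ _ _ (p b) (value b f) (value b g)
  comp_smul _ _ _ f p g := funext fun b => Linear.comp_smul _ _ _ (value b f) (p b) (value b g)

@[simp] lemma value_zero (X Y : Twisted t) (b : Q) : value b (0 : X ⟶ Y) = 0 := rfl

@[simp] lemma value_add {X Y : Twisted t} (f g : X ⟶ Y) (b : Q) : value b (f + g) = value b f + value b g := rfl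

@[simp] lemma value_smul {X Y : Twisted t} (p : Q → k) (f : X ⟶ Y) (b : Q) :
    value b (p • f) = p b • value b f := rfl

lemma value_sum {X Y : Twisted t} {ι : Type*} (s : Finset ι) (f : ι → (X ⟶ Y)) (b : Q) :
    value b (∑ i ∈ s, f i) = ∑ i ∈ s, value b (f i) :=
  Finset.sum_apply b s f

/-- The constant family of isomorphisms. -/
@[simps]
def constIso {X Y : Twisted t} (e : X.obj ≅ Y.obj) : X ≅ Y where
  hom := family fun _ => e.hom
  inv := family fun _ => e.inv
  hom_inv_id := by ext; simp
  inv_hom_id := by ext; simp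

section Monoidal

variable [MonoidalPreadditive M] [MonoidalLinear k M]

instance : MonoidalCategoryStruct (Twisted t) where
  tensorObj X Y := ⟨X.obj ⊗ Y.obj⟩
  whiskerLeft X _ _ f := family fun b => X.obj ◁ value b f
  -- This translation is what turns `Fun(Q, kˣ)` into a nontrivial coefficient module.
  whiskerRight f Z := family fun b => value (ρ (t.deg Z.obj) * b) f ▷ Z.obj
  tensorUnit := ⟨𝟙_ M⟩
  associator X Y Z :=
    { hom := family fun b => (t.c (t.deg X.obj) (t.deg Y.obj) (t.deg Z.obj) b : k) •
        (α_ X.obj Y.obj Z.obj).hom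
      inv := family fun b => (((t.c (t.deg X.obj) (t.deg Y.obj) (t.deg Z.obj) b)⁻¹ : kˣ) : k) •
        (α_ X.obj Y.obj Z.obj).inv
      hom_inv_id := by ext; simp [smul_smul]
      inv_hom_id := by ext; simp [smul_smul] }
  leftUnitor X := constIso (λ_ X.obj)
  rightUnitor X := constIso (ρ_ X.obj)

@[simp] lemma tensor_obj (X Y : Twisted t) : (X ⊗ Y).obj = X.obj ⊗ Y.obj := rfl

@[simp] lemma unit_obj : (𝟙_ (Twisted t)).obj = 𝟙_ M := rfl

@[simp] lemma value_whiskerLeft (X : Twisted t) {Y Z : Twisted t} (f : Y ⟶ Z) (b : Q) :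
    value b (X ◁ f) = X.obj ◁ value b f := rfl

@[simp] lemma value_whiskerRight {X Y : Twisted t} (f : X ⟶ Y) (Z : Twisted t) (b : Q) :
    value b (f ▷ Z) = value (ρ (t.deg Z.obj) * b) f ▷ Z.obj := rfl

lemma value_tensorHom {X Y X' Y' : Twisted t} (f : X ⟶ Y) (g : X' ⟶ Y') (b : Q) :
    value b (f ⊗ₘ g) = value (ρ (t.deg X'.obj) * b) f ⊗ₘ value b g := by
  rw [MonoidalCategory.tensorHom_def]; rfl

@[simp] lemma value_associator_hom (X Y Z : Twisted t) (b : Q) : value b (α_ X Y Z).hom =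
    (t.c (t.deg X.obj) (t.deg Y.obj) (t.deg Z.obj) b : k) • (α_ X.obj Y.obj Z.obj).hom := rfl

@[simp] lemma value_associator_inv (X Y Z : Twisted t) (b : Q) : value b (α_ X Y Z).inv =
    (((t.c (t.deg X.obj) (t.deg Y.obj) (t.deg Z.obj) b)⁻¹ : kˣ) : k) •
      (α_ X.obj Y.obj Z.obj).inv := rfl

@[simp] lemma value_leftUnitor_hom (X : Twisted t) (b : Q) : value b (λ_ X).hom = (λ_ X.obj).hom := rfl

@[simp] lemma value_rightUnitor_hom (X : Twisted t) (b : Q) : value b (ρ_ X).hom = (ρ_ X.obj).hom := rfl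

instance : MonoidalCategory (Twisted t) where
  tensorHom_def _ _ := rfl
  id_tensorHom_id _ _ := by ext; simp [value_tensorHom]
  tensorHom_comp_tensorHom {X Y Z X' Y' Z'} f f' g g' := by
    ext b
    rw [value_comp, value_tensorHom, value_tensorHom, value_tensorHom, value_comp, value_comp]
    -- The left-hand factors are evaluated at points translated by the degrees of `X'` and `Y'`. If
    -- these degrees differ, then `f'` vanishes and so do both sides.
    by_cases h : t.deg X'.obj = t.deg Y'.obj
    · rw [h, tensorHom_comp_tensorHom]
    · simp [t.hom_eq_zero (value b f') h]
  whiskerLeft_id _ _ := by ext; simp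
  id_whiskerRight _ _ := by ext; simp
  associator_naturality {X₁ X₂ X₃ Y₁ Y₂ Y₃} f g h := by
    ext b
    rw [value_comp, value_comp, value_tensorHom, value_tensorHom, value_tensorHom, value_tensorHom,
      value_associator_hom, value_associator_hom, Linear.comp_smul, Linear.smul_comp,
      show ρ (t.deg (X₂ ⊗ X₃).obj) * b = ρ (t.deg X₂.obj) * (ρ (t.deg X₃.obj) * b) by
        rw [tensor_obj, t.deg_tensor, map_mul, mul_assoc]]
    refine (congrArg _ (MonoidalCategory.associator_naturality _ _ _)).trans ?_
    by_cases h₁ : t.deg X₁.obj = t.deg Y₁.obj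
    · by_cases h₂ : t.deg X₂.obj = t.deg Y₂.obj
      · by_cases h₃ : t.deg X₃.obj = t.deg Y₃.obj
        · rw [h₁, h₂, h₃]
        · simp [t.hom_eq_zero (value b h) h₃]
      · simp [t.hom_eq_zero (value _ g) h₂]
    · simp [t.hom_eq_zero (value _ f) h₁]
  leftUnitor_naturality _ := by ext; simp
  rightUnitor_naturality _ := by ext; simp [t.deg_unit]
  pentagon X Y Z W := by
    ext b
    simp [t.deg_tensor, smul_smul, ← Units.val_mul]
    congr 2
    rw [mul_comm (t.c _ _ (_ * _) _), ← t.pentagon]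
    ac_rfl
  triangle X Y := by
    ext b
    simp [t.deg_unit, t.c_one]

instance : MonoidalPreadditive (Twisted t) where
  whiskerLeft_zero := by intros; ext; simp
  zero_whiskerRight := by intros; ext; simp
  whiskerLeft_add _ _ := by ext; simp
  add_whiskerRight _ _ := by ext; simp

end Monoidal

end Twisted

end Twist

/-! ### Direct sums of twisted families and their constant morphisms. -/

section TwistedSums

open Functor.LaxMonoidal (μ ε)

/-- The linear structure on formal direct sums over a commutative ring. -/
@[reducible]
def matLinear (R : Type*) [CommRing R] (M : Type*) [Category* M] [Preadditive M] [Linear R M] :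
    Linear R (Mat_ M) where
  homModule X Y := inferInstanceAs (Module R (∀ i j, X.X i ⟶ Y.X j))
  smul_comp _ _ _ r f g := mat_ext fun i l =>
    (Finset.sum_congr rfl fun j _ => Linear.smul_comp _ _ _ r (entry f i j) (entry g j l)).trans
      (Finset.smul_sum).symm
  comp_smul _ _ _ f r g := mat_ext fun i l =>
    (Finset.sum_congr rfl fun j _ => Linear.comp_smul _ _ _ (entry f i j) r (entry g j l)).trans
      (Finset.smul_sum).symm

variable {k : Type w} [Field k] {M : Type*} [Category* M] [Preadditive M] [Linear k M]
  [MonoidalCategory M] {G Q : Type*} [Group G] [Group Q] {ρ : G →* Q} {t : Twist k M ρ}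

open Twisted

instance : Linear (Q → k) (Mat_ (Twisted t)) := matLinear _ _

lemma value_entry_smul {X Y : Mat_ (Twisted t)} (p : Q → k) (f : X ⟶ Y) (i j) (b : Q) :
    value b (entry (p • f) i j) = p b • value b (entry f i j) := rfl

lemma value_entry_id (X : Mat_ (Twisted t)) (i j : X.ι) (b b' : Q) :
    value b (entry (𝟙 X) i j) = value b' (entry (𝟙 X) i j) := by
  by_cases h : i = j
  · subst h
    rw [entry_id, value_id, value_id]
  · rw [entry_id_of_ne _ h, value_zero, value_zero]

variable (t) in
/-- The morphisms all of whose entries are constant families. -/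
def constants : MorphismProperty (Mat_ (Twisted t)) := fun _ _ f =>
  ∀ i j b b', value b (entry f i j) = value b' (entry f i j)

/-- The morphism whose entries are the constant families with the values of `f` at `b`. -/
def constAt (b : Q) {X Y : Mat_ (Twisted t)} (f : X ⟶ Y) : X ⟶ Y :=
  matOf fun i j => family fun _ => value b (entry f i j)

/-- Constant morphisms are the fixed points of `constAt b`, which preserves identities and
composition. Closure under composition and inverses follows formally. -/
lemma constants_iff {X Y : Mat_ (Twisted t)} (f : X ⟶ Y) :
    constants t f ↔ ∀ b, constAt b f = f :=
  ⟨fun h b => mat_ext fun i j => hom_ext fun b' => h i j b b', fun h i j b b' =>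
    congrArg (fun g => value b' (entry g i j)) (h b)⟩

lemma constAt_id (b : Q) (X : Mat_ (Twisted t)) : constAt b (𝟙 X) = 𝟙 X :=
  mat_ext fun i j => hom_ext fun b' => value_entry_id X i j b b'

lemma constAt_comp (b : Q) {X Y Z : Mat_ (Twisted t)} (f : X ⟶ Y) (g : Y ⟶ Z) :
    constAt b (f ≫ g) = constAt b f ≫ constAt b g := by
  refine mat_ext fun i j => hom_ext fun b' => ?_
  simp only [constAt, entry_matOf, value_family, entry_comp, value_sum, value_comp]

lemma constants_comp {X Y Z : Mat_ (Twisted t)} {f : X ⟶ Y} {g : Y ⟶ Z} (hf : constants t f)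
    (hg : constants t g) : constants t (f ≫ g) := by
  rw [constants_iff] at *
  intro b
  rw [constAt_comp, hf, hg]

lemma constants_inv {X Y : Mat_ (Twisted t)} (e : X ≅ Y) (h : constants t e.hom) :
    constants t e.inv := by
  rw [constants_iff] at *
  intro b
  -- `constAt b e.inv` is also a left inverse of `e.hom`, hence equal to `e.inv`.
  rw [← cancel_mono e.hom, e.inv_hom_id, ← constAt_id b, ← e.inv_hom_id, constAt_comp, h]

lemma constants_matIso {X Y : Mat_ (Twisted t)} (e : X.ι ≃ Y.ι) (φ : ∀ i, X.X i ≅ Y.X (e i))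
    (h : ∀ i b b', value b (φ i).hom = value b' (φ i).hom) : constants t (matIso e φ).hom := by
  intro i j b b'
  by_cases hij : e i = j
  · subst hij
    rw [entry_matIso_hom, h i b b']
  · rw [entry_matIso_hom_of_ne _ _ _ _ hij, value_zero, value_zero]

variable [MonoidalPreadditive M] [MonoidalLinear k M]

lemma value_entry_whiskerLeft (X : Mat_ (Twisted t)) {Y Z : Mat_ (Twisted t)} (f : Y ⟶ Z)
    (i i' j j') (b : Q) : value b (entry (X ◁ f) (i, j) (i', j')) =
      value b (entry (𝟙 X) i i') ⊗ₘ value b (entry f j j') := by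
  rw [entry_whiskerLeft, value_tensorHom, value_entry_id X i i' _ b]

lemma value_entry_whiskerRight {X Y : Mat_ (Twisted t)} (f : X ⟶ Y) (Z : Mat_ (Twisted t))
    (i i' j j') (b : Q) : value b (entry (f ▷ Z) (i, j) (i', j')) =
      value (ρ (t.deg (Z.X j).obj) * b) (entry f i i') ⊗ₘ value b (entry (𝟙 Z) j j') := by
  rw [entry_whiskerRight, value_tensorHom]

lemma leftLinear_twisted : LeftLinear (Q → k) (Mat_ (Twisted t)) := fun p X Y Z f => by
  refine mat_ext fun ⟨i, j⟩ ⟨i', j'⟩ => hom_ext fun b => ?_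
  rw [value_entry_smul, value_entry_whiskerLeft, value_entry_whiskerLeft, value_entry_smul,
    MonoidalCategory.tensorHom_def, MonoidalCategory.tensorHom_def, MonoidalLinear.whiskerLeft_smul,
    Linear.comp_smul]

/-- Covers both semilinearity laws: summands of degree in `ker ρ` give `p' = p`, and `T q` gives the
translate by `q`. One function `p'` must serve all summands of `Z`. -/
lemma smul_whiskerRight_twisted (p p' : Q → k) {X Y : Mat_ (Twisted t)} (f : X ⟶ Y)
    (Z : Mat_ (Twisted t)) (h : ∀ j b, p (ρ (t.deg (Z.X j).obj) * b) = p' b) :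
    (p • f) ▷ Z = p' • (f ▷ Z) := by
  refine mat_ext fun ⟨i, j⟩ ⟨i', j'⟩ => hom_ext fun b => ?_
  rw [value_entry_smul, value_entry_whiskerRight, value_entry_whiskerRight, value_entry_smul,
    MonoidalCategory.tensorHom_def, MonoidalCategory.tensorHom_def, MonoidalLinear.smul_whiskerRight,
    Linear.smul_comp, h]

lemma value_associator_congr (X Y Z : Twisted t) {b b' : Q}
    (h : t.c (t.deg X.obj) (t.deg Y.obj) (t.deg Z.obj) b =
      t.c (t.deg X.obj) (t.deg Y.obj) (t.deg Z.obj) b') :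
    value b (α_ X Y Z).hom = value b' (α_ X Y Z).hom := by
  rw [value_associator_hom, value_associator_hom, h]

variable {H : Type*} [Category* H] [Preadditive H] [MonoidalCategory H] [MonoidalPreadditive H]

/-- The morphisms with constant entries form a constant class. -/
lemma isConstantClass_constants (j : H ⥤ Twisted t) [j.Additive] [j.Monoidal]
    (hj : ∀ {X Y : H} (f : X ⟶ Y) (b b'), value b (j.map f) = value b' (j.map f))
    (hε : ∀ b b', value b (ε j) = value b' (ε j))
    (hμ : ∀ X Y b b', value b (μ j X Y) = value b' (μ j X Y))
    (hc₁ : ∀ X y z b b', t.c (t.deg (j.obj X).obj) y z b = t.c (t.deg (j.obj X).obj) y z b')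
    (hc₂ : ∀ x Y z b b', t.c x (t.deg (j.obj Y).obj) z b = t.c x (t.deg (j.obj Y).obj) z b')
    (hc₃ : ∀ x y Z b b', t.c x y (t.deg (j.obj Z).obj) b = t.c x y (t.deg (j.obj Z).obj) b') :
    IsConstantClass (matFunctor j) (constants t) where
  comp := constants_comp
  whiskerLeft := fun X {Y Z} {f} h => fun ⟨i, j⟩ ⟨i', j'⟩ b b' => by
    rw [value_entry_whiskerLeft, value_entry_whiskerLeft, h j j' b b', value_entry_id X i i' b b']
  whiskerRight := fun {Y Z} {f} X h => fun ⟨i, j⟩ ⟨i', j'⟩ b b' => by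
    rw [value_entry_whiskerRight, value_entry_whiskerRight, value_entry_id X j j' b b',
      h i i' _ (ρ (t.deg (X.X j).obj) * b')]
  inv := constants_inv
  map _ _ _ := hj _
  unit := constants_matIso _ _ fun _ => hε
  tensor _ _ := constants_matIso _ _ fun _ => hμ _ _
  associator_left X Y Z := constants_matIso _ _ fun p b b' =>
    value_associator_congr _ _ _ (hc₁ _ _ _ b b')
  associator_middle X Y Z := constants_matIso _ _ fun p b b' =>
    value_associator_congr _ _ _ (hc₂ _ _ _ b b')
  associator_right X Y Z := constants_matIso _ _ fun p b b' =>
    value_associator_congr _ _ _ (hc₃ _ _ _ b b')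
  leftUnitor X := constants_matIso _ _ fun _ _ _ => rfl
  rightUnitor X := constants_matIso _ _ fun _ _ _ => rfl

end TwistedSums

/-! ### Tensoring with objects `[1, g]`. -/

section WhiskerIso

variable {C : Type*} [Category* C] [MonoidalCategory C] {X Y E : C}

lemma whiskerRight_injective_of_iso {f g : X ⟶ Y} (e : E ≅ 𝟙_ C) (h : f ▷ E = g ▷ E) : f = g := by
  have h' : f ▷ 𝟙_ C = g ▷ 𝟙_ C := by
    rw [← cancel_epi (X ◁ e.hom), whisker_exchange, whisker_exchange, h]
  simpa using h'

lemma whiskerRight_surjective_of_iso (e : E ≅ 𝟙_ C) (φ : X ⊗ E ⟶ Y ⊗ E) :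
    ((ρ_ X).inv ≫ X ◁ e.inv ≫ φ ≫ Y ◁ e.hom ≫ (ρ_ Y).hom) ▷ E = φ := by
  have h : ((ρ_ X).inv ≫ X ◁ e.inv ≫ φ ≫ Y ◁ e.hom ≫ (ρ_ Y).hom) ▷ 𝟙_ C =
      X ◁ e.inv ≫ φ ≫ Y ◁ e.hom := by
    simp only [MonoidalCategory.whiskerRight_id, Category.assoc, Iso.hom_inv_id_assoc,
      Iso.hom_inv_id, Category.comp_id]
  rw [← cancel_mono (Y ◁ e.hom), ← whisker_exchange, h]
  simp

lemma whiskerRight_rightUnitor_leftUnitor (e : E ≅ 𝟙_ C) (f : X ⟶ Y) :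
    f ▷ E ≫ Y ◁ e.hom ≫ (ρ_ Y).hom ≫ (λ_ Y).inv =
      (X ◁ e.hom ≫ (ρ_ X).hom ≫ (λ_ X).inv) ≫ 𝟙_ C ◁ f := by
  rw [← whisker_exchange_assoc]
  simp

lemma whiskerLeft_map_id_comp (F : C ⥤ C) (X V : C) {Z : C} (f : X ⊗ F.obj V ⟶ Z) :
    X ◁ F.map (𝟙 V) ≫ 𝟙 _ ≫ f = f := by simp

lemma comp_whiskerLeft_map_id (F : C ⥤ C) (X V : C) {Z : C} (f : Z ⟶ X ⊗ F.obj V) :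
    f ≫ X ◁ F.map (𝟙 V) ≫ 𝟙 _ = f := by simp

end WhiskerIso

namespace Homogeneous

variable {k : Type w} [Field k] {G : Type*} [Group G] {C : Type u} [Category.{v} C] [Preadditive C]
  [Linear k C] [MonoidalCategory C] [MonoidalPreadditive C] [MonoidalLinear k C]
  {A : GroupAction k G C} {θ : Cocycle₃ G kˣ}

/-- In equal degrees `x`, tensoring with `[1, g]` is tensoring in `C` with `x_* 1`, which is
isomorphic to the unit. In different degrees all morphisms vanish. -/
lemma whiskerRight_unit_injective {X Y : Homogeneous A θ} {f f' : X ⟶ Y} (g : G)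
    (h : f ▷ (⟨𝟙_ C, g⟩ : Homogeneous A θ) = f' ▷ (⟨𝟙_ C, g⟩ : Homogeneous A θ)) : f = f' := by
  by_cases e : X.deg = Y.deg
  · obtain ⟨X, x⟩ := X
    obtain ⟨Y, y⟩ := Y
    obtain rfl : x = y := e
    have h' := congrArg Subtype.val h
    rw [whiskerRight_val₀, whiskerRight_val₀] at h'
    exact hom_ext (whiskerRight_injective_of_iso (Functor.Monoidal.εIso (A.act x)).symm h')
  · rw [hom_eq_zero f e, hom_eq_zero f' e]

lemma whiskerRight_unit_surjective {X Y : Homogeneous A θ} (g : G)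
    (φ : X ⊗ (⟨𝟙_ C, g⟩ : Homogeneous A θ) ⟶ Y ⊗ (⟨𝟙_ C, g⟩ : Homogeneous A θ)) :
    ∃ f : X ⟶ Y, f ▷ (⟨𝟙_ C, g⟩ : Homogeneous A θ) = φ := by
  by_cases e : X.deg = Y.deg
  · obtain ⟨X, x⟩ := X
    obtain ⟨Y, y⟩ := Y
    obtain rfl : x = y := e
    refine ⟨⟨_, fun h => absurd rfl h⟩, hom_ext ((whiskerRight_val₀ _ _).trans
      (whiskerRight_surjective_of_iso (Functor.Monoidal.εIso (A.act x)).symm φ.1))⟩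
  · exact ⟨0, by
      rw [zero_whiskerRight']
      exact (hom_eq_zero φ fun h => e (mul_right_cancel h)).symm⟩

end Homogeneous

/-- The trivial `3`-cocycle. -/
def Cocycle₃.trivial (G M : Type*) [Group G] [CommGroup M] : Cocycle₃ G M where
  toFun _ _ _ := 1
  normalized _ _ _ _ := rfl
  cocycle _ _ _ _ := by simp [Cochain₃.d]

/-- The `aᵢ` are the five factors of `dπ` containing `b`, and the `bᵢ` are the five factors of `dω`;
the hypothesis is `dπ = 1` with its last factor rewritten through `dω`. -/
lemma twist_pentagon {M : Type*} [CommGroup M] {a₁ a₂ a₃ a₄ a₅ b₁ b₂ b₃ b₄ b₅ : M}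
    (h : a₁ * a₂⁻¹ * a₃ * a₄⁻¹ * a₅ * (b₁ * b₂⁻¹ * b₃ * b₄⁻¹ * b₅)⁻¹ = 1) :
    b₅⁻¹ * a₅ * (b₃⁻¹ * a₃) * (b₁⁻¹ * a₁) = b₂⁻¹ * a₂ * (b₄⁻¹ * a₄) := by
  rw [← mul_inv_eq_one, ← h]
  simp only [mul_inv, inv_inv]
  ac_rfl

lemma units_inv_smul {k V : Type*} [Field k] [AddCommGroup V] [Module k V] {a c : kˣ} (h : c = a⁻¹)
    (f : V) : a⁻¹ • f = (c : k) • ((1 : kˣ)⁻¹ • f) := by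
  rw [inv_one, one_smul, h]
  rfl

/-! ### The twist given by `ω` and `π`, the embedding of `C ⋊_ω K`, and conjugation by `[1, g]`. -/

section CrossedTwist

open Twisted Homogeneous

variable {k : Type w} [Field k] {C : Type u} [Category.{v} C] [Preadditive C] [Linear k C]
  [MonoidalCategory C] [MonoidalPreadditive C] [MonoidalLinear k C]
  {G Q : Type*} [Group G] [Group Q]
  {π : Cocycle₄ Q kˣ} {ρ : G →* Q} (ω : Cochain₃ G kˣ)
  (hω : ∀ x y z t, ω.d x y z t = π (ρ x) (ρ y) (ρ z) (ρ t))
  (A : GroupAction k G C)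

/-- The twist of the crossed product of `G` given by `ω` and `π`. -/
def crossedTwist : Twist k (Homogeneous A (Cocycle₃.trivial G kˣ)) ρ where
  deg X := X.deg
  deg_unit := rfl
  deg_tensor _ _ := rfl
  hom_eq_zero f h := Homogeneous.hom_eq_zero f h
  c x y z b := (ω x y z)⁻¹ * π (ρ x) (ρ y) (ρ z) b
  c_one x z b := by
    rw [ω.normalized x 1 z (by simp), π.normalized _ _ _ _ (by simp), inv_one, one_mul]
  pentagon x y z w b := by
    have h₁ := hω x y z w
    have h₂ := π.cocycle (ρ x) (ρ y) (ρ z) (ρ w) b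
    simp only [Cochain₃.d] at h₁
    -- The only factor of `dπ` free of `b` is `π(ρx, ρy, ρz, ρw)`, and it is replaced by `dω(x, y,
    -- z, w)`.
    simp only [Cochain₄.d, ← h₁] at h₂
    simp only [map_mul]
    exact twist_pentagon h₂

/-- `π` is normalized and `ρ x = 1`. With one degree in `K` the scalar is independent of `b`, which
makes the associator constant; with all three in `K` it is the scalar of the associator of `C ⋊_ω
K`. -/
lemma crossedTwist_c_left (x : ρ.ker) (y z : G) (b : Q) :
    (crossedTwist ω hω A).c x y z b = (ω x y z)⁻¹ :=
  (congrArg (_ * ·) (π.normalized _ _ _ _ (Or.inl x.2))).trans (mul_one _)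

lemma crossedTwist_c_middle (x : G) (y : ρ.ker) (z : G) (b : Q) :
    (crossedTwist ω hω A).c x y z b = (ω x y z)⁻¹ :=
  (congrArg (_ * ·) (π.normalized _ _ _ _ (Or.inr (Or.inl y.2)))).trans (mul_one _)

lemma crossedTwist_c_right (x y : G) (z : ρ.ker) (b : Q) :
    (crossedTwist ω hω A).c x y z b = (ω x y z)⁻¹ :=
  (congrArg (_ * ·) (π.normalized _ _ _ _ (Or.inr (Or.inr (Or.inl z.2))))).trans (mul_one _)

variable {ω A}

/-- The object `[V, g]`. -/
abbrev gradedObj (V : C) (g : G) : Twisted (crossedTwist ω hω A) := ⟨⟨V, g⟩⟩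

variable (ω A)

/-- The inclusion of the crossed product of the kernel, by constant families. -/
def kernelInclusion : Homogeneous (A.restrict ρ.ker) (ω.restrictKer ρ π hω) ⥤
    Twisted (crossedTwist ω hω A) where
  obj X := ⟨⟨X.obj, X.deg⟩⟩
  map f := family fun _ => ⟨f.1, fun h => f.2 fun e => h (congrArg Subtype.val e)⟩

instance : (kernelInclusion ω hω A).Additive where

instance : (kernelInclusion ω hω A).Faithful where
  map_injective {X Y _ _} h := Homogeneous.hom_ext (congrArg
    (fun z : (kernelInclusion ω hω A).obj X ⟶ (kernelInclusion ω hω A).obj Y =>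
      (value (1 : Q) z).1) h)

/-- An isomorphism of `C` between the underlying objects, in equal degrees. -/
def gradedIso {X Y : Twisted (crossedTwist ω hω A)} (e : X.obj.obj ≅ Y.obj.obj)
    (h : X.obj.deg = Y.obj.deg) : X ≅ Y := constIso (mkIso e h)

lemma value_gradedIso_whiskerRight (V : C) {x y : G} (h : x = y)
    (Z : Twisted (crossedTwist ω hω A)) (b : Q) :
    (value b ((gradedIso ω hω A (X := gradedObj hω V x) (Y := gradedObj hω V y)
      (Iso.refl V) h).hom ▷ Z)).1 = V ◁ A.cast h Z.obj.obj := by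
  subst h
  refine (whiskerRight_val₀ _ _).trans ?_
  change 𝟙 V ▷ _ = _
  simp

instance : (kernelInclusion ω hω A).Monoidal := Functor.CoreMonoidal.toMonoidal
  { εIso := gradedIso ω hω A (Iso.refl (𝟙_ C)) rfl
    μIso := fun X Y => gradedIso ω hω A (Iso.refl (X.obj ⊗ (A.act X.deg).obj Y.obj)) rfl
    μIso_hom_natural_left := fun {X Y} f Z => by
      refine Twisted.hom_ext fun b => Homogeneous.hom_ext ?_
      refine (Category.comp_id _).trans (Eq.trans ?_ (Category.id_comp _).symm)
      by_cases e : X.deg = Y.deg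
      · exact (whiskerRight_val _ _ (congrArg Subtype.val e)).trans (whiskerRight_val f Z e).symm
      · exact (dif_neg fun h => e (Subtype.ext h)).trans (show (f ▷ Z).1 = 0 from dif_neg e).symm
    μIso_hom_natural_right := fun {X Y} Z f => by
      refine Twisted.hom_ext fun b => Homogeneous.hom_ext ?_
      exact (Category.comp_id _).trans (Category.id_comp _).symm
    associativity := fun X Y Z => by
      refine Twisted.hom_ext fun b => Homogeneous.hom_ext ?_
      have h₁ := value_gradedIso_whiskerRight ω hω A (X.obj ⊗ (A.act X.deg).obj Y.obj)
        (rfl : (X.deg : G) * Y.deg = _) ((kernelInclusion ω hω A).obj Z) b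
      refine (congrArg (· ≫ 𝟙 _ ≫ (α_ X Y Z).hom.1) h₁).trans ?_
      rw [A.cast_rfl, MonoidalCategory.whiskerLeft_id]
      refine ((Category.id_comp _).trans (Category.id_comp _)).trans ?_
      refine Eq.trans ?_ (comp_whiskerLeft_map_id (A.act X.deg) X.obj (Y.obj ⊗ (A.act Y.deg).obj Z.obj)
        (value b (α_ ((kernelInclusion ω hω A).obj X) ((kernelInclusion ω hω A).obj Y)
          ((kernelInclusion ω hω A).obj Z)).hom).1).symm
      refine (associator_hom_val X Y Z).trans (Eq.trans ?_
        (congrArg (((crossedTwist ω hω A).c X.deg Y.deg Z.deg b : k) • ·)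
          (associator_hom_val ((kernelInclusion ω hω A).obj X).obj
            ((kernelInclusion ω hω A).obj Y).obj ((kernelInclusion ω hω A).obj Z).obj)).symm)
      -- The scalar `ω⁻¹` lies in the associator of `C ⋊_ω K` on one side and in the twist on the
      -- other, where the underlying cocycle is trivial.
      exact units_inv_smul (crossedTwist_c_left ω hω A X.deg _ _ b) _
    left_unitality := fun X => by
      refine Twisted.hom_ext fun b => Homogeneous.hom_ext ?_
      have h₁ := value_gradedIso_whiskerRight ω hω A (𝟙_ C) (rfl : (1 : G) = 1)
        ((kernelInclusion ω hω A).obj X) b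
      refine Eq.trans ?_ (congrArg (· ≫ 𝟙 _ ≫ (λ_ X).hom.1) h₁).symm
      rw [A.cast_rfl, MonoidalCategory.whiskerLeft_id]
      exact ((Category.id_comp _).trans (Category.id_comp _)).symm
    right_unitality := fun X => by
      refine Twisted.hom_ext fun b => Homogeneous.hom_ext ?_
      exact (whiskerLeft_map_id_comp (A.act X.deg) X.obj (𝟙_ C) (ρ_ X).hom.1).symm }

lemma isConstantClass_kernelInclusion :
    IsConstantClass (matFunctor (kernelInclusion ω hω A)) (constants (crossedTwist ω hω A)) :=
  isConstantClass_constants (kernelInclusion ω hω A) (fun _ _ _ => rfl) (fun _ _ => rfl)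
    (fun _ _ _ _ => rfl)
    (fun X y z b b' => (crossedTwist_c_left ω hω A X.deg y z b).trans
      (crossedTwist_c_left ω hω A X.deg y z b').symm)
    (fun x Y z b b' => (crossedTwist_c_middle ω hω A x Y.deg z b).trans
      (crossedTwist_c_middle ω hω A x Y.deg z b').symm)
    (fun x y Z b b' => (crossedTwist_c_right ω hω A x y Z.deg b).trans
      (crossedTwist_c_right ω hω A x y Z.deg b').symm)

/-! ### Conjugation -/

/-- Conjugation by `g`, `[V, σ] ↦ [g_* V, g σ g⁻¹]`. -/
def conjFunctor (g : G) : Homogeneous (A.restrict ρ.ker) (ω.restrictKer ρ π hω) ⥤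
    Homogeneous (A.restrict ρ.ker) (ω.restrictKer ρ π hω) where
  obj X := ⟨(A.act g).obj X.obj, MulAut.conjNormal g X.deg⟩
  map f := ⟨(A.act g).map f.1, fun h =>
    (congrArg (A.act g).map (f.2 fun e => h (congrArg (MulAut.conjNormal g) e))).trans
      ((A.act g).map_zero _ _)⟩
  map_id X := Homogeneous.hom_ext ((A.act g).map_id X.obj)
  map_comp f f' := Homogeneous.hom_ext ((A.act g).map_comp f.1 f'.1)

instance (g : G) : (conjFunctor ω hω A g).Additive where
  map_add := Homogeneous.hom_ext (A.act g).map_add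

instance (g : G) : (conjFunctor ω hω A g).Linear k where
  map_smul f r := Homogeneous.hom_ext ((A.act g).map_smul r f.1)

instance (g : G) : (conjFunctor ω hω A g).Faithful where
  map_injective h := Homogeneous.hom_ext ((A.act g).map_injective (congrArg Subtype.val h))

instance (g : G) : (conjFunctor ω hω A g).Full where
  map_surjective f := ⟨⟨(A.act g).preimage f.1, fun h => (A.act g).map_injective
    (((A.act g).map_preimage f.1).trans ((f.2 fun e => h ((MulAut.conjNormal g).injective e)).trans
      ((A.act g).map_zero _ _).symm))⟩,
    Homogeneous.hom_ext ((A.act g).map_preimage f.1)⟩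

instance (g : G) : (conjFunctor ω hω A g).EssSurj where
  mem_essImage Y := ⟨⟨(A.act g).objPreimage Y.obj, (MulAut.conjNormal g).symm Y.deg⟩,
    ⟨mkIso ((A.act g).objObjPreimageIso Y.obj) ((MulAut.conjNormal g).apply_symm_apply Y.deg)⟩⟩

instance (g : G) : (conjFunctor ω hω A g).IsEquivalence where

/-- The half braiding of `[1, g]`. -/
def conjBraid (g : G) (X : Homogeneous (A.restrict ρ.ker) (ω.restrictKer ρ π hω)) :
    (kernelInclusion ω hω A).obj ((conjFunctor ω hω A g).obj X) ⊗ gradedObj hω (𝟙_ C) g ≅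
      gradedObj hω (𝟙_ C) g ⊗ (kernelInclusion ω hω A).obj X :=
  gradedIso ω hω A (whiskerLeftIso ((A.act g).obj X.obj)
      (Functor.Monoidal.εIso (A.act (MulAut.conjNormal g X.deg : ρ.ker))).symm ≪≫
      ρ_ _ ≪≫ (λ_ _).symm) (by
    change ((MulAut.conjNormal g X.deg : ρ.ker) : G) * g = g * X.deg
    simp)

lemma conjBraid_naturality (g : G)
    {X Y : Homogeneous (A.restrict ρ.ker) (ω.restrictKer ρ π hω)} (f : X ⟶ Y) :
    Square (gradedObj hω (𝟙_ C) g) (conjBraid ω hω A g X).hom (conjBraid ω hω A g Y).hom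
      ((kernelInclusion ω hω A).map ((conjFunctor ω hω A g).map f))
      ((kernelInclusion ω hω A).map f) := by
  by_cases e : X.deg = Y.deg
  · obtain ⟨X, x⟩ := X
    obtain ⟨Y, y⟩ := Y
    obtain rfl : x = y := e
    refine Twisted.hom_ext fun b => Homogeneous.hom_ext ?_
    refine (congrArg (· ≫ _) (whiskerRight_val₀ _ _)).trans ?_
    exact whiskerRight_rightUnitor_leftUnitor (Functor.Monoidal.εIso
      (A.act (MulAut.conjNormal g x : ρ.ker))).symm ((A.act g).map f.1)
  · obtain rfl : f = 0 := Homogeneous.hom_eq_zero f e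
    simp [Square]

end CrossedTwist

/-! ### Direct sums with one summand. -/

section Single

variable {M : Type*} [Category* M] [Preadditive M]

/-- A direct sum with one summand. -/
def single (x : M) : Mat_ M := ⟨PUnit, fun _ => x⟩

variable [MonoidalCategory M] [MonoidalPreadditive M]

lemma entry_whiskerRight_single {X Y : Mat_ M} (f : X ⟶ Y) (x : M) (i j) (a a' : PUnit) :
    entry (f ▷ single x) (i, a) (j, a') = entry f i j ▷ x :=
  (congrArg (entry f i j ⊗ₘ ·) (entry_id (single x) a)).trans (tensorHom_id _ _)

lemma entry_whiskerLeft_single {X Y : Mat_ M} (f : X ⟶ Y) (x : M) (i j) (a a' : PUnit) :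
    entry (single x ◁ f) (a, i) (a', j) = x ◁ entry f i j :=
  (congrArg (· ⊗ₘ entry f i j) (entry_id (single x) a)).trans (id_tensorHom _ _)

/-- An isomorphism between tensor products of two homogeneous objects. -/
def singleTensorIso {x y x' y' : M} (φ : x ⊗ y ≅ x' ⊗ y') :
    single x ⊗ single y ≅ single x' ⊗ single y' :=
  matIso (M := single x ⊗ single y) (N := single x' ⊗ single y') (Equiv.refl _) fun _ => φ

/-- An isomorphism between the unit and the tensor product of two homogeneous objects. -/
def singleUnitIso {x y : M} (φ : x ⊗ y ≅ 𝟙_ M) : single x ⊗ single y ≅ 𝟙_ (Mat_ M) :=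
  matIso (M := single x ⊗ single y) (N := 𝟙_ (Mat_ M)) (Equiv.punitProd PUnit) fun _ => φ

/-- The symmetry of a direct sum with a single summand given by the symmetries of its entries. -/
def singleBraid {X Y : Mat_ M} (e : X.ι ≃ Y.ι) (x : M) (φ : ∀ i, X.X i ⊗ x ≅ x ⊗ Y.X (e i)) :
    X ⊗ single x ≅ single x ⊗ Y :=
  matIso (M := X ⊗ single x) (N := single x ⊗ Y)
    ((Equiv.prodComm _ _).trans (Equiv.prodCongr (Equiv.refl PUnit) e)) fun p => φ p.1

lemma singleBraid_naturality {X Y X' Y' : Mat_ M} (e : X.ι ≃ Y.ι) (e' : X'.ι ≃ Y'.ι) (x : M)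
    (φ : ∀ i, X.X i ⊗ x ≅ x ⊗ Y.X (e i)) (φ' : ∀ i, X'.X i ⊗ x ≅ x ⊗ Y'.X (e' i))
    (f : X ⟶ X') (g : Y ⟶ Y')
    (h : ∀ i j, Square x (φ i).hom (φ' j).hom (entry f i j) (entry g (e i) (e' j))) :
    Square (single x) (singleBraid e x φ).hom (singleBraid e' x φ').hom f g := by
  refine mat_ext fun ⟨i, a⟩ ⟨a', j'⟩ => ?_
  obtain ⟨j, rfl⟩ := e'.surjective j'
  refine (entry_comp_matIso_hom (M := X' ⊗ single x) (N := single x ⊗ Y')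
    ((Equiv.prodComm _ _).trans (Equiv.prodCongr (Equiv.refl PUnit) e')) (fun p => φ' p.1)
    (f ▷ single x) (i, a) (j, a')).trans ?_
  refine Eq.trans ?_ (entry_matIso_hom_comp (M := X ⊗ single x) (N := single x ⊗ Y)
    ((Equiv.prodComm _ _).trans (Equiv.prodCongr (Equiv.refl PUnit) e)) (fun p => φ p.1)
    (single x ◁ g) (i, a) (a', e' j)).symm
  refine (congrArg (· ≫ (φ' j).hom) (entry_whiskerRight_single f x i j a a')).trans ?_
  refine Eq.trans ?_ (congrArg ((φ i).hom ≫ ·)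
    (entry_whiskerLeft_single g x (e i) (e' j) a a')).symm
  exact h i j

end Single

/-! ### The conjugation system of the crossed product. -/

section Crossed

open Twisted Homogeneous

variable {k : Type w} [Field k] {C : Type u} [Category.{v} C] [Preadditive C] [Linear k C]
  [MonoidalCategory C] [MonoidalPreadditive C] [MonoidalLinear k C]
  {G Q : Type*} [Group G] [Group Q]
  {π : Cocycle₄ Q kˣ} {ρ : G →* Q} (ω : Cochain₃ G kˣ)
  (hω : ∀ x y z t, ω.d x y z t = π (ρ x) (ρ y) (ρ z) (ρ t))
  (A : GroupAction k G C)

/-- The object `[1, σ]` of the crossed product. -/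
def kernelObj (σ : ρ.ker) : Homogeneous (A.restrict ρ.ker) (ω.restrictKer ρ π hω) := ⟨𝟙_ C, σ⟩

/-- The object `[1, σ]` of the crossed product is invertible. -/
lemma single_kernelObj_invertible (σ : ρ.ker) :
    ∃ U' : CrossedProduct (A.restrict ρ.ker) (ω.restrictKer ρ π hω),
      Nonempty (single (kernelObj ω hω A σ) ⊗ U' ≅ 𝟙_ _) ∧
      Nonempty (U' ⊗ single (kernelObj ω hω A σ) ≅ 𝟙_ _) := by
  have h (τ τ' : ρ.ker) (e : τ * τ' = 1) :
      Nonempty (single (kernelObj ω hω A τ) ⊗ single (kernelObj ω hω A τ') ≅ 𝟙_ _) :=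
    ⟨singleUnitIso (mkIso (whiskerLeftIso (𝟙_ C)
      (Functor.Monoidal.εIso ((A.restrict ρ.ker).act τ)).symm ≪≫ λ_ _) e)⟩
  exact ⟨_, h σ σ⁻¹ (mul_inv_cancel σ), h σ⁻¹ σ (inv_mul_cancel σ)⟩

lemma rightFaithful_single (g : G) :
    RightFaithful (single (gradedObj hω (𝟙_ C) g : Twisted (crossedTwist ω hω A))) := by
  intro X Y f f' h
  refine mat_ext fun i j => Twisted.hom_ext fun b => ?_
  -- Tensoring with `[1, g]` translates the index by `ρ g`, so the value of `f` at `b` is read off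
  -- at `(ρ g)⁻¹ b`.
  have h' : value ((ρ g)⁻¹ * b) (entry f i j ▷ gradedObj hω (𝟙_ C) g) =
      value ((ρ g)⁻¹ * b) (entry f' i j ▷ gradedObj hω (𝟙_ C) g) := by
    rw [← entry_whiskerRight_single f _ i j PUnit.unit PUnit.unit, h,
      entry_whiskerRight_single]
  have e : ρ ((crossedTwist ω hω A).deg (gradedObj hω (𝟙_ C) g).obj) * ((ρ g)⁻¹ * b) = b :=
    mul_inv_cancel_left _ _
  rw [value_whiskerRight, value_whiskerRight, e] at h'
  exact whiskerRight_unit_injective g h'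

lemma full_single (g : G) {X Y : CrossedProduct (A.restrict ρ.ker) (ω.restrictKer ρ π hω)}
    (φ : (matFunctor (kernelInclusion ω hω A)).obj X ⊗ single (gradedObj hω (𝟙_ C) g) ⟶
      (matFunctor (kernelInclusion ω hω A)).obj Y ⊗ single (gradedObj hω (𝟙_ C) g))
    (h : constants (crossedTwist ω hω A) φ) :
    ∃ f, (matFunctor (kernelInclusion ω hω A)).map f ▷ single (gradedObj hω (𝟙_ C) g) = φ := by
  -- The entries are lifted at the single index `1`; constancy of `φ` makes these lifts valid at
  -- every index.
  choose f hf using fun (i : X.ι) (j : Y.ι) => whiskerRight_unit_surjective g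
    (X := ((kernelInclusion ω hω A).obj (X.X i)).obj)
    (Y := ((kernelInclusion ω hω A).obj (Y.X j)).obj)
    (value (1 : Q) (entry φ (i, PUnit.unit) (j, PUnit.unit)))
  -- The lifts are found among objects graded by `G`; they are morphisms graded by `K` because
  -- degrees in `K` are equal once equal in `G`.
  refine ⟨matOf fun i j => ⟨(f i j).1, fun e => (f i j).2 fun e' => e (Subtype.ext e')⟩,
    mat_ext fun ⟨i, a⟩ ⟨j, a'⟩ => Twisted.hom_ext fun b => ?_⟩
  refine (congrArg (value b) (entry_whiskerRight_single _ _ i j a a')).trans ?_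
  exact (hf i j).trans (h (i, a) (j, a') 1 b)

lemma eval_single (p p' : Q → k) (g : G)
    {X Y : CrossedProduct (A.restrict ρ.ker) (ω.restrictKer ρ π hω)} (f f' : X ⟶ Y)
    (h : p • ((matFunctor (kernelInclusion ω hω A)).map f ▷ single (gradedObj hω (𝟙_ C) g)) =
      p' • ((matFunctor (kernelInclusion ω hω A)).map f' ▷ single (gradedObj hω (𝟙_ C) g))) :
    p 1 • f = p' 1 • f' := by
  refine mat_ext fun i j => Homogeneous.hom_ext ?_
  have e (f : X ⟶ Y) := congrArg (value (1 : Q)) (entry_whiskerRight_single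
    ((matFunctor (kernelInclusion ω hω A)).map f) (gradedObj hω (𝟙_ C) g) i j PUnit.unit PUnit.unit)
  have h' : p 1 • value 1 ((kernelInclusion ω hω A).map (entry f i j) ▷ gradedObj hω (𝟙_ C) g) =
      p' 1 • value 1 ((kernelInclusion ω hω A).map (entry f' i j) ▷ gradedObj hω (𝟙_ C) g) :=
    ((congrArg (p 1 • ·) (e f).symm).trans (congrArg (fun z : _ ⊗ _ ⟶ _ ⊗ _ =>
      value (1 : Q) (entry z (i, PUnit.unit) (j, PUnit.unit))) h)).trans
      (congrArg (p' 1 • ·) (e f'))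
  rw [value_whiskerRight, value_whiskerRight, ← MonoidalLinear.smul_whiskerRight,
    ← MonoidalLinear.smul_whiskerRight] at h'
  have h'' := whiskerRight_unit_injective g h'
  have h₃ := Subtype.ext_iff.mp h''
  exact h₃

lemma inv_smul_units_smul {V : Type*} [AddCommGroup V] [Module k V] (a p : kˣ) (f : V) :
    p⁻¹ • (((a * p : kˣ) : k) • f) = (a : k) • f := by
  rw [Units.smul_def, smul_smul, ← Units.val_mul, mul_comm, mul_inv_cancel_right]

/-- The associator has value `ω(x,y,z)⁻¹ π(ρx,ρy,ρz,b)` times a fixed morphism. Dividing it by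
`π(ρx,ρy,ρz,·)` leaves a constant isomorphism, whose inverse is the morphism in question. -/
lemma smul_associator_single (x y z : G) : constants (crossedTwist ω hω A)
    ((fun b => (π (ρ x) (ρ y) (ρ z) b : k)) • (α_ (single (gradedObj hω (𝟙_ C) x))
      (single (gradedObj hω (𝟙_ C) y)) (single (gradedObj hω (𝟙_ C) z))).inv) := by
  have h : constants (crossedTwist ω hω A) (smulIso (ConjugationSystem.scalar π (ρ x) (ρ y) (ρ z))⁻¹
      (α_ (single (gradedObj hω (𝟙_ C) x)) (single (gradedObj hω (𝟙_ C) y))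
        (single (gradedObj hω (𝟙_ C) z)))).hom := by
    intro i j b b'
    have e (b : Q) : value b (entry (smulIso (ConjugationSystem.scalar π (ρ x) (ρ y) (ρ z))⁻¹
        (α_ (single (gradedObj hω (𝟙_ C) x)) (single (gradedObj hω (𝟙_ C) y))
          (single (gradedObj hω (𝟙_ C) z)))).hom i j) = (((ω x y z)⁻¹ : kˣ) : k) •
          (α_ (gradedObj hω (𝟙_ C) x).obj (gradedObj hω (𝟙_ C) y).obj
            (gradedObj hω (𝟙_ C) z).obj).hom := by
      have e₁ := entry_matIso_hom (M := (single (gradedObj hω (𝟙_ C) x) ⊗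
        single (gradedObj hω (𝟙_ C) y)) ⊗ single (gradedObj hω (𝟙_ C) z))
        (N := single (gradedObj hω (𝟙_ C) x) ⊗ single (gradedObj hω (𝟙_ C) y) ⊗
          single (gradedObj hω (𝟙_ C) z)) (Equiv.prodAssoc _ _ _)
        (fun _ => α_ (gradedObj hω (𝟙_ C) x) (gradedObj hω (𝟙_ C) y) (gradedObj hω (𝟙_ C) z)) i
      refine (congrArg (fun f => ((π (ρ x) (ρ y) (ρ z) b)⁻¹ : kˣ) • value b f) e₁).trans ?_
      exact inv_smul_units_smul _ _ _
    exact (e b).trans (e b').symm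
  have h' := constants_inv _ h
  rw [smulIso_inv, inv_inv] at h'
  exact h'

section system

variable {s : Q → G} (hs : ∀ q, ρ (s q) = q)

/-- The cocycle of a section of `ρ`. -/
def sectionCocycle {q r p : Q} (h : q * r = p) : ρ.ker :=
  ⟨s q * s r * (s p)⁻¹, by rw [MonoidHom.mem_ker, map_mul, map_mul, map_inv, hs, hs, hs, h]; simp⟩

/-- The conjugation system of the crossed product. -/
def crossedSystem :
    ConjugationSystem k (CrossedProduct (A.restrict ρ.ker) (ω.restrictKer ρ π hω))
      (Mat_ (Twisted (crossedTwist ω hω A))) π where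
  J := matFunctor (kernelInclusion ω hω A)
  W := constants _
  isConstantClass := isConstantClass_kernelInclusion ω hω A
  T q := single (gradedObj hω (𝟙_ C) (s q))
  rightFaithful q := rightFaithful_single ω hω A (s q)
  full q X Y φ h := full_single ω hω A (s q) φ h
  leftLinear := leftLinear_twisted
  smul_whiskerRight_J p X Y f V := smul_whiskerRight_twisted p p f _ fun j b =>
    congrArg p ((congrArg (· * b) (V.X j).deg.2).trans (one_mul b))
  smul_whiskerRight_T p X Y f q := smul_whiskerRight_twisted p _ f _ fun j b =>
    congrArg (fun x => p (x * b)) (hs q)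
  eval p p' q X Y f f' h := eval_single ω hω A p p' (s q) f f' h
  F q := matFunctor (conjFunctor ω hω A (s q))
  additive _ := inferInstance
  linear _ := inferInstance
  isEquivalence _ := inferInstance
  β q V := singleBraid (X := (matFunctor (kernelInclusion ω hω A)).obj
      ((matFunctor (conjFunctor ω hω A (s q))).obj V))
    (Y := (matFunctor (kernelInclusion ω hω A)).obj V) (Equiv.refl V.ι)
    (gradedObj hω (𝟙_ C) (s q)) fun i =>
    conjBraid ω hω A (s q) (V.X i)
  β_naturality q V V' f := singleBraid_naturality _ _ _ _ _ _ _ fun i j =>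
    conjBraid_naturality ω hω A (s q) (entry f i j)
  β_constant q V := constants_matIso _ _ fun _ _ _ => rfl
  U h := single (kernelObj ω hω A (sectionCocycle hs h))
  U_invertible h := single_kernelObj_invertible ω hω A _
  -- Both sides have degree `s(q)s(r)`, and their underlying objects are `1 ⊗ s(q)_* 1` and `1 ⊗ u_*
  -- 1` with `u = s(q)s(r)s(p)⁻¹`; the units of the two functors identify them. No scalar is needed
  -- in the comparison.
  θ {q r p} h := singleTensorIso (gradedIso ω hω A (X := gradedObj hω (𝟙_ C) (s q) ⊗
      gradedObj hω (𝟙_ C) (s r)) (Y := (kernelInclusion ω hω A).obj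
        (kernelObj ω hω A (sectionCocycle hs h)) ⊗ gradedObj hω (𝟙_ C) (s p))
    (whiskerLeftIso (𝟙_ C) ((Functor.Monoidal.εIso (A.act (s q))).symm ≪≫
      Functor.Monoidal.εIso (A.act (sectionCocycle hs h : ρ.ker))))
    (inv_mul_cancel_right (s q * s r) (s p)).symm)
  θ_constant h := constants_matIso _ _ fun _ _ _ => rfl
  -- The section is not assumed to satisfy `s(1) = 1`, so `ι` is carried by `[1, s(1)⁻¹]`, which
  -- corrects `T 1 = [1, s(1)]` to the unit.
  U₀ := single (kernelObj ω hω A ⟨(s 1)⁻¹, by rw [MonoidHom.mem_ker, map_inv, hs, inv_one]⟩)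
  U₀_invertible := single_kernelObj_invertible ω hω A _
  θ₀ := (singleUnitIso (gradedIso ω hω A (X := (kernelInclusion ω hω A).obj
      (kernelObj ω hω A ⟨(s 1)⁻¹, by rw [MonoidHom.mem_ker, map_inv, hs, inv_one]⟩) ⊗
        gradedObj hω (𝟙_ C) (s 1)) (Y := 𝟙_ _)
    (whiskerLeftIso (𝟙_ C) (Functor.Monoidal.εIso (A.act (s 1)⁻¹)).symm ≪≫ λ_ _)
    (inv_mul_cancel (s 1)))).symm
  θ₀_constant := constants_inv _ (constants_matIso _ _ fun _ _ _ => rfl)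
  associator_constant q r t := by
    have h := smul_associator_single ω hω A (s q) (s r) (s t)
    rw [hs, hs, hs] at h
    exact h

end system

end Crossed

end Anomalous

end

theorem theorem1 {k : Type*} [Field k] {C : Type*} [Category C] [Preadditive C] [Linear k C]
    [MonoidalCategory C] [MonoidalPreadditive C] [MonoidalLinear k C]
    {G Q : Type*} [Group G] [Group Q]
    (π : Anomalous.Cocycle₄ Q kˣ) (ρ : G →* Q) (hρ : Function.Surjective ρ)
    (ω : Anomalous.Cochain₃ G kˣ)
    (hω : ∀ x y z t, ω.d x y z t = π (ρ x) (ρ y) (ρ z) (ρ t))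
    (A : Anomalous.GroupAction k G C) :
    Nonempty (Anomalous.AnomalousAction k
      (Anomalous.CrossedProduct (A.restrict ρ.ker) (ω.restrictKer ρ π hω)) π) := by
  -- Surjectivity of `ρ` enters only through a set-theoretic section, which need not be
  -- multiplicative.
  obtain ⟨s, hs⟩ := hρ.hasRightInverse
  exact ⟨(Anomalous.crossedSystem ω hω A hs).action⟩
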